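/- Let $c,d\in\{-1,0,1\}$ and $f(x,y,z)=-dx^2-cxy-y^2+z$, and consider the discontinuous piecewise linear system in $\mathbb{R}^3$ $$(\dot x,\dot y,\dot z)=\begin{cases}X_0^+(x,y,z)+\varepsilon X_1^+(x,y,z), & f(x,y,z)>0,\\ X_0^-(x,y,z)+\varepsilon X_1^-(x,y,z), & f(x,y,z)<0,\end{cases}\qquad X_0^{\pm}(x,y,z)=(x,\,-z\mp1,\,x+y),$$ where $X_1^{\pm}$ are affine vector fields, $X_1^\pm(p)=b^\pm+A^\pm p$ with $b^\pm\in\mathbb{R}^3$ and $A^\pm\in\mathbb{R}^{3\times3}$. On the switching manifold $\Sigma=\{f=0\}$ Filippov's convention is used. A crossing point is a point of $\Sigma$ at which the derivatives of $f$ along the $+$ field and along the $-$ field are nonzero and have the same sign; a crossing periodic orbit is the image of a nonconstant periodic solution which meets $\Sigma$, and only at crossing points; a limit cycle is a crossing periodic orbit with a neighbourhood that contains no other periodic orbit. (i) For $\varepsilon=0$ the plane $\mathcal S=\{(x,y,z)\in\mathbb{R}^3: x=0\}$ is invariant and contains the period annulus $\mathcal A=\mathcal A_1\cup\mathcal A_2$,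 where $$\mathcal A_1=\{(0,y,z): y^2+(z-1)^2>1,\ z\le y^2\},\qquad \mathcal A_2=\{(0,y,z): y^2+(z+1)^2>5,\ z\ge y^2\}.$$ That is, there is a homeomorphism from the open annulus $\mathbb{S}^1\times(1,\infty)$ onto $\mathcal A$ that maps each circle $\mathbb{S}^1\times\{r\}$ onto a crossing periodic orbit. Moreover, every crossing periodic orbit of the unperturbed system is contained in $\mathcal A$. (ii) There are affine vector fields $X_1^{+}$ and $X_1^-$, seven distinct crossing periodic orbits $\Gamma_1,\dots,\Gamma_7\subset\mathcal A$ of the unperturbed system, and $\varepsilon_0>0$ such that for every $\varepsilon$ with $0<|\varepsilon|<\varepsilon_0$ the system has seven distinct limit cycles $\Gamma_1^{\varepsilon},\dots,\Gamma_7^{\varepsilon}$, and $\Gamma_i^\varepsilon\to\Gamma_i$ in the Hausdorff distance as $\varepsilon\to0$, for $i=1,\dots,7$. -/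

import Mathlib

open Set Filter Topology
open scoped Matrix

/-- The phase space `ℝ³`, with coordinates `p 0 = x`, `p 1 = y`, `p 2 = z`. -/
abbrev Space3 : Type := Fin 3 → ℝ

/-- A piecewise smooth system `ṗ = Xp p` where `h p > 0`, `ṗ = Xm p` where `h p < 0`;
the switching manifold is `h = 0`. -/
structure PiecewiseSystem where
  h : Space3 → ℝ
  Xp : Space3 → Space3
  Xm : Space3 → Space3

namespace PiecewiseSystem

/-- The switching manifold `Σ = h⁻¹(0)`. -/
def switchingManifold (Z : PiecewiseSystem) : Set Space3 := {p | Z.h p = 0}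

/-- The Lie derivative of `h` along `Xp`. -/
noncomputable def liePlus (Z : PiecewiseSystem) (p : Space3) : ℝ := fderiv ℝ Z.h p (Z.Xp p)

/-- The Lie derivative of `h` along `Xm`. -/
noncomputable def lieMinus (Z : PiecewiseSystem) (p : Space3) : ℝ := fderiv ℝ Z.h p (Z.Xm p)

/-- A crossing point: a point of `Σ` at which both fields are transversal to `Σ` and point to the
same side of it. -/
def IsCrossingPoint (Z : PiecewiseSystem) (p : Space3) : Prop :=
  p ∈ Z.switchingManifold ∧ 0 < Z.liePlus p * Z.lieMinus p

/-- Filippov's set of admissible velocities at `p`. -/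
def velocities (Z : PiecewiseSystem) (p : Space3) : Set Space3 :=
  {v | (0 < Z.h p → v = Z.Xp p) ∧ (Z.h p < 0 → v = Z.Xm p) ∧
    (Z.h p = 0 → v ∈ segment ℝ (Z.Xm p) (Z.Xp p))}

/-- `γ` is a solution on the set of times `I` (in practice an open interval): at each time both
one-sided derivatives exist and are admissible velocities. Off `Σ` this says that `γ` is
differentiable and solves the differential equation of the side on which it lies. -/
def IsSolutionOn (Z : PiecewiseSystem) (γ : ℝ → Space3) (I : Set ℝ) : Prop :=
  ∀ t ∈ I, (∃ v ∈ Z.velocities (γ t), HasDerivWithinAt γ v (Iic t) t) ∧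
    (∃ v ∈ Z.velocities (γ t), HasDerivWithinAt γ v (Ici t) t)

/-- `S` is invariant: a solution on an open interval that is in `S` at one time is in `S` at all
times. -/
def IsInvariant (Z : PiecewiseSystem) (S : Set Space3) : Prop :=
  ∀ (γ : ℝ → Space3) (I : Set ℝ), IsOpen I → I.OrdConnected → Z.IsSolutionOn γ I →
    (∃ t ∈ I, γ t ∈ S) → ∀ t ∈ I, γ t ∈ S

/-- `Γ` is a periodic orbit: the image of a nonconstant periodic solution. -/
def IsPeriodicOrbit (Z : PiecewiseSystem) (Γ : Set Space3) : Prop :=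
  ∃ (γ : ℝ → Space3) (T : ℝ), 0 < T ∧ Z.IsSolutionOn γ univ ∧ Function.Periodic γ T ∧
    (∃ t, γ t ≠ γ 0) ∧ Γ = range γ

/-- `Γ` is a crossing periodic orbit: a periodic orbit that meets `Σ`, and meets it only at
crossing points. -/
def IsCrossingPeriodicOrbit (Z : PiecewiseSystem) (Γ : Set Space3) : Prop :=
  Z.IsPeriodicOrbit Γ ∧ (Γ ∩ Z.switchingManifold).Nonempty ∧
    ∀ p ∈ Γ ∩ Z.switchingManifold, Z.IsCrossingPoint p

/-- `Γ` is a (crossing) limit cycle: a crossing periodic orbit with a neighbourhood that contains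
no other periodic orbit. -/
def IsLimitCycle (Z : PiecewiseSystem) (Γ : Set Space3) : Prop :=
  Z.IsCrossingPeriodicOrbit Γ ∧
    ∃ U : Set Space3, IsOpen U ∧ Γ ⊆ U ∧ ∀ Γ', Z.IsPeriodicOrbit Γ' → Γ' ⊆ U → Γ' = Γ

/-- `A` is a period annulus: it is homeomorphic to an open annulus, in such a way that the
concentric circles of the annulus correspond to crossing periodic orbits. -/
def IsPeriodAnnulus (Z : PiecewiseSystem) (A : Set Space3) : Prop :=
  ∃ Φ : (Circle × Ioi (1 : ℝ)) ≃ₜ A,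
    ∀ r : Ioi (1 : ℝ), Z.IsCrossingPeriodicOrbit (range fun θ : Circle => (Φ (θ, r) : Space3))

end PiecewiseSystem

/-- The fields `(x, -z ∓ 1, x + y)`; `s = 1` gives the field `X⁺`, `s = -1` the field `X⁻`. -/
def baseField (s : ℝ) (p : Space3) : Space3 := ![p 0, -p 2 - s, p 0 + p 1]

/-- The switching function `-d x² - c x y - y² + z`. -/
def switchingFunction (c d : ℝ) (p : Space3) : ℝ :=
  -d * p 0 ^ 2 - c * p 0 * p 1 - p 1 ^ 2 + p 2

/-- The unperturbed system. -/
def unperturbedSystem (c d : ℝ) : PiecewiseSystem where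
  h := switchingFunction c d
  Xp := baseField 1
  Xm := baseField (-1)

/-- The system perturbed by `ε` times the affine fields `p ↦ bp + Ap p` (where `h > 0`) and
`p ↦ bm + Am p` (where `h < 0`). -/
def perturbedSystem (c d : ℝ) (bp bm : Space3) (Ap Am : Matrix (Fin 3) (Fin 3) ℝ) (ε : ℝ) :
    PiecewiseSystem where
  h := switchingFunction c d
  Xp := fun p => baseField 1 p + ε • (bp + Ap *ᵥ p)
  Xm := fun p => baseField (-1) p + ε • (bm + Am *ᵥ p)

/-- The plane `x = 0`. -/
def planeS : Set Space3 := {p | p 0 = 0}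

/-- The part of the annulus on or below the parabola `z = y²`. -/
def annulusOne : Set Space3 := {p | p 0 = 0 ∧ 1 < p 1 ^ 2 + (p 2 - 1) ^ 2 ∧ p 2 ≤ p 1 ^ 2}

/-- The part of the annulus on or above the parabola `z = y²`. -/
def annulusTwo : Set Space3 := {p | p 0 = 0 ∧ 5 < p 1 ^ 2 + (p 2 + 1) ^ 2 ∧ p 1 ^ 2 ≤ p 2}

/-! In the invariant plane `x = 0` both fields rotate with unit speed, the `+` field about `(y, z) =
(0, -1)` and the `-` field about `(0, 1)`. For `y > 1` the two circular arcs through the points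
`(±y, y²)` of the parabola `z = y²` close up to a crossing periodic orbit; for smaller `y` the `-`
arc returns to the parabola at a point that is not a crossing point. Since `x' = x`, a periodic
orbit of the unperturbed system lies in `x = 0`, so these are all the crossing ones
(`exists_eq_unperturbedOrbit`). The region inside an orbit is the intersection of two discs, which
gives the first integral `levelFunction` and polar coordinates on the annulus.

The perturbed orbits lie at distance of order `ε` from the plane, hence the scaling `x = ε ξ`. In
the coordinates `(ξ, y)` on the switching manifold the return map is `C²` up to `ε = 0`, where it
preserves `y` and is affine in `ξ` with a multiplier greater than `1`. So at `ε = 0` there is a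
curve `ξ = fixedXi v y` of fixed points, and the first-order change of `y` along it is `melnikov c v
y`, computed from the balance of the squared radii `y² + (z ± 1)²`. A Lyapunov–Schmidt argument
(`exists_isolated_fixed_point`) continues a simple zero of `melnikov` to fixed points for `ε ≠ 0`.
The eigenvalues there are positive and different from `1`, which makes the fixed point isolated
among all periodic points. To exclude every other Filippov periodic orbit nearby, a neighbourhood is
chosen that meets the switching manifold in crossing points only and contains no periodic orbit that
avoids the manifold (`IsTwoArc.isLimitCycle`). The result is `exists_limitCycle_of_melnikov`.

The perturbations form a family with eight parameters `v`, on which `melnikov` depends linearly. If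
no `v ≠ 0` gives the zero function on `y > 1`, then the values at eight suitable points can be
prescribed; alternating signs force seven zeros, and a one-dimensional Sard argument makes them
simple (`exists_seven_simple_zeros`). The independence, `eq_zero_of_melnikov`, rests on analytic
continuation. With `y = tan θ`, passing from `θ` to `θ + π` restores `y` and the `+` half time but
adds `2π` to the `-` half time. A relation that holds for `y > 1` thus persists with `b + 2πk` in
place of the half time `b`, for all `k`, and comparing powers of `exp (2π)` splits it into
elementary relations that kill the parameters one after the other. -/

/-- Two trajectories of a Lipschitz field on an open interval that have the same limit at the left
end point agree. -/
theorem eqOn_Icc_of_hasDerivAt_Ioo {E : Type*} [NormedAddCommGroup E] [NormedSpace ℝ E]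
    {X : E → E} {K : NNReal} (hX : LipschitzWith K X) {f g : ℝ → E} {a b : ℝ}
    (hf : ContinuousOn f (Icc a b)) (hg : ContinuousOn g (Icc a b)) (h0 : f a = g a)
    (hf' : ∀ t ∈ Ioo a b, HasDerivAt f (X (f t)) t)
    (hg' : ∀ t ∈ Ioo a b, HasDerivAt g (X (g t)) t) : EqOn f g (Icc a b) := by
  intro t ht
  rcases eq_or_lt_of_le ht.1 with h | h
  · rw [← h, h0]
  -- Nothing is known about the derivative at `a`, where a solution may take another Filippov
  -- velocity. Grönwall's inequality is therefore applied from `a' > a`, and `a'` tends to `a`.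
  have key : ∀ a' ∈ Ioo a t, dist (f t) (g t) ≤ dist (f a') (g a') * Real.exp (K * (t - a')) := by
    intro a' ha'
    have hsub : Icc a' t ⊆ Icc a b := Icc_subset_Icc ha'.1.le ht.2
    have hsub' : ∀ s ∈ Ico a' t, s ∈ Ioo a b := fun s hs =>
      ⟨lt_of_lt_of_le ha'.1 hs.1, lt_of_lt_of_le hs.2 ht.2⟩
    exact dist_le_of_trajectories_ODE (v := fun _ => X) (fun _ => hX) (hf.mono hsub)
      (fun s hs => (hf' s (hsub' s hs)).hasDerivWithinAt) (hg.mono hsub)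
      (fun s hs => (hg' s (hsub' s hs)).hasDerivWithinAt) le_rfl t ⟨ha'.2.le, le_rfl⟩
  have hle : 𝓝[Ioo a t] a ≤ 𝓝[Icc a b] a :=
    nhdsWithin_mono _ fun s hs => ⟨hs.1.le, hs.2.le.trans ht.2⟩
  have ha : a ∈ Icc a b := ⟨le_rfl, ht.1.trans ht.2⟩
  have h1 : Tendsto (fun a' => dist (f a') (g a') * Real.exp (K * (t - a'))) (𝓝[Ioo a t] a)
      (𝓝 (dist (f a) (g a) * Real.exp (K * (t - a)))) := by
    refine Tendsto.mul (((hf a ha).mono_left hle).dist ((hg a ha).mono_left hle)) ?_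
    have : Continuous fun a' : ℝ => Real.exp (K * (t - a')) := by fun_prop
    exact this.continuousAt.mono_left nhdsWithin_le_nhds
  have hne : (𝓝[Ioo a t] a).NeBot := by
    rw [nhdsWithin_Ioo_eq_nhdsGT h]; infer_instance
  have h2 := le_of_tendsto_of_tendsto (tendsto_const_nhds (x := dist (f t) (g t))) h1
    (eventually_nhdsWithin_of_forall key)
  rw [h0, dist_self, zero_mul] at h2
  exact dist_le_zero.1 h2

theorem eventually_gt_of_hasDerivWithinAt_pos {f : ℝ → ℝ} {a f' : ℝ}
    (hf : HasDerivWithinAt f f' (Ici a) a) (hf' : 0 < f') : ∀ᶠ t in 𝓝[>] a, f a < f t := by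
  have h := (hasDerivWithinAt_iff_tendsto_slope' (s := Ioi a) (by simp)).1
    (hf.mono Ioi_subset_Ici_self)
  filter_upwards [h.eventually (lt_mem_nhds hf'), self_mem_nhdsWithin] with t ht hta
  rw [slope_def_field] at ht
  have : 0 < t - a := sub_pos.2 hta
  have := (div_pos_iff_of_pos_right this).1 ht
  linarith

/-! ### Solutions through crossing points and closed curves made of two arcs -/

namespace PiecewiseSystem

variable {Z : PiecewiseSystem} {γ : ℝ → Space3} {I : Set ℝ}

theorem IsSolutionOn.continuousAt (hγ : Z.IsSolutionOn γ I) {t : ℝ} (ht : t ∈ I) :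
    ContinuousAt γ t := by
  obtain ⟨⟨v, -, hv⟩, ⟨w, -, hw⟩⟩ := hγ t ht
  exact continuousAt_iff_continuous_left_right.2 ⟨hv.continuousWithinAt, hw.continuousWithinAt⟩

theorem hasDerivAt_of_left_right {E : Type*} [NormedAddCommGroup E] [NormedSpace ℝ E]
    {f : ℝ → E} {v : E} {t : ℝ} (h₁ : HasDerivWithinAt f v (Iic t) t)
    (h₂ : HasDerivWithinAt f v (Ici t) t) : HasDerivAt f v t := by
  have := h₁.union h₂
  rwa [Iic_union_Ici, hasDerivWithinAt_univ] at this

theorem IsSolutionOn.hasDerivAt_of_pos (hγ : Z.IsSolutionOn γ I) {t : ℝ} (ht : t ∈ I)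
    (h : 0 < Z.h (γ t)) : HasDerivAt γ (Z.Xp (γ t)) t := by
  obtain ⟨⟨v, hv', hv⟩, ⟨w, hw', hw⟩⟩ := hγ t ht
  rw [hv'.1 h] at hv
  rw [hw'.1 h] at hw
  exact hasDerivAt_of_left_right hv hw

theorem IsSolutionOn.hasDerivAt_of_neg (hγ : Z.IsSolutionOn γ I) {t : ℝ} (ht : t ∈ I)
    (h : Z.h (γ t) < 0) : HasDerivAt γ (Z.Xm (γ t)) t := by
  obtain ⟨⟨v, hv', hv⟩, ⟨w, hw', hw⟩⟩ := hγ t ht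
  rw [hv'.2.1 h] at hv
  rw [hw'.2.1 h] at hw
  exact hasDerivAt_of_left_right hv hw

/-- The same system, with the names of the two sides exchanged. -/
def flip (Z : PiecewiseSystem) : PiecewiseSystem where
  h := fun p => -Z.h p
  Xp := Z.Xm
  Xm := Z.Xp

theorem velocities_flip (p : Space3) : Z.flip.velocities p = Z.velocities p := by
  ext v
  simp only [velocities, flip, mem_ofPred_eq, Left.neg_pos_iff, Left.neg_neg_iff, neg_eq_zero,
    segment_symm ℝ (Z.Xp p) (Z.Xm p)]
  tauto

theorem IsSolutionOn.flip (hγ : Z.IsSolutionOn γ I) : Z.flip.IsSolutionOn γ I := by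
  intro t ht
  simpa only [velocities_flip] using hγ t ht

theorem liePlus_flip (p : Space3) : Z.flip.liePlus p = -Z.lieMinus p := by
  simp [liePlus, lieMinus, PiecewiseSystem.flip, fderiv_fun_neg]

theorem lieMinus_flip (p : Space3) : Z.flip.lieMinus p = -Z.liePlus p := by
  simp [liePlus, lieMinus, PiecewiseSystem.flip, fderiv_fun_neg]

/-- Convex combinations of positive numbers are positive: no Filippov velocity at a crossing point
permits sliding, and the solution leaves `Σ` at once. -/
theorem lie_pos_of_mem_segment {p v : Space3} (hp : 0 < Z.liePlus p) (hm : 0 < Z.lieMinus p)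
    (hv : v ∈ segment ℝ (Z.Xm p) (Z.Xp p)) : 0 < fderiv ℝ Z.h p v := by
  obtain ⟨s, t, hs, ht, hst, rfl⟩ := hv
  simp only [liePlus, lieMinus] at hp hm
  rw [map_add, map_smul, map_smul, smul_eq_mul, smul_eq_mul]
  rcases eq_or_lt_of_le hs with h | h
  · have : t = 1 := by linarith
    rw [← h, this]; linarith
  · have := mul_pos h hm
    have := mul_nonneg ht hp.le
    linarith

/-- After entering `h > 0` through `Σ`, a solution follows the trajectory of the field `Xp`, as
long as that stays in `h > 0`. -/
theorem IsSolutionOn.follow_plus (hγ : Z.IsSolutionOn γ univ) (hh : Differentiable ℝ Z.h)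
    {K : NNReal} (hX : LipschitzWith K Z.Xp) {a τ : ℝ} {α : ℝ → Space3}
    (hα : ∀ t, HasDerivAt α (Z.Xp (α t)) t) (h0 : α 0 = γ a)
    (hpos : ∀ t ∈ Ioo 0 τ, 0 < Z.h (α t)) (hs₀ : Z.h (γ a) = 0) (hp : 0 < Z.liePlus (γ a))
    (hm : 0 < Z.lieMinus (γ a)) : ∀ t ∈ Icc 0 τ, γ (a + t) = α t := by
  have hcont : Continuous γ := continuous_iff_continuousAt.2 fun t => hγ.continuousAt (mem_univ t)
  have hαc : Continuous α := continuous_iff_continuousAt.2 fun t => (hα t).continuousAt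
  have hcs : Continuous fun t => γ (a + t) := by fun_prop
  have heq : ∀ b, (∀ t ∈ Ioo 0 b, 0 < Z.h (γ (a + t))) → EqOn (fun t => γ (a + t)) α (Icc 0 b) := by
    intro b hb
    refine eqOn_Icc_of_hasDerivAt_Ioo hX hcs.continuousOn hαc.continuousOn ?_ (fun t ht => ?_)
      (fun t _ => hα t)
    · simpa using h0.symm
    · exact (hγ.hasDerivAt_of_pos (mem_univ _) (hb t ht)).comp_const_add a t
  obtain ⟨-, ⟨v, hv, hvd⟩⟩ := hγ a (mem_univ a)
  have hd : HasDerivWithinAt (Z.h ∘ γ) (fderiv ℝ Z.h (γ a) v) (Ici a) a :=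
    (hh (γ a)).hasFDerivAt.comp_hasDerivWithinAt a hvd
  have hev := eventually_gt_of_hasDerivWithinAt_pos hd (lie_pos_of_mem_segment hp hm (hv.2.2 hs₀))
  obtain ⟨δ, hδ, hδ'⟩ := (mem_nhdsGT_iff_exists_Ioo_subset (α := ℝ)).1 hev
  have hδpos : ∀ t, 0 < t → t < δ - a → 0 < Z.h (γ (a + t)) := by
    intro t h1 h2
    have : a + t ∈ Ioo a δ := ⟨by linarith, by linarith⟩
    simpa [hs₀] using hδ' this
  refine heq τ ?_
  by_contra hcon
  push Not at hcon
  obtain ⟨s, hs, hs'⟩ := hcon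
  -- The infimum of `S` is the first time at which `γ` fails to be in `h > 0`. The bound `δ - a`
  -- keeps `S` away from the starting time, where `h` vanishes. Up to the infimum `γ` agrees with
  -- `α`, so `h` is still positive there.
  let S : Set ℝ := {t | δ - a ≤ t ∧ t ≤ s ∧ Z.h (γ (a + t)) ≤ 0}
  have hScl : IsClosed S := by
    have h3 : Continuous fun t => Z.h (γ (a + t)) := hh.continuous.comp hcs
    exact (isClosed_le continuous_const continuous_id).inter
      ((isClosed_le continuous_id continuous_const).inter (isClosed_le h3 continuous_const))
  have hSne : S.Nonempty := by
    refine ⟨s, ?_, le_rfl, hs'⟩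
    by_contra h
    exact absurd (hδpos s hs.1 (not_le.1 h)) (not_lt.2 hs')
  have hSbdd : BddBelow S := ⟨δ - a, fun t ht => ht.1⟩
  have hmem := hScl.csInf_mem hSne hSbdd
  set s₀ := sInf S
  have hs0 : 0 < s₀ := lt_of_lt_of_le (sub_pos.2 hδ) hmem.1
  have hposγ : ∀ t ∈ Ioo 0 s₀, 0 < Z.h (γ (a + t)) := by
    intro t ht
    by_contra h
    rcases lt_or_ge t (δ - a) with h1 | h1
    · exact h (hδpos t ht.1 h1)
    · exact absurd (csInf_le hSbdd (⟨h1, ht.2.le.trans hmem.2.1, not_lt.1 h⟩ : t ∈ S))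
        (not_le.2 ht.2)
  have h4 : γ (a + s₀) = α s₀ := heq s₀ hposγ ⟨hs0.le, le_rfl⟩
  have h5 := hpos s₀ ⟨hs0, lt_of_le_of_lt hmem.2.1 hs.2⟩
  rw [← h4] at h5
  exact absurd hmem.2.2 (not_le.2 h5)

theorem IsSolutionOn.follow_minus (hγ : Z.IsSolutionOn γ univ) (hh : Differentiable ℝ Z.h)
    {K : NNReal} (hX : LipschitzWith K Z.Xm) {a τ : ℝ} {β : ℝ → Space3}
    (hβ : ∀ t, HasDerivAt β (Z.Xm (β t)) t) (h0 : β 0 = γ a)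
    (hneg : ∀ t ∈ Ioo 0 τ, Z.h (β t) < 0) (hs₀ : Z.h (γ a) = 0) (hp : Z.liePlus (γ a) < 0)
    (hm : Z.lieMinus (γ a) < 0) : ∀ t ∈ Icc 0 τ, γ (a + t) = β t :=
  hγ.flip.follow_plus (Z := Z.flip) hh.neg hX hβ h0
    (fun t ht => neg_pos.2 (hneg t ht)) (by simp [PiecewiseSystem.flip, hs₀])
    (by rw [liePlus_flip]; linarith) (by rw [lieMinus_flip]; linarith)

/-- A closed curve consisting of an arc `α` in `h > 0`, from `R` to `L`, and an arc `β` in `h < 0`,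
from `L` to `R`. -/
structure IsTwoArc (Z : PiecewiseSystem) (R L : Space3) (σ τ : ℝ) (α β : ℝ → Space3) : Prop where
  σ_pos : 0 < σ
  τ_pos : 0 < τ
  α_zero : α 0 = R
  α_end : α σ = L
  β_zero : β 0 = L
  β_end : β τ = R
  hasDerivAt_α : ∀ t, HasDerivAt α (Z.Xp (α t)) t
  hasDerivAt_β : ∀ t, HasDerivAt β (Z.Xm (β t)) t
  α_pos : ∀ t ∈ Ioo 0 σ, 0 < Z.h (α t)
  β_neg : ∀ t ∈ Ioo 0 τ, Z.h (β t) < 0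
  h_R : Z.h R = 0
  h_L : Z.h L = 0
  liePlus_R : 0 < Z.liePlus R
  lieMinus_R : 0 < Z.lieMinus R
  liePlus_L : Z.liePlus L < 0
  lieMinus_L : Z.lieMinus L < 0

theorem Xp_mem_velocities {p : Space3} (h : 0 ≤ Z.h p) : Z.Xp p ∈ Z.velocities p :=
  ⟨fun _ => rfl, fun h' => absurd h (not_le.2 h'), fun _ => right_mem_segment ℝ _ _⟩

theorem Xm_mem_velocities {p : Space3} (h : Z.h p ≤ 0) : Z.Xm p ∈ Z.velocities p :=
  ⟨fun h' => absurd h (not_le.2 h'), fun _ => rfl, fun _ => left_mem_segment ℝ _ _⟩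

/-- The union of two arcs. -/
def arcs (σ τ : ℝ) (α β : ℝ → Space3) : Set Space3 := α '' Icc 0 σ ∪ β '' Icc 0 τ

namespace IsTwoArc

variable {R L : Space3} {σ τ : ℝ} {α β : ℝ → Space3}

theorem α_nonneg (H : Z.IsTwoArc R L σ τ α β) {t : ℝ} (ht : t ∈ Icc 0 σ) : 0 ≤ Z.h (α t) := by
  rcases eq_or_lt_of_le ht.1 with h | h
  · rw [← h, H.α_zero, H.h_R]
  rcases eq_or_lt_of_le ht.2 with h' | h'
  · rw [h', H.α_end, H.h_L]
  exact (H.α_pos t ⟨h, h'⟩).le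

theorem β_nonpos (H : Z.IsTwoArc R L σ τ α β) {t : ℝ} (ht : t ∈ Icc 0 τ) : Z.h (β t) ≤ 0 := by
  rcases eq_or_lt_of_le ht.1 with h | h
  · rw [← h, H.β_zero, H.h_L]
  rcases eq_or_lt_of_le ht.2 with h' | h'
  · rw [h', H.β_end, H.h_R]
  exact (H.β_neg t ⟨h, h'⟩).le

theorem mem_arcs_switching (H : Z.IsTwoArc R L σ τ α β) {p : Space3} (hp : p ∈ arcs σ τ α β)
    (hs₀ : Z.h p = 0) : p = R ∨ p = L := by
  rcases hp with ⟨t, ht, rfl⟩ | ⟨t, ht, rfl⟩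
  · rcases eq_or_lt_of_le ht.1 with h | h
    · left; rw [← h, H.α_zero]
    rcases eq_or_lt_of_le ht.2 with h' | h'
    · right; rw [h', H.α_end]
    exact absurd hs₀ (H.α_pos t ⟨h, h'⟩).ne'
  · rcases eq_or_lt_of_le ht.1 with h | h
    · right; rw [← h, H.β_zero]
    rcases eq_or_lt_of_le ht.2 with h' | h'
    · left; rw [h', H.β_end]
    exact absurd hs₀ (H.β_neg t ⟨h, h'⟩).ne

theorem R_mem_arcs (H : Z.IsTwoArc R L σ τ α β) : R ∈ arcs σ τ α β :=
  Or.inl ⟨0, ⟨le_rfl, H.σ_pos.le⟩, H.α_zero⟩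

theorem isCompact_arcs (H : Z.IsTwoArc R L σ τ α β) : IsCompact (arcs σ τ α β) := by
  have hα : Continuous α := continuous_iff_continuousAt.2 fun t => (H.hasDerivAt_α t).continuousAt
  have hβ : Continuous β := continuous_iff_continuousAt.2 fun t => (H.hasDerivAt_β t).continuousAt
  exact (isCompact_Icc.image hα).union (isCompact_Icc.image hβ)

/-- A closed curve made of two arcs is a crossing periodic orbit. -/
theorem isCrossingPeriodicOrbit (H : Z.IsTwoArc R L σ τ α β) :
    Z.IsCrossingPeriodicOrbit (arcs σ τ α β) := by
  classical
  have hT : 0 < σ + τ := add_pos H.σ_pos H.τ_pos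
  let δ : ℝ → Space3 := fun s => if s ≤ σ then α s else β (s - σ)
  let γ : ℝ → Space3 := fun t => δ (toIcoMod hT 0 t)
  have δ1 : ∀ s, s ≤ σ → δ s = α s := fun s hs => if_pos hs
  have δ2 : ∀ s, σ ≤ s → δ s = β (s - σ) := by
    intro s hs
    rcases eq_or_lt_of_le hs with h | h
    · rw [← h, δ1 σ le_rfl, H.α_end, sub_self, H.β_zero]
    · exact if_neg (not_le.2 h)
  -- The formula is needed on the closed period: at a multiple of the period the left derivative
  -- comes from the end of `β` and the right derivative from the start of `α`. Accordingly
  -- `toIocDiv` is used on the left and `toIcoDiv` on the right.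
  have hγ : ∀ (n : ℤ) (t : ℝ), t - n • (σ + τ) ∈ Icc 0 (σ + τ) → γ t = δ (t - n • (σ + τ)) := by
    intro n t ht
    rcases eq_or_lt_of_le ht.2 with h | h
    · have : toIcoMod hT 0 t = 0 := by
        rw [toIcoMod_eq_iff]
        refine ⟨⟨le_rfl, by simpa using hT⟩, n + 1, ?_⟩
        rw [add_smul, one_smul, zero_add]
        linarith
      simp only [γ]
      rw [this, h, δ1 0 H.σ_pos.le, δ2 _ (by linarith [H.τ_pos]), H.α_zero, add_sub_cancel_left,
        H.β_end]
    · have : toIcoMod hT 0 t = t - n • (σ + τ) := by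
        rw [toIcoMod_eq_iff]
        exact ⟨⟨ht.1, by simpa using h⟩, n, by ring⟩
      simp only [γ]
      rw [this]
  have hsol : Z.IsSolutionOn γ univ := by
    intro t _
    constructor
    · set n := toIocDiv hT 0 t
      set s := t - n • (σ + τ) with hs
      have hsmem : s ∈ Ioc 0 (σ + τ) := by
        have := sub_toIocDiv_zsmul_mem_Ioc hT 0 t
        rwa [zero_add] at this
      have hγt : γ t = δ s := hγ n t ⟨hsmem.1.le, hsmem.2⟩
      rcases le_or_gt s σ with h | h
      · have hval : γ t = α s := by rw [hγt, δ1 s h]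
        refine ⟨Z.Xp (γ t), Xp_mem_velocities ?_, ?_⟩
        · rw [hval]; exact H.α_nonneg ⟨hsmem.1.le, h⟩
        · have hd : HasDerivAt (fun t' => α (t' - n • (σ + τ))) (Z.Xp (α s)) t :=
            (H.hasDerivAt_α s).comp_sub_const t _
          rw [hval]
          refine hd.hasDerivWithinAt.congr_of_eventuallyEq_of_mem ?_ (mem_Iic.2 le_rfl)
          filter_upwards [Ioc_mem_nhdsLE (show t - s < t by linarith [hsmem.1])] with t' ht'
          rw [hγ n t' ⟨by linarith [ht'.1], by linarith [ht'.2, hsmem.2]⟩, δ1]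
          linarith [ht'.2]
      · have hval : γ t = β (s - σ) := by rw [hγt, δ2 s h.le]
        refine ⟨Z.Xm (γ t), Xm_mem_velocities ?_, ?_⟩
        · rw [hval]; exact H.β_nonpos ⟨by linarith, by linarith [hsmem.2]⟩
        · have hd : HasDerivAt (fun t' => β (t' - (n • (σ + τ) + σ))) (Z.Xm (β (s - σ))) t := by
            have := H.hasDerivAt_β (t - (n • (σ + τ) + σ))
            rw [show t - (n • (σ + τ) + σ) = s - σ by rw [hs]; ring] at this
            refine HasDerivAt.comp_sub_const t _ ?_
            rwa [show t - (n • (σ + τ) + σ) = s - σ by rw [hs]; ring]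
          rw [hval]
          refine hd.hasDerivWithinAt.congr_of_eventuallyEq_of_mem ?_ (mem_Iic.2 le_rfl)
          filter_upwards [Ioc_mem_nhdsLE (show t - (s - σ) < t by linarith)] with t' ht'
          rw [hγ n t' ⟨by linarith [ht'.1, H.σ_pos], by linarith [ht'.2, hsmem.2]⟩,
            δ2 _ (by linarith [ht'.1])]
          congr 1; ring
    · set n := toIcoDiv hT 0 t
      set s := t - n • (σ + τ) with hs
      have hsmem : s ∈ Ico 0 (σ + τ) := by
        have := sub_toIcoDiv_zsmul_mem_Ico hT 0 t
        rwa [zero_add] at this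
      have hγt : γ t = δ s := hγ n t ⟨hsmem.1, hsmem.2.le⟩
      rcases lt_or_ge s σ with h | h
      · have hval : γ t = α s := by rw [hγt, δ1 s h.le]
        refine ⟨Z.Xp (γ t), Xp_mem_velocities ?_, ?_⟩
        · rw [hval]; exact H.α_nonneg ⟨hsmem.1, h.le⟩
        · have hd : HasDerivAt (fun t' => α (t' - n • (σ + τ))) (Z.Xp (α s)) t :=
            (H.hasDerivAt_α s).comp_sub_const t _
          rw [hval]
          refine hd.hasDerivWithinAt.congr_of_eventuallyEq_of_mem ?_ (mem_Ici.2 le_rfl)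
          filter_upwards [Ico_mem_nhdsGE (show t < t + (σ - s) by linarith)] with t' ht'
          rw [hγ n t' ⟨by linarith [ht'.1, hsmem.1], by linarith [ht'.2, H.τ_pos]⟩, δ1]
          linarith [ht'.2]
      · have hval : γ t = β (s - σ) := by rw [hγt, δ2 s h]
        refine ⟨Z.Xm (γ t), Xm_mem_velocities ?_, ?_⟩
        · rw [hval]; exact H.β_nonpos ⟨by linarith, by linarith [hsmem.2]⟩
        · have hd : HasDerivAt (fun t' => β (t' - (n • (σ + τ) + σ))) (Z.Xm (β (s - σ))) t := by
            have := H.hasDerivAt_β (t - (n • (σ + τ) + σ))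
            rw [show t - (n • (σ + τ) + σ) = s - σ by rw [hs]; ring] at this
            refine HasDerivAt.comp_sub_const t _ ?_
            rwa [show t - (n • (σ + τ) + σ) = s - σ by rw [hs]; ring]
          rw [hval]
          refine hd.hasDerivWithinAt.congr_of_eventuallyEq_of_mem ?_ (mem_Ici.2 le_rfl)
          filter_upwards [Ico_mem_nhdsGE (show t < t + (σ + τ - s) by linarith [hsmem.2])]
            with t' ht'
          rw [hγ n t' ⟨by linarith [ht'.1, hsmem.1], by linarith [ht'.2]⟩,
            δ2 _ (by linarith [ht'.1])]
          congr 1; ring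
  have hval0 : ∀ s ∈ Icc 0 (σ + τ), γ s = δ s := by
    intro s hs
    simpa using hγ 0 s (by simpa using hs)
  have hrange : arcs σ τ α β = range γ := by
    apply Subset.antisymm
    · rintro p (⟨t, ht, rfl⟩ | ⟨t, ht, rfl⟩)
      · exact ⟨t, by rw [hval0 t ⟨ht.1, by linarith [ht.2, H.τ_pos]⟩, δ1 t ht.2]⟩
      · refine ⟨t + σ, ?_⟩
        rw [hval0 _ ⟨by linarith [ht.1, H.σ_pos], by linarith [ht.2]⟩, δ2 _ (by linarith [ht.1]),
          add_sub_cancel_right]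
    · rintro _ ⟨t, rfl⟩
      have hm := toIcoMod_mem_Ico hT 0 t
      rw [zero_add] at hm
      simp only [γ]
      rcases le_or_gt (toIcoMod hT 0 t) σ with h | h
      · rw [δ1 _ h]; exact Or.inl ⟨_, ⟨hm.1, h⟩, rfl⟩
      · rw [δ2 _ h.le]; exact Or.inr ⟨_, ⟨by linarith, by linarith [hm.2]⟩, rfl⟩
  refine ⟨⟨γ, σ + τ, hT, hsol, fun t => ?_, ⟨σ / 2, ?_⟩, hrange⟩, ⟨R, H.R_mem_arcs, H.h_R⟩, ?_⟩
  · simp only [γ]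
    rw [toIcoMod_add_right]
  -- At time `σ / 2` the curve is in `h > 0`, at time `0` it is on `h = 0`, so it is not constant.
  · intro h
    have h1 : γ (σ / 2) = α (σ / 2) := by
      rw [hval0 _ ⟨by linarith [H.σ_pos], by linarith [H.σ_pos, H.τ_pos]⟩,
        δ1 _ (by linarith [H.σ_pos])]
    have h2 : γ 0 = R := by rw [hval0 0 ⟨le_rfl, hT.le⟩, δ1 _ H.σ_pos.le, H.α_zero]
    have h3 := H.α_pos (σ / 2) ⟨by linarith [H.σ_pos], by linarith [H.σ_pos]⟩
    rw [← h1, h, h2, H.h_R] at h3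
    exact lt_irrefl _ h3
  · rintro p ⟨hp, hps⟩
    refine ⟨hps, ?_⟩
    rcases H.mem_arcs_switching hp hps with rfl | rfl
    · exact mul_pos H.liePlus_R H.lieMinus_R
    · exact mul_pos_of_neg_of_neg H.liePlus_L H.lieMinus_L

/-- A periodic solution through `R` runs along the two arcs. -/
theorem range_eq (H : Z.IsTwoArc R L σ τ α β) (hh : Differentiable ℝ Z.h) {K K' : NNReal}
    (hX : LipschitzWith K Z.Xp) (hX' : LipschitzWith K' Z.Xm) (hγ : Z.IsSolutionOn γ univ)
    {T : ℝ} (hT : 0 < T) (hper : Function.Periodic γ T) {t₀ : ℝ} (ht₀ : γ t₀ = R) :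
    range γ = arcs σ τ α β := by
  have step : ∀ t₁, γ t₁ = R → (∀ t ∈ Icc 0 σ, γ (t₁ + t) = α t) ∧
      (∀ t ∈ Icc 0 τ, γ (t₁ + σ + t) = β t) := by
    intro t₁ ht₁
    have h1 : ∀ t ∈ Icc 0 σ, γ (t₁ + t) = α t :=
      hγ.follow_plus hh hX H.hasDerivAt_α (by rw [H.α_zero, ht₁]) H.α_pos (by rw [ht₁, H.h_R])
        (by rw [ht₁]; exact H.liePlus_R) (by rw [ht₁]; exact H.lieMinus_R)
    have h2 : γ (t₁ + σ) = L := by rw [h1 σ ⟨H.σ_pos.le, le_rfl⟩, H.α_end]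
    exact ⟨h1, hγ.follow_minus hh hX' H.hasDerivAt_β (by rw [H.β_zero, h2]) H.β_neg
      (by rw [h2, H.h_L]) (by rw [h2]; exact H.liePlus_L) (by rw [h2]; exact H.lieMinus_L)⟩
  have hP : 0 < σ + τ := add_pos H.σ_pos H.τ_pos
  have hn : ∀ n : ℕ, γ (t₀ + n * (σ + τ)) = R := by
    intro n
    induction n with
    | zero => simpa using ht₀
    | succ n ih =>
      have := (step _ ih).2 τ ⟨H.τ_pos.le, le_rfl⟩
      rw [H.β_end] at this
      rw [← this]; congr 1; push_cast; ring
  apply Subset.antisymm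
  · rintro _ ⟨t, rfl⟩
    -- The arcs determine the solution only forward in time; periodicity moves `t` beyond `t₀`.
    obtain ⟨k, hk⟩ := exists_nat_gt ((t₀ - t) / T)
    have hk' : t₀ < t + k * T := by
      rw [div_lt_iff₀ hT] at hk; linarith
    have hγt : γ (t + k * T) = γ t := by
      simpa using hper.nat_mul k t
    rw [← hγt]
    set t' := t + k * T
    set n := ⌊(t' - t₀) / (σ + τ)⌋₊
    have hn1 : (n : ℝ) * (σ + τ) ≤ t' - t₀ := by
      have := Nat.floor_le (show 0 ≤ (t' - t₀) / (σ + τ) from div_nonneg (by linarith) hP.le)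
      rwa [le_div_iff₀ hP] at this
    have hn2 : t' - t₀ < (n + 1) * (σ + τ) := by
      have := Nat.lt_floor_add_one ((t' - t₀) / (σ + τ))
      rwa [div_lt_iff₀ hP] at this
    obtain ⟨s1, s2⟩ := step _ (hn n)
    rcases le_or_gt (t' - (t₀ + n * (σ + τ))) σ with h | h
    · left
      refine ⟨t' - (t₀ + n * (σ + τ)), ⟨by linarith, h⟩, ?_⟩
      rw [← s1 _ ⟨by linarith, h⟩]; congr 1; ring
    · right
      have hm : t' - (t₀ + n * (σ + τ)) - σ ∈ Icc 0 τ := ⟨by linarith, by linarith⟩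
      refine ⟨_, hm, ?_⟩
      rw [← s2 _ hm]; congr 1; ring
  · obtain ⟨s1, s2⟩ := step t₀ ht₀
    rintro p (⟨t, ht, rfl⟩ | ⟨t, ht, rfl⟩)
    · exact ⟨_, s1 t ht⟩
    · exact ⟨_, s2 t ht⟩

end IsTwoArc

end PiecewiseSystem

/-! ### The switching function, the unperturbed fields and the invariant plane -/

theorem hasFDerivAt_switchingFunction (c d : ℝ) (p : Space3) :
    HasFDerivAt (switchingFunction c d)
      ((-2 * d * p 0 - c * p 1) • ContinuousLinearMap.proj (R := ℝ) (φ := fun _ : Fin 3 => ℝ) 0 +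
        (-c * p 0 - 2 * p 1) • ContinuousLinearMap.proj (R := ℝ) (φ := fun _ : Fin 3 => ℝ) 1 +
        ContinuousLinearMap.proj (R := ℝ) (φ := fun _ : Fin 3 => ℝ) 2) p := by
  have h : ∀ i : Fin 3, HasFDerivAt (fun q : Space3 => q i)
      (ContinuousLinearMap.proj (R := ℝ) (φ := fun _ : Fin 3 => ℝ) i) p := fun i =>
    (ContinuousLinearMap.proj (R := ℝ) (φ := fun _ : Fin 3 => ℝ) i).hasFDerivAt
  have := (((((h 0).pow 2).const_mul (-d)).sub ((((h 0).const_mul c)).mul (h 1))).sub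
    ((h 1).pow 2)).add (h 2)
  refine this.congr_fderiv ?_
  ext i
  simp
  ring

theorem fderiv_switchingFunction (c d : ℝ) (p v : Space3) :
    fderiv ℝ (switchingFunction c d) p v =
      (-2 * d * p 0 - c * p 1) * v 0 + (-c * p 0 - 2 * p 1) * v 1 + v 2 := by
  rw [(hasFDerivAt_switchingFunction c d p).fderiv]
  simp

theorem differentiable_switchingFunction (c d : ℝ) :
    Differentiable ℝ (switchingFunction c d) :=
  fun p => (hasFDerivAt_switchingFunction c d p).differentiableAt

theorem lipschitzWith_of_affine {X : Space3 → Space3} {v : Space3} {A : Space3 →ₗ[ℝ] Space3}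
    (hX : ∀ p, X p = v + A p) : ∃ K, LipschitzWith K X := by
  refine ⟨‖A.toContinuousLinearMap‖₊, LipschitzWith.of_dist_le_mul fun p q => ?_⟩
  rw [hX, hX, dist_eq_norm, dist_eq_norm, add_sub_add_left_eq_sub, ← map_sub]
  exact A.toContinuousLinearMap.le_opNorm (p - q)

theorem exists_lipschitzWith_baseField (s : ℝ) : ∃ K, LipschitzWith K (baseField s) := by
  refine lipschitzWith_of_affine (v := ![0, -s, 0])
    (A := Matrix.toLin' !![1, 0, 0; 0, 0, -1; 1, 1, 0]) fun p => ?_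
  ext i
  fin_cases i <;> simp [baseField, dotProduct, Fin.sum_univ_three]; ring

namespace PiecewiseSystem

variable {Z : PiecewiseSystem} {γ : ℝ → Space3} {I : Set ℝ}

/-- If a coordinate of both fields is given by the same function, then this coordinate of a
solution is differentiable. -/
theorem IsSolutionOn.hasDerivAt_apply (hγ : Z.IsSolutionOn γ I) (i : Fin 3) {φ : Space3 → ℝ}
    (hp : ∀ p, Z.Xp p i = φ p) (hm : ∀ p, Z.Xm p i = φ p) {t : ℝ} (ht : t ∈ I) :
    HasDerivAt (fun t => γ t i) (φ (γ t)) t := by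
  have key : ∀ v ∈ Z.velocities (γ t), v i = φ (γ t) := by
    intro v hv
    rcases lt_trichotomy (Z.h (γ t)) 0 with h | h | h
    · rw [hv.2.1 h, hm]
    · obtain ⟨a, b, -, -, hab, rfl⟩ := hv.2.2 h
      simp only [Pi.add_apply, Pi.smul_apply, smul_eq_mul, hp, hm]
      rw [← add_mul, hab, one_mul]
    · rw [hv.1 h, hp]
  obtain ⟨⟨v, hv', hv⟩, ⟨w, hw', hw⟩⟩ := hγ t ht
  have h1 := (hasDerivWithinAt_pi.1 hv) i
  have h2 := (hasDerivWithinAt_pi.1 hw) i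
  rw [key v hv'] at h1
  rw [key w hw'] at h2
  exact hasDerivAt_of_left_right h1 h2

end PiecewiseSystem

theorem eq_mul_exp_of_hasDerivAt_self {x : ℝ → ℝ} {I : Set ℝ} (hI : IsOpen I) (hI' : I.OrdConnected)
    (hx : ∀ t ∈ I, HasDerivAt x (x t) t) {s t : ℝ} (hs : s ∈ I) (ht : t ∈ I) :
    x t = x s * Real.exp (t - s) := by
  have hd : ∀ r ∈ I, HasDerivAt (fun r => x r * Real.exp (-r)) 0 r := by
    intro r hr
    have := (hx r hr).mul ((hasDerivAt_neg r).exp)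
    refine this.congr_deriv ?_
    ring
  have : x t * Real.exp (-t) = x s * Real.exp (-s) := hI.is_const_of_deriv_eq_zero hI'.isPreconnected
    (fun r hr => (hd r hr).differentiableAt.differentiableWithinAt) (fun r hr => (hd r hr).deriv)
    ht hs
  rw [sub_eq_add_neg, add_comm, Real.exp_add, ← mul_assoc, ← this, mul_assoc, ← Real.exp_add]
  simp

/-- Both fields have first component `x`, hence so has every Filippov velocity. Along a solution `x'
= x` holds even on `Σ`, and `x` is a multiple of `exp t`. -/
theorem isInvariant_planeS (c d : ℝ) : (unperturbedSystem c d).IsInvariant planeS := by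
  rintro γ I hI hI' hγ ⟨s, hs, hs'⟩ t ht
  have h : ∀ r ∈ I, HasDerivAt (fun r => γ r 0) (γ r 0) r := fun r hr =>
    hγ.hasDerivAt_apply 0 (φ := fun p => p 0) (fun p => rfl) (fun p => rfl) hr
  have := eq_mul_exp_of_hasDerivAt_self hI hI' h hs ht
  have h0 : γ s 0 = 0 := hs'
  rw [h0, zero_mul] at this
  exact this

/-- This confines periodic orbits to `x = 0`, both for the unperturbed system and for perturbed
solutions that stay in `h < 0`. -/
theorem eq_zero_of_periodic_of_hasDerivAt_self {x : ℝ → ℝ} (hx : ∀ t, HasDerivAt x (x t) t)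
    {T : ℝ} (hT : 0 < T) (hper : Function.Periodic x T) (t : ℝ) : x t = 0 := by
  have h := eq_mul_exp_of_hasDerivAt_self isOpen_univ ordConnected_univ (fun t _ => hx t)
    (mem_univ t) (mem_univ (t + T))
  rw [hper t, add_sub_cancel_left] at h
  have h1 : 1 < Real.exp T := Real.one_lt_exp_iff.2 hT
  by_contra hne
  have : Real.exp T = 1 := by
    have := mul_left_cancel₀ hne (show x t * 1 = x t * Real.exp T by linarith)
    exact this.symm
  linarith

/-! ### The explicit unperturbed orbits -/

/-- Half of the time that the unperturbed `+` flow needs from `(0, y, y²)` to `(0, -y, y²)`. -/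
noncomputable def halfTimePlus (y : ℝ) : ℝ := Real.arctan (y / (y ^ 2 + 1))

/-- Half of the time that the unperturbed `-` flow needs from `(0, -y, y²)` to `(0, y, y²)`. -/
noncomputable def halfTimeMinus (y : ℝ) : ℝ := Real.pi / 2 + Real.arctan ((y ^ 2 - 1) / y)

/-- The squared radius of the circle about `(0, -1)` through `(y, y²)`. -/
def radSqPlus (y : ℝ) : ℝ := y ^ 2 + (y ^ 2 + 1) ^ 2

/-- The squared radius of the circle about `(0, 1)` through `(y, y²)`. -/
def radSqMinus (y : ℝ) : ℝ := y ^ 2 + (y ^ 2 - 1) ^ 2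

theorem radSqPlus_pos (y : ℝ) : 0 < radSqPlus y := by unfold radSqPlus; positivity

theorem radSqMinus_pos (y : ℝ) : 0 < radSqMinus y := by
  unfold radSqMinus; nlinarith [sq_nonneg (y ^ 2 - 1), sq_nonneg y, sq_nonneg (y ^ 2 - 1 / 2)]

/-- Seen from the centre `(0, -1)`, the point `(y, y²)` has the angle `halfTimePlus y` with the
upward axis. As the rotation has unit speed, this angle is the time in which the axis is reached. -/
theorem sqrt_mul_cos_halfTimePlus (y : ℝ) :
    √(radSqPlus y) * Real.cos (halfTimePlus y) = y ^ 2 + 1 := by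
  have h : √(1 + (y / (y ^ 2 + 1)) ^ 2) = √(radSqPlus y) / (y ^ 2 + 1) := by
    rw [show 1 + (y / (y ^ 2 + 1)) ^ 2 = radSqPlus y / (y ^ 2 + 1) ^ 2 by
      unfold radSqPlus; field_simp; ring, Real.sqrt_div (radSqPlus_pos y).le,
      Real.sqrt_sq (by positivity)]
  have h2 : √(radSqPlus y) ≠ 0 := (Real.sqrt_pos.2 (radSqPlus_pos y)).ne'
  rw [halfTimePlus, Real.cos_arctan, h]
  field_simp

theorem sqrt_mul_sin_halfTimePlus (y : ℝ) :
    √(radSqPlus y) * Real.sin (halfTimePlus y) = y := by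
  have h : √(1 + (y / (y ^ 2 + 1)) ^ 2) = √(radSqPlus y) / (y ^ 2 + 1) := by
    rw [show 1 + (y / (y ^ 2 + 1)) ^ 2 = radSqPlus y / (y ^ 2 + 1) ^ 2 by
      unfold radSqPlus; field_simp; ring, Real.sqrt_div (radSqPlus_pos y).le,
      Real.sqrt_sq (by positivity)]
  have h2 : √(radSqPlus y) ≠ 0 := (Real.sqrt_pos.2 (radSqPlus_pos y)).ne'
  rw [halfTimePlus, Real.sin_arctan, h]
  field_simp

theorem sqrt_one_add_halfTimeMinus_sq {y : ℝ} (hy : 0 < y) :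
    √(1 + ((y ^ 2 - 1) / y) ^ 2) = √(radSqMinus y) / y := by
  rw [show 1 + ((y ^ 2 - 1) / y) ^ 2 = radSqMinus y / y ^ 2 by
      unfold radSqMinus; field_simp, Real.sqrt_div (radSqMinus_pos y).le,
      Real.sqrt_sq hy.le]

/-- Here the angle is seen from the centre `(0, 1)` and measured from the downward axis; it exceeds
`π / 2` exactly when `y > 1`. -/
theorem sqrt_mul_cos_halfTimeMinus {y : ℝ} (hy : 0 < y) :
    √(radSqMinus y) * Real.cos (halfTimeMinus y) = 1 - y ^ 2 := by
  have h2 : √(radSqMinus y) ≠ 0 := (Real.sqrt_pos.2 (radSqMinus_pos y)).ne'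
  rw [halfTimeMinus, add_comm, Real.cos_add_pi_div_two, Real.sin_arctan,
    sqrt_one_add_halfTimeMinus_sq hy]
  field_simp
  ring

theorem sqrt_mul_sin_halfTimeMinus {y : ℝ} (hy : 0 < y) :
    √(radSqMinus y) * Real.sin (halfTimeMinus y) = y := by
  have h2 : √(radSqMinus y) ≠ 0 := (Real.sqrt_pos.2 (radSqMinus_pos y)).ne'
  rw [halfTimeMinus, add_comm, Real.sin_add_pi_div_two, Real.cos_arctan,
    sqrt_one_add_halfTimeMinus_sq hy]
  field_simp

theorem halfTimePlus_pos {y : ℝ} (hy : 0 < y) : 0 < halfTimePlus y :=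
  Real.arctan_pos.2 (by positivity)

theorem halfTimePlus_lt (y : ℝ) : halfTimePlus y < Real.pi / 2 := Real.arctan_lt_pi_div_two _

theorem halfTimeMinus_pos (y : ℝ) : 0 < halfTimeMinus y := by
  unfold halfTimeMinus; linarith [Real.neg_pi_div_two_lt_arctan ((y ^ 2 - 1) / y)]

theorem halfTimeMinus_lt (y : ℝ) : halfTimeMinus y < Real.pi := by
  unfold halfTimeMinus; linarith [Real.arctan_lt_pi_div_two ((y ^ 2 - 1) / y)]

/-- The unperturbed `+` trajectory in `x = 0` that starts at `(0, y, y²)`. -/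
noncomputable def circlePlus (y t : ℝ) : Space3 :=
  ![0, y * Real.cos t - (y ^ 2 + 1) * Real.sin t, (y ^ 2 + 1) * Real.cos t + y * Real.sin t - 1]

/-- The unperturbed `-` trajectory in `x = 0` that starts at `(0, -y, y²)`. -/
noncomputable def circleMinus (y t : ℝ) : Space3 :=
  ![0, -y * Real.cos t - (y ^ 2 - 1) * Real.sin t, (y ^ 2 - 1) * Real.cos t - y * Real.sin t + 1]

/-- In amplitude and phase form the height is a cosine centred at the half time, so that heights
along the arc can be compared by the monotonicity of the cosine. -/
theorem circlePlus_eq (y t : ℝ) : circlePlus y t =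
    ![0, √(radSqPlus y) * Real.sin (halfTimePlus y - t),
      √(radSqPlus y) * Real.cos (halfTimePlus y - t) - 1] := by
  have h1 := sqrt_mul_cos_halfTimePlus y
  have h2 := sqrt_mul_sin_halfTimePlus y
  rw [circlePlus, Real.sin_sub, Real.cos_sub]
  congr 1
  congr 1
  · linear_combination (-Real.cos t) * h2 + Real.sin t * h1
  · congr 1
    linear_combination (-Real.sin t) * h2 - Real.cos t * h1

theorem circleMinus_eq {y : ℝ} (hy : 0 < y) (t : ℝ) : circleMinus y t =
    ![0, √(radSqMinus y) * Real.sin (t - halfTimeMinus y),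
      1 - √(radSqMinus y) * Real.cos (t - halfTimeMinus y)] := by
  have h1 := sqrt_mul_cos_halfTimeMinus hy
  have h2 := sqrt_mul_sin_halfTimeMinus hy
  rw [circleMinus, Real.sin_sub, Real.cos_sub]
  congr 1
  congr 1
  · linear_combination (-Real.sin t) * h1 + Real.cos t * h2
  · congr 1
    linear_combination Real.sin t * h2 + Real.cos t * h1

theorem hasDerivAt_circlePlus (y t : ℝ) :
    HasDerivAt (circlePlus y) (baseField 1 (circlePlus y t)) t := by
  rw [hasDerivAt_pi]
  intro i
  have hs := Real.hasDerivAt_sin t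
  have hc := Real.hasDerivAt_cos t
  fin_cases i
  · simpa [circlePlus, baseField] using hasDerivAt_const t (0 : ℝ)
  · refine ((hc.const_mul y).sub (hs.const_mul (y ^ 2 + 1))).congr_deriv ?_
    simp [circlePlus, baseField]
    ring
  · refine (((hc.const_mul (y ^ 2 + 1)).add (hs.const_mul y)).sub_const 1).congr_deriv ?_
    simp [circlePlus, baseField]
    ring

theorem hasDerivAt_circleMinus (y t : ℝ) :
    HasDerivAt (circleMinus y) (baseField (-1) (circleMinus y t)) t := by
  rw [hasDerivAt_pi]
  intro i
  have hs := Real.hasDerivAt_sin t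
  have hc := Real.hasDerivAt_cos t
  fin_cases i
  · simpa [circleMinus, baseField] using hasDerivAt_const t (0 : ℝ)
  · refine ((hc.const_mul (-y)).sub (hs.const_mul (y ^ 2 - 1))).congr_deriv ?_
    simp [circleMinus, baseField]
  · refine (((hc.const_mul (y ^ 2 - 1)).sub (hs.const_mul y)).add_const 1).congr_deriv ?_
    simp [circleMinus, baseField]
    ring

theorem circlePlus_zero (y : ℝ) : circlePlus y 0 = ![0, y, y ^ 2] := by
  simp [circlePlus]

theorem circleMinus_zero (y : ℝ) : circleMinus y 0 = ![0, -y, y ^ 2] := by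
  simp [circleMinus]

theorem circlePlus_end (y : ℝ) : circlePlus y (2 * halfTimePlus y) = ![0, -y, y ^ 2] := by
  rw [circlePlus_eq, show halfTimePlus y - 2 * halfTimePlus y = -halfTimePlus y by ring,
    Real.sin_neg, Real.cos_neg, mul_neg, sqrt_mul_sin_halfTimePlus, sqrt_mul_cos_halfTimePlus,
    add_sub_cancel_right]

theorem circleMinus_end {y : ℝ} (hy : 0 < y) :
    circleMinus y (2 * halfTimeMinus y) = ![0, y, y ^ 2] := by
  rw [circleMinus_eq hy, show 2 * halfTimeMinus y - halfTimeMinus y = halfTimeMinus y by ring,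
    sqrt_mul_sin_halfTimeMinus hy, sqrt_mul_cos_halfTimeMinus hy, sub_sub_cancel]

theorem switchingFunction_of_zero (c d y z : ℝ) :
    switchingFunction c d ![0, y, z] = z - y ^ 2 := by
  simp [switchingFunction]; ring

theorem cos_lt_cos_of_abs_lt {s θ : ℝ} (hs : |s| < θ) (hθ : θ ≤ Real.pi) :
    Real.cos θ < Real.cos s := by
  rw [← Real.cos_abs s]
  exact Real.cos_lt_cos_of_nonneg_of_le_pi (abs_nonneg s) hθ hs

/-- On the circle `y² + (z + 1)²` is constant, so the switching function is a quadratic polynomial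
in the height, with one root at the starting height `y²`. -/
theorem switchingFunction_circlePlus (c d y t : ℝ) :
    switchingFunction c d (circlePlus y t) =
      (circlePlus y t 2 - y ^ 2) * (circlePlus y t 2 + y ^ 2 + 3) := by
  have := Real.sin_sq_add_cos_sq t
  simp [circlePlus, switchingFunction]
  linear_combination (-y ^ 2 - (y ^ 2 + 1) ^ 2) * this

/-- The second root `1 - y²` is the height at which the `-` circle may meet the parabola again. It
decides whether the arc closes up. -/
theorem switchingFunction_circleMinus (c d y t : ℝ) :
    switchingFunction c d (circleMinus y t) =
      (circleMinus y t 2 - y ^ 2) * (circleMinus y t 2 - 1 + y ^ 2) := by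
  have := Real.sin_sq_add_cos_sq t
  simp [circleMinus, switchingFunction]
  linear_combination (-y ^ 2 - (y ^ 2 - 1) ^ 2) * this

theorem lt_circlePlus_two {y t : ℝ} (ht : t ∈ Ioo 0 (2 * halfTimePlus y)) :
    y ^ 2 < circlePlus y t 2 := by
  have h1 : Real.cos (halfTimePlus y) < Real.cos (halfTimePlus y - t) :=
    cos_lt_cos_of_abs_lt (abs_lt.2 ⟨by linarith [ht.2], by linarith [ht.1]⟩)
      (by linarith [halfTimePlus_lt y, Real.pi_pos])
  have h2 := sqrt_mul_cos_halfTimePlus y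
  have h3 := mul_lt_mul_of_pos_left h1 (Real.sqrt_pos.2 (radSqPlus_pos y))
  rw [circlePlus_eq]
  simp
  linarith

theorem switchingFunction_circlePlus_pos (c d : ℝ) {y t : ℝ}
    (ht : t ∈ Ioo 0 (2 * halfTimePlus y)) : 0 < switchingFunction c d (circlePlus y t) := by
  have := lt_circlePlus_two ht
  rw [switchingFunction_circlePlus]
  exact mul_pos (by linarith) (by nlinarith [sq_nonneg y])

theorem circleMinus_two_lt {y t : ℝ} (hy : 0 < y) (ht : t ∈ Ioo 0 (2 * halfTimeMinus y)) :
    circleMinus y t 2 < y ^ 2 := by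
  have h1 : Real.cos (halfTimeMinus y) < Real.cos (t - halfTimeMinus y) :=
    cos_lt_cos_of_abs_lt (abs_lt.2 ⟨by linarith [ht.1], by linarith [ht.2]⟩)
      (halfTimeMinus_lt y).le
  have h2 := sqrt_mul_cos_halfTimeMinus hy
  have h3 := mul_lt_mul_of_pos_left h1 (Real.sqrt_pos.2 (radSqMinus_pos y))
  rw [circleMinus_eq hy]
  simp
  linarith

theorem switchingFunction_circleMinus_neg (c d : ℝ) {y t : ℝ} (hy : 1 < y)
    (ht : t ∈ Ioo 0 (2 * halfTimeMinus y)) : switchingFunction c d (circleMinus y t) < 0 := by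
  have hy0 : 0 < y := by linarith
  have h1 := circleMinus_two_lt hy0 ht
  -- For `y > 1` the radius is smaller than `y²`, so the whole circle lies above the second root `1
  -- - y²`.
  have h2 : 1 - y ^ 2 < circleMinus y t 2 := by
    rw [circleMinus_eq hy0]
    simp
    have h3 : √(radSqMinus y) < y ^ 2 := by
      rw [Real.sqrt_lt' (by positivity)]
      unfold radSqMinus; nlinarith
    nlinarith [Real.cos_le_one (t - halfTimeMinus y), Real.sqrt_nonneg (radSqMinus y)]
  rw [switchingFunction_circleMinus]
  exact mul_neg_of_neg_of_pos (by linarith) (by linarith)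

theorem liePlus_unperturbed (c d y z : ℝ) :
    (unperturbedSystem c d).liePlus ![0, y, z] = y * (2 * z + 3) := by
  simp only [PiecewiseSystem.liePlus, unperturbedSystem, fderiv_switchingFunction]
  simp [baseField]; ring

theorem lieMinus_unperturbed (c d y z : ℝ) :
    (unperturbedSystem c d).lieMinus ![0, y, z] = y * (2 * z - 1) := by
  simp only [PiecewiseSystem.lieMinus, unperturbedSystem, fderiv_switchingFunction]
  simp [baseField]; ring

theorem isTwoArc_unperturbed (c d : ℝ) {y : ℝ} (hy : 1 < y) :
    (unperturbedSystem c d).IsTwoArc ![0, y, y ^ 2] ![0, -y, y ^ 2] (2 * halfTimePlus y)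
      (2 * halfTimeMinus y) (circlePlus y) (circleMinus y) where
  σ_pos := by linarith [halfTimePlus_pos (y := y) (by linarith)]
  τ_pos := by linarith [halfTimeMinus_pos y]
  α_zero := circlePlus_zero y
  α_end := circlePlus_end y
  β_zero := circleMinus_zero y
  β_end := circleMinus_end (by linarith)
  hasDerivAt_α := hasDerivAt_circlePlus y
  hasDerivAt_β := hasDerivAt_circleMinus y
  α_pos _ ht := switchingFunction_circlePlus_pos c d ht
  β_neg _ ht := switchingFunction_circleMinus_neg c d hy ht
  h_R := by simp [unperturbedSystem, switchingFunction_of_zero]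
  h_L := by simp [unperturbedSystem, switchingFunction_of_zero]
  liePlus_R := by rw [liePlus_unperturbed]; positivity
  lieMinus_R := by rw [lieMinus_unperturbed]; nlinarith [sq_nonneg (y - 1)]
  liePlus_L := by rw [liePlus_unperturbed]; nlinarith [sq_nonneg y]
  lieMinus_L := by rw [lieMinus_unperturbed]; nlinarith [sq_nonneg (y - 1)]

/-- The unperturbed periodic orbit through `(0, y, y²)`. -/
noncomputable def unperturbedOrbit (y : ℝ) : Set Space3 :=
  PiecewiseSystem.arcs (2 * halfTimePlus y) (2 * halfTimeMinus y) (circlePlus y) (circleMinus y)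

/-- Every crossing periodic orbit of the unperturbed system is one of the explicit ones. -/
theorem exists_eq_unperturbedOrbit {c d : ℝ} {Γ : Set Space3}
    (hΓ : (unperturbedSystem c d).IsCrossingPeriodicOrbit Γ) : ∃ y, 1 < y ∧ Γ = unperturbedOrbit y := by
  obtain ⟨⟨γ, T, hT, hγ, hper, -, rfl⟩, ⟨_, ⟨t₀, rfl⟩, ht₀⟩, hcross⟩ := hΓ
  have hx : ∀ t, γ t 0 = 0 := fun t =>
    eq_zero_of_periodic_of_hasDerivAt_self (x := fun t => γ t 0)
      (fun t => hγ.hasDerivAt_apply 0 (φ := fun p => p 0) (fun p => rfl) (fun p => rfl) (mem_univ t))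
      hT (fun t => by simp only [hper t]) t
  have hγ3 : ∀ t, γ t = ![0, γ t 1, γ t 2] := by
    intro t; ext i; fin_cases i <;> simp [hx]
  have hh := differentiable_switchingFunction c d
  obtain ⟨K, hK⟩ := exists_lipschitzWith_baseField 1
  obtain ⟨K', hK'⟩ := exists_lipschitzWith_baseField (-1)
  -- The product of the Lie derivatives is `y² (2 y² + 3) (2 y² - 1)`; its positivity means `y² > 1
  -- / 2`.
  have hcr : ∀ t, switchingFunction c d (γ t) = 0 → γ t 2 = γ t 1 ^ 2 ∧ 1 / 2 < γ t 1 ^ 2 := by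
    intro t ht
    have h2 := (hcross (γ t) ⟨⟨t, rfl⟩, ht⟩).2
    rw [hγ3 t, switchingFunction_of_zero] at ht
    rw [hγ3 t, liePlus_unperturbed, lieMinus_unperturbed] at h2
    have h3 : γ t 2 = γ t 1 ^ 2 := by linarith
    refine ⟨h3, ?_⟩
    rw [h3] at h2
    by_contra hcon
    have h5 : 2 * γ t 1 ^ 2 - 1 ≤ 0 := by linarith
    have h6 := mul_nonneg (sq_nonneg (γ t 1)) (show 0 ≤ 2 * γ t 1 ^ 2 + 3 by positivity)
    nlinarith [mul_nonneg h6 (neg_nonneg.2 h5)]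
  -- it suffices to deal with a crossing at a point with `y < 0`
  have main : ∀ t₁ y, 0 < y → γ t₁ = ![0, -y, y ^ 2] → 1 < y ∧ range γ = unperturbedOrbit y := by
    intro t₁ y hy h1
    have hL : switchingFunction c d (γ t₁) = 0 := by
      rw [h1, switchingFunction_of_zero]; ring
    have hy2 : 1 / 2 < y ^ 2 := by simpa [h1] using (hcr t₁ hL).2
    have hlp : (unperturbedSystem c d).liePlus (γ t₁) < 0 := by
      rw [h1, liePlus_unperturbed]; nlinarith [sq_nonneg y]
    have hlm : (unperturbedSystem c d).lieMinus (γ t₁) < 0 := by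
      rw [h1, lieMinus_unperturbed]; nlinarith [sq_nonneg y]
    have hfollow : ∀ τ, (∀ t ∈ Ioo 0 τ, switchingFunction c d (circleMinus y t) < 0) →
        ∀ t ∈ Icc 0 τ, γ (t₁ + t) = circleMinus y t := fun τ hτ =>
      hγ.follow_minus hh hK' (hasDerivAt_circleMinus y) (by rw [circleMinus_zero, h1]) hτ hL hlp hlm
    rcases lt_or_ge 1 y with h | h
    · refine ⟨h, ?_⟩
      have hR := hfollow (2 * halfTimeMinus y)
        (fun t ht => switchingFunction_circleMinus_neg c d h ht) (2 * halfTimeMinus y)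
        ⟨by linarith [halfTimeMinus_pos y], le_rfl⟩
      rw [circleMinus_end hy] at hR
      exact (isTwoArc_unperturbed c d h).range_eq hh hK hK' hγ hT hper hR
    -- For `1 / 2 < y² ≤ 1` the `-` arc comes back to the parabola at height `1 - y² < 1 / 2`, which
    -- is impossible for a crossing point. The angle `e` is that of this point, so the arc takes the
    -- time `b - e` to reach it.
    · exfalso
      set r := √(radSqMinus y) with hr
      have hrpos : 0 < r := Real.sqrt_pos.2 (radSqMinus_pos y)
      have hry : y ^ 2 ≤ r := by
        apply Real.le_sqrt_of_sq_le
        unfold radSqMinus; nlinarith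
      have hcosb := sqrt_mul_cos_halfTimeMinus hy
      set b := halfTimeMinus y
      set e := Real.arccos (y ^ 2 / r) with he
      have hcose : r * Real.cos e = y ^ 2 := by
        rw [he, Real.cos_arccos (by linarith [div_nonneg (sq_nonneg y) hrpos.le])
          ((div_le_one hrpos).2 hry)]
        field_simp
      have he0 : 0 ≤ e := Real.arccos_nonneg _
      have heb : e < b := by
        by_contra hcon
        have h2 := Real.cos_le_cos_of_nonneg_of_le_pi (halfTimeMinus_pos y).le
          (Real.arccos_le_pi (y ^ 2 / r)) (not_lt.1 hcon)
        have h3 := mul_le_mul_of_nonneg_left h2 hrpos.le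
        rw [hcose] at h3
        change y ^ 2 ≤ r * Real.cos b at h3
        linarith
      have hend := hfollow (b - e) (fun t ht => by
        have h2 := circleMinus_two_lt (t := t) hy
          ⟨ht.1, by linarith [ht.2, halfTimeMinus_pos y, show b = halfTimeMinus y from rfl]⟩
        have h3 : 1 - y ^ 2 < circleMinus y t 2 := by
          rw [circleMinus_eq hy]
          simp
          have : Real.cos (t - halfTimeMinus y) < Real.cos e := by
            rw [← Real.cos_neg (t - halfTimeMinus y)]
            exact Real.cos_lt_cos_of_nonneg_of_le_pi he0
              (by linarith [ht.1, halfTimeMinus_lt y])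
              (by linarith [ht.2, show b = halfTimeMinus y from rfl])
          have := mul_lt_mul_of_pos_left this hrpos
          rw [hcose] at this
          exact this
        rw [switchingFunction_circleMinus]
        exact mul_neg_of_neg_of_pos (by linarith) (by linarith)) (b - e) ⟨by linarith, le_rfl⟩
      have hz : circleMinus y (b - e) 2 = 1 - y ^ 2 := by
        rw [circleMinus_eq hy]
        simp only [Matrix.cons_val]
        rw [show b - e - halfTimeMinus y = -e by simp [b], Real.cos_neg]
        linarith
      have hsw : switchingFunction c d (circleMinus y (b - e)) = 0 := by
        rw [switchingFunction_circleMinus, hz]; ring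
      rw [← hend] at hsw hz
      obtain ⟨h4, h5⟩ := hcr _ hsw
      linarith
  obtain ⟨h1, h2⟩ := hcr t₀ ht₀
  rcases lt_or_gt_of_ne (show γ t₀ 1 ≠ 0 by intro h; rw [h] at h2; norm_num at h2) with h | h
  · obtain ⟨h3, h4⟩ := main t₀ (-γ t₀ 1) (by linarith) (by rw [hγ3 t₀]; simp [h1])
    exact ⟨_, h3, h4⟩
  -- From a crossing with `y > 0` the `+` arc leads to the mirror image `(0, -y, y²)`, where `main`
  -- applies.
  · set y := γ t₀ 1
    have h3 : γ t₀ = ![0, y, y ^ 2] := by rw [hγ3 t₀, h1]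
    have h4 := hγ.follow_plus (Z := unperturbedSystem c d) hh hK (a := t₀)
      (τ := 2 * halfTimePlus y) (hasDerivAt_circlePlus y) (by rw [circlePlus_zero, h3])
      (fun t ht => switchingFunction_circlePlus_pos c d ht) ht₀
      (by rw [h3, liePlus_unperturbed]; positivity)
      (by rw [h3, lieMinus_unperturbed]; exact mul_pos h (by linarith)) (2 * halfTimePlus y)
      ⟨by linarith [halfTimePlus_pos h], le_rfl⟩
    rw [circlePlus_end] at h4
    obtain ⟨h5, h6⟩ := main _ y h h4
    exact ⟨y, h5, h6⟩

/-! ### The period annulus in polar coordinates -/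

/-- A continuous first integral of the unperturbed system in `x = 0`; its value on the orbit through
`(0, y, y²)`, `y > 1`, is `y²`. -/
noncomputable def levelFunction (p : Space3) : ℝ :=
  max (1 / 2 + √(p 1 ^ 2 + (p 2 - 1) ^ 2 - 3 / 4)) (-3 / 2 + √(p 1 ^ 2 + (p 2 + 1) ^ 2 + 5 / 4))

theorem continuous_levelFunction : Continuous levelFunction := by
  unfold levelFunction; fun_prop

/-- The squared distances from `(0, 1)` and `(0, -1)` differ by `4 z`. Above the parabola the bound
`1` for the first one implies `z > 1` and thus the bound `5` for the second one; below it the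
implication is the other way round. So the maximum selects the right condition on each side. -/
theorem mem_annulus_iff (p : Space3) :
    p ∈ annulusOne ∪ annulusTwo ↔ p 0 = 0 ∧ 1 < levelFunction p := by
  have h1 : 1 < 1 / 2 + √(p 1 ^ 2 + (p 2 - 1) ^ 2 - 3 / 4) ↔ 1 < p 1 ^ 2 + (p 2 - 1) ^ 2 := by
    rw [← sub_lt_iff_lt_add', Real.lt_sqrt (by norm_num)]
    constructor <;> intro h <;> linarith
  have h2 : 1 < -3 / 2 + √(p 1 ^ 2 + (p 2 + 1) ^ 2 + 5 / 4) ↔ 5 < p 1 ^ 2 + (p 2 + 1) ^ 2 := by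
    rw [← sub_lt_iff_lt_add', Real.lt_sqrt (by norm_num)]
    constructor <;> intro h <;> linarith
  rw [levelFunction, lt_max_iff, h1, h2]
  simp only [annulusOne, annulusTwo, mem_union, mem_ofPred_eq]
  constructor
  · rintro (⟨h, h', -⟩ | ⟨h, h', -⟩)
    · exact ⟨h, Or.inl h'⟩
    · exact ⟨h, Or.inr h'⟩
  · rintro ⟨h0, h⟩
    rcases le_or_gt (p 2) (p 1 ^ 2) with hz | hz
    · refine Or.inl ⟨h0, ?_, hz⟩
      rcases h with h | h
      · exact h
      · by_contra hcon
        nlinarith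
    · refine Or.inr ⟨h0, ?_, hz.le⟩
      rcases h with h | h
      · have h3 : 0 < p 2 := lt_of_le_of_lt (sq_nonneg _) hz
        have h4 : 1 < p 2 := by
          by_contra hcon
          nlinarith
        nlinarith
      · exact h

/-- The two terms of the maximum are solutions `r` of `r² - r + 1 = ρ²` and `r² + 3 r + 1 = ρ²`,
where the left sides are the squared radii of the circles through `(√r, r)`. Sublevel sets are
therefore intersections of two discs. -/
theorem levelFunction_le_iff {p : Space3} {r : ℝ} (hr : 1 < r) : levelFunction p ≤ r ↔
    p 1 ^ 2 + (p 2 - 1) ^ 2 ≤ r ^ 2 - r + 1 ∧ p 1 ^ 2 + (p 2 + 1) ^ 2 ≤ r ^ 2 + 3 * r + 1 := by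
  have h1 : 1 / 2 + √(p 1 ^ 2 + (p 2 - 1) ^ 2 - 3 / 4) ≤ r ↔
      p 1 ^ 2 + (p 2 - 1) ^ 2 ≤ r ^ 2 - r + 1 := by
    rw [← le_sub_iff_add_le', Real.sqrt_le_left (by linarith)]
    constructor <;> intro h <;> nlinarith
  have h2 : -3 / 2 + √(p 1 ^ 2 + (p 2 + 1) ^ 2 + 5 / 4) ≤ r ↔
      p 1 ^ 2 + (p 2 + 1) ^ 2 ≤ r ^ 2 + 3 * r + 1 := by
    rw [← le_sub_iff_add_le', Real.sqrt_le_left (by linarith)]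
    constructor <;> intro h <;> nlinarith
  rw [levelFunction, max_le_iff, h1, h2]

theorem le_levelFunction_iff {p : Space3} {r : ℝ} (hr : 1 < r) : r ≤ levelFunction p ↔
    r ^ 2 - r + 1 ≤ p 1 ^ 2 + (p 2 - 1) ^ 2 ∨ r ^ 2 + 3 * r + 1 ≤ p 1 ^ 2 + (p 2 + 1) ^ 2 := by
  have h1 : r ≤ 1 / 2 + √(p 1 ^ 2 + (p 2 - 1) ^ 2 - 3 / 4) ↔
      r ^ 2 - r + 1 ≤ p 1 ^ 2 + (p 2 - 1) ^ 2 := by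
    rw [← sub_le_iff_le_add', Real.le_sqrt' (by linarith)]
    constructor <;> intro h <;> nlinarith
  have h2 : r ≤ -3 / 2 + √(p 1 ^ 2 + (p 2 + 1) ^ 2 + 5 / 4) ↔
      r ^ 2 + 3 * r + 1 ≤ p 1 ^ 2 + (p 2 + 1) ^ 2 := by
    rw [← sub_le_iff_le_add', Real.le_sqrt' (by linarith)]
    constructor <;> intro h <;> nlinarith
  rw [levelFunction, le_max_iff, h1, h2]

/-- Subtracting the equations of the two circles gives `4 z = 4 r`: they meet at height `r`, and
each bounds the intersection of the discs on its own side of this height. -/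
theorem levelFunction_eq_iff {p : Space3} {r : ℝ} (hr : 1 < r) : levelFunction p = r ↔
    (p 1 ^ 2 + (p 2 - 1) ^ 2 = r ^ 2 - r + 1 ∧ p 2 ≤ r) ∨
      (p 1 ^ 2 + (p 2 + 1) ^ 2 = r ^ 2 + 3 * r + 1 ∧ r ≤ p 2) := by
  rw [le_antisymm_iff, levelFunction_le_iff hr, le_levelFunction_iff hr]
  constructor
  · rintro ⟨⟨h1, h2⟩, h3 | h3⟩
    · exact Or.inl ⟨le_antisymm h1 h3, by linarith⟩
    · exact Or.inr ⟨le_antisymm h2 h3, by linarith⟩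
  · rintro (⟨h1, h2⟩ | ⟨h1, h2⟩)
    · exact ⟨⟨h1.le, by linarith⟩, Or.inl h1.ge⟩
    · exact ⟨⟨by linarith, h1.le⟩, Or.inr h1.ge⟩

theorem exists_angle {X Y r θ : ℝ} (hr : 0 < r) (h : X ^ 2 + Y ^ 2 = r ^ 2) (hθ : 0 ≤ θ)
    (hX : r * Real.cos θ ≤ X) :
    ∃ s ∈ Icc (-θ) θ, X = r * Real.cos s ∧ Y = r * Real.sin s := by
  have hn : ‖(⟨X, Y⟩ : ℂ)‖ = r := by
    rw [Complex.norm_def, Complex.normSq_mk, ← pow_two, ← pow_two, h, Real.sqrt_sq hr.le]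
  have hc := Complex.norm_mul_cos_arg (⟨X, Y⟩ : ℂ)
  have hs := Complex.norm_mul_sin_arg (⟨X, Y⟩ : ℂ)
  rw [hn] at hc hs
  refine ⟨Complex.arg ⟨X, Y⟩, abs_le.1 ?_, hc.symm, hs.symm⟩
  by_contra hcon
  have h1 := Real.cos_lt_cos_of_nonneg_of_le_pi hθ (Complex.abs_arg_le_pi ⟨X, Y⟩) (not_le.1 hcon)
  rw [Real.cos_abs] at h1
  have := mul_lt_mul_of_pos_left h1 hr
  simp only at hc
  linarith

theorem mem_unperturbedOrbit_iff {y : ℝ} (hy : 1 < y) (p : Space3) :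
    p ∈ unperturbedOrbit y ↔ p 0 = 0 ∧ levelFunction p = y ^ 2 := by
  have hy0 : 0 < y := by linarith
  have hr : 1 < y ^ 2 := by nlinarith
  have H := isTwoArc_unperturbed 0 0 hy
  rw [levelFunction_eq_iff hr]
  constructor
  · rintro (⟨t, ht, rfl⟩ | ⟨t, ht, rfl⟩)
    · refine ⟨by simp [circlePlus], Or.inr ⟨?_, ?_⟩⟩
      · have := Real.sin_sq_add_cos_sq t
        simp [circlePlus]
        linear_combination (y ^ 2 + (y ^ 2 + 1) ^ 2) * this
      · rcases eq_or_lt_of_le ht.1 with h | h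
        · rw [← h, circlePlus_zero]; simp
        rcases eq_or_lt_of_le ht.2 with h' | h'
        · rw [h', circlePlus_end]; simp
        exact (lt_circlePlus_two ⟨h, h'⟩).le
    · refine ⟨by simp [circleMinus], Or.inl ⟨?_, ?_⟩⟩
      · have := Real.sin_sq_add_cos_sq t
        simp [circleMinus]
        linear_combination (y ^ 2 + (y ^ 2 - 1) ^ 2) * this
      · rcases eq_or_lt_of_le ht.1 with h | h
        · rw [← h, circleMinus_zero]; simp
        rcases eq_or_lt_of_le ht.2 with h' | h'
        · rw [h', circleMinus_end hy0]; simp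
        exact (circleMinus_two_lt hy0 ⟨h, h'⟩).le
  · have hp3 : p 0 = 0 → p = ![0, p 1, p 2] := by
      intro h; ext i; fin_cases i <;> simp [h]
    rintro ⟨h0, ⟨h1, h2⟩ | ⟨h1, h2⟩⟩
    · obtain ⟨s, hs, hs1, hs2⟩ := exists_angle (X := 1 - p 2) (Y := p 1) (θ := halfTimeMinus y)
        (Real.sqrt_pos.2 (radSqMinus_pos y))
        (by rw [Real.sq_sqrt (radSqMinus_pos y).le]; unfold radSqMinus; linarith)
        (halfTimeMinus_pos y).le (by rw [sqrt_mul_cos_halfTimeMinus hy0]; linarith)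
      refine Or.inr ⟨s + halfTimeMinus y, ⟨by linarith [hs.1], by linarith [hs.2]⟩, ?_⟩
      rw [circleMinus_eq hy0, add_sub_cancel_right, ← hs1, ← hs2, sub_sub_cancel, ← hp3 h0]
    · obtain ⟨s, hs, hs1, hs2⟩ := exists_angle (X := p 2 + 1) (Y := p 1) (θ := halfTimePlus y)
        (Real.sqrt_pos.2 (radSqPlus_pos y))
        (by rw [Real.sq_sqrt (radSqPlus_pos y).le]; unfold radSqPlus; linarith)
        (halfTimePlus_pos hy0).le (by rw [sqrt_mul_cos_halfTimePlus]; linarith)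
      refine Or.inl ⟨halfTimePlus y - s, ⟨by linarith [hs.2], by linarith [hs.1]⟩, ?_⟩
      rw [circlePlus_eq, sub_sub_cancel, ← hs1, ← hs2, add_sub_cancel_right, ← hp3 h0]

theorem unperturbedOrbit_subset {y : ℝ} (hy : 1 < y) :
    unperturbedOrbit y ⊆ annulusOne ∪ annulusTwo := by
  intro p hp
  rw [mem_unperturbedOrbit_iff hy] at hp
  rw [mem_annulus_iff, hp.2]
  exact ⟨hp.1, by nlinarith⟩

/-- The distance between `(0, 0, 1)` and the point of the orbit of level `r` in the direction `w`. -/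
noncomputable def orbitRadius (w : ℂ) (r : ℝ) : ℝ :=
  min √(r ^ 2 - r + 1) (-2 * w.im + √(r ^ 2 + 3 * r + 1 - 4 * w.re ^ 2))

theorem re_sq_add_im_sq {w : ℂ} (hw : ‖w‖ = 1) : w.re ^ 2 + w.im ^ 2 = 1 := by
  have := Complex.sq_norm w
  rw [hw, Complex.normSq_apply] at this
  linarith

/-- The centre `(0, 1)` of the polar coordinates is inside the `+` circle: its distance from `(0,
-1)` is `2`, and `4 < r² + 3 r + 1`. -/
theorem two_mul_abs_im_lt {w : ℂ} (hw : ‖w‖ = 1) {r : ℝ} (hr : 1 < r) :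
    2 * |w.im| < √(r ^ 2 + 3 * r + 1 - 4 * w.re ^ 2) := by
  apply Real.lt_sqrt_of_sq_lt
  rw [mul_pow, sq_abs]
  nlinarith [re_sq_add_im_sq hw]

theorem orbitRadius_pos {w : ℂ} (hw : ‖w‖ = 1) {r : ℝ} (hr : 1 < r) : 0 < orbitRadius w r := by
  refine lt_min (Real.sqrt_pos.2 (by nlinarith)) ?_
  have := two_mul_abs_im_lt hw hr
  linarith [le_abs_self w.im]

/-- The point of the plane `x = 0` at distance `s` from `(0, 0, 1)` in the direction `w`. -/
noncomputable def polarPoint (w : ℂ) (s : ℝ) : Space3 := ![0, s * w.re, 1 + s * w.im]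

/-- A ray from `(0, 1)` starts inside both discs and leaves their intersection exactly once, at the
smaller of the two exit distances. Both inequalities between `s` and `orbitRadius w r` are
translated separately. -/
theorem levelFunction_polarPoint_eq_iff {w : ℂ} (hw : ‖w‖ = 1) {r s : ℝ} (hr : 1 < r)
    (hs : 0 < s) : levelFunction (polarPoint w s) = r ↔ s = orbitRadius w r := by
  have hri := re_sq_add_im_sq hw
  have hlt := two_mul_abs_im_lt hw hr
  have habs := neg_abs_le w.im
  have h1 : (polarPoint w s) 1 ^ 2 + ((polarPoint w s) 2 - 1) ^ 2 = s ^ 2 := by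
    simp [polarPoint]; linear_combination s ^ 2 * hri
  have h2 : (polarPoint w s) 1 ^ 2 + ((polarPoint w s) 2 + 1) ^ 2 =
      (s + 2 * w.im) ^ 2 + 4 * w.re ^ 2 := by
    simp [polarPoint]; linear_combination (s ^ 2 - 4) * hri
  have hρ : ∀ a : ℝ, 0 < a → (s ≤ √a ↔ s ^ 2 ≤ a) := fun a _ => Real.le_sqrt' hs
  have e1 : s ≤ orbitRadius w r ↔ levelFunction (polarPoint w s) ≤ r := by
    rw [levelFunction_le_iff hr, orbitRadius, le_min_iff, h1, h2, Real.le_sqrt' hs]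
    refine and_congr_right fun _ => ?_
    constructor
    · intro h
      have := Real.sq_sqrt (show 0 ≤ r ^ 2 + 3 * r + 1 - 4 * w.re ^ 2 by
        nlinarith [sq_nonneg w.im])
      nlinarith
    · intro h
      have := Real.abs_le_sqrt (show (s + 2 * w.im) ^ 2 ≤ r ^ 2 + 3 * r + 1 - 4 * w.re ^ 2 by
        linarith)
      linarith [le_abs_self (s + 2 * w.im)]
  have e2 : orbitRadius w r ≤ s ↔ r ≤ levelFunction (polarPoint w s) := by
    rw [le_levelFunction_iff hr, orbitRadius, min_le_iff, h1, h2]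
    refine or_congr ?_ ?_
    · rw [Real.sqrt_le_left hs.le]
    · rw [← le_sub_iff_add_le', show s - -2 * w.im = s + 2 * w.im by ring]
      constructor
      · intro h
        have h0 := Real.sqrt_nonneg (r ^ 2 + 3 * r + 1 - 4 * w.re ^ 2)
        have := (Real.sqrt_le_left (h0.trans h)).1 h
        linarith
      · intro h
        have h3 : √(r ^ 2 + 3 * r + 1 - 4 * w.re ^ 2) ≤ |s + 2 * w.im| :=
          Real.sqrt_le_iff.2 ⟨abs_nonneg _, by rw [sq_abs]; linarith⟩
        rcases abs_cases (s + 2 * w.im) with ⟨h4, -⟩ | ⟨h4, -⟩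
        · rwa [h4] at h3
        · linarith
  rw [le_antisymm_iff, ← e1, ← e2, ← le_antisymm_iff]

/-- The direction of a point of the plane `x = 0`, seen from `(0, 0, 1)`. -/
noncomputable def polarVector (p : Space3) : ℂ := ⟨p 1, p 2 - 1⟩

theorem polarVector_ne_zero {p : Space3} (hp : 1 < levelFunction p) : polarVector p ≠ 0 := by
  intro h
  have h1 : p 1 = 0 := congrArg Complex.re h
  have h2 : p 2 - 1 = 0 := congrArg Complex.im h
  have h3 : levelFunction p ≤ 1 := by
    rw [levelFunction, h1, h2, show p 2 = 1 by linarith]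
    refine max_le ?_ ?_
    · rw [Real.sqrt_eq_zero_of_nonpos (by norm_num)]; norm_num
    · rw [← le_sub_iff_add_le', Real.sqrt_le_left (by norm_num)]; norm_num
  linarith

theorem polarPoint_polarVector {p : Space3} (h0 : p 0 = 0) (hp : polarVector p ≠ 0) :
    polarPoint (polarVector p / ‖polarVector p‖) ‖polarVector p‖ = p := by
  have hn : ‖polarVector p‖ ≠ 0 := norm_ne_zero_iff.2 hp
  ext i
  fin_cases i
  · simp [polarPoint, h0]
  · simp only [polarPoint, Complex.div_ofReal_re]
    simp [polarVector]
    rw [← polarVector]; field_simp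
  · simp only [polarPoint, Complex.div_ofReal_im]
    simp [polarVector]
    rw [← polarVector]; field_simp; ring

theorem polarVector_polarPoint (w : ℂ) (s : ℝ) : polarVector (polarPoint w s) = s * w := by
  apply Complex.ext <;> simp [polarVector, polarPoint]

/-- Polar coordinates on the annulus, the radius being replaced by the level of the orbit. -/
noncomputable def annulusHomeomorph :
    (Circle × Ioi (1 : ℝ)) ≃ₜ (annulusOne ∪ annulusTwo : Set Space3) where
  toFun q := ⟨polarPoint q.1 (orbitRadius q.1 q.2), by
    rw [mem_annulus_iff]
    refine ⟨by simp [polarPoint], ?_⟩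
    rw [(levelFunction_polarPoint_eq_iff (Circle.norm_coe q.1) q.2.2
      (orbitRadius_pos (Circle.norm_coe q.1) q.2.2)).2 rfl]
    exact q.2.2⟩
  invFun p := ⟨⟨polarVector p / ‖polarVector p‖, by
    rw [Submonoid.unitSphere, Submonoid.mem_mk, Subsemigroup.mem_mk, mem_sphere_zero_iff_norm, norm_div, Complex.norm_real, norm_norm]
    exact div_self (norm_ne_zero_iff.2 (polarVector_ne_zero ((mem_annulus_iff _).1 p.2).2))⟩,
    ⟨levelFunction p, ((mem_annulus_iff _).1 p.2).2⟩⟩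
  left_inv q := by
    have hs := orbitRadius_pos (Circle.norm_coe q.1) q.2.2
    apply Prod.ext
    · apply Circle.ext
      simp only [polarVector_polarPoint, norm_mul, Complex.norm_real, Circle.norm_coe, mul_one,
        Real.norm_eq_abs, abs_of_pos hs]
      exact mul_div_cancel_left₀ _ (Complex.ofReal_ne_zero.2 hs.ne')
    · exact Subtype.ext ((levelFunction_polarPoint_eq_iff (Circle.norm_coe q.1) q.2.2 hs).2 rfl)
  right_inv p := by
    obtain ⟨h0, h1⟩ := (mem_annulus_iff _).1 p.2
    have hne := polarVector_ne_zero h1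
    have hpos := norm_pos_iff.2 hne
    have hw : ‖polarVector p / ‖polarVector p‖‖ = 1 := by
      rw [norm_div, Complex.norm_real, norm_norm]
      exact div_self hpos.ne'
    apply Subtype.ext
    have h2 := (levelFunction_polarPoint_eq_iff hw h1 hpos).1
      (by rw [polarPoint_polarVector h0 hne])
    simp only
    rw [← h2, polarPoint_polarVector h0 hne]
  continuous_toFun := by
    refine Continuous.subtype_mk ?_ _
    have h1 : Continuous fun q : Circle × Ioi (1 : ℝ) => ((q.1 : ℂ)).re :=
      Complex.continuous_re.comp (continuous_subtype_val.comp continuous_fst)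
    have h2 : Continuous fun q : Circle × Ioi (1 : ℝ) => ((q.1 : ℂ)).im :=
      Complex.continuous_im.comp (continuous_subtype_val.comp continuous_fst)
    have h3 : Continuous fun q : Circle × Ioi (1 : ℝ) => orbitRadius q.1 q.2 := by
      unfold orbitRadius; fun_prop
    refine continuous_pi fun i => ?_
    fin_cases i
    · simpa [polarPoint] using continuous_const
    · exact h3.mul h1
    · exact continuous_const.add (h3.mul h2)
  continuous_invFun := by
    have h1 : Continuous fun p : (annulusOne ∪ annulusTwo : Set Space3) => polarVector p := by
      have : Continuous fun p : (annulusOne ∪ annulusTwo : Set Space3) =>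
          ((p.1 1 : ℝ) : ℂ) + ((p.1 2 - 1 : ℝ) : ℂ) * Complex.I :=
        (Complex.continuous_ofReal.comp ((continuous_apply 1).comp continuous_subtype_val)).add
          ((Complex.continuous_ofReal.comp (((continuous_apply 2).comp
            continuous_subtype_val).sub continuous_const)).mul continuous_const)
      refine this.congr fun p => ?_
      apply Complex.ext <;> simp [polarVector]
    refine Continuous.prodMk ?_ ?_
    · refine Continuous.subtype_mk (h1.div (Complex.continuous_ofReal.comp h1.norm) fun p => ?_) _
      refine Complex.ofReal_ne_zero.2 ?_
      exact norm_ne_zero_iff.2 (polarVector_ne_zero ((mem_annulus_iff _).1 p.2).2)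
    · exact (continuous_levelFunction.comp continuous_subtype_val).subtype_mk _

theorem range_annulusHomeomorph (r : Ioi (1 : ℝ)) :
    (range fun θ : Circle => (annulusHomeomorph (θ, r) : Space3)) = unperturbedOrbit √r := by
  have hr1 : (1 : ℝ) < r := r.2
  have hy : 1 < √(r : ℝ) := by
    rw [Real.lt_sqrt (by norm_num)]; simpa using hr1
  have hlev : ∀ q, levelFunction (annulusHomeomorph q) = q.2 := fun q =>
    congrArg (fun x : Circle × Ioi (1 : ℝ) => (x.2 : ℝ)) (annulusHomeomorph.symm_apply_apply q)
  ext p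
  rw [mem_unperturbedOrbit_iff hy, Real.sq_sqrt (by linarith)]
  constructor
  · rintro ⟨θ, rfl⟩
    exact ⟨((mem_annulus_iff _).1 (annulusHomeomorph (θ, r)).2).1, hlev _⟩
  · rintro ⟨h0, h1⟩
    have hp : p ∈ annulusOne ∪ annulusTwo := (mem_annulus_iff p).2 ⟨h0, by rw [h1]; exact hr1⟩
    refine ⟨(annulusHomeomorph.symm ⟨p, hp⟩).1, ?_⟩
    have h2 : (annulusHomeomorph.symm ⟨p, hp⟩).2 = r := Subtype.ext h1
    simp only
    rw [← h2, Prod.mk.eta, annulusHomeomorph.apply_symm_apply]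

theorem isCrossingPeriodicOrbit_unperturbedOrbit (c d : ℝ) {y : ℝ} (hy : 1 < y) :
    (unperturbedSystem c d).IsCrossingPeriodicOrbit (unperturbedOrbit y) :=
  (isTwoArc_unperturbed c d hy).isCrossingPeriodicOrbit

theorem isPeriodAnnulus_unperturbed (c d : ℝ) :
    (unperturbedSystem c d).IsPeriodAnnulus (annulusOne ∪ annulusTwo) := by
  refine ⟨annulusHomeomorph, fun r => ?_⟩
  have hr1 : (1 : ℝ) < r := r.2
  rw [range_annulusHomeomorph]
  refine isCrossingPeriodicOrbit_unperturbedOrbit c d ?_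
  rw [Real.lt_sqrt (by norm_num)]; simpa using hr1

theorem annulus_subset_planeS : annulusOne ∪ annulusTwo ⊆ planeS :=
  fun p hp => ((mem_annulus_iff p).1 hp).1

theorem crossingPeriodicOrbit_subset_annulus {c d : ℝ} {Γ : Set Space3}
    (hΓ : (unperturbedSystem c d).IsCrossingPeriodicOrbit Γ) : Γ ⊆ annulusOne ∪ annulusTwo := by
  obtain ⟨y, hy, rfl⟩ := exists_eq_unperturbedOrbit hΓ
  exact unperturbedOrbit_subset hy

/-! ### Smooth dependence of the first return time -/

section HittingTime

variable {E : Type*} [NormedAddCommGroup E] [NormedSpace ℝ E] [CompleteSpace E]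

theorem isInvertible_toSpanSingleton {A : ℝ →L[ℝ] ℝ} (hA : A 1 ≠ 0) : A.IsInvertible := by
  refine ⟨ContinuousLinearEquiv.unitsEquivAut ℝ (Units.mk0 (A 1) hA), ?_⟩
  ext
  simp

/-- The first positive zero of `H (q, ·)` depends smoothly on `q`, if it is a transversal one. -/
theorem exists_hitting_time {H H' : E × ℝ → ℝ} {n : WithTop ℕ∞} (hn : n ≠ 0)
    (hH : ContDiff ℝ n H)
    (hH' : Continuous H') (hd : ∀ q t, HasDerivAt (fun t => H (q, t)) (H' (q, t)) t)
    (h0 : ∀ q, H (q, 0) = 0) {q₀ : E} {t₀ : ℝ} (ht₀ : 0 < t₀) (hend : H (q₀, t₀) = 0)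
    (hstart' : 0 < H' (q₀, 0)) (hend' : H' (q₀, t₀) < 0)
    (hpos : ∀ t ∈ Ioo 0 t₀, 0 < H (q₀, t)) :
    ∃ τ : E → ℝ, τ q₀ = t₀ ∧ ContDiffAt ℝ n τ q₀ ∧ ∀ᶠ q in 𝓝 q₀, 0 < τ q ∧ H (q, τ q) = 0 ∧
      (∀ t ∈ Ioo 0 (τ q), 0 < H (q, t)) ∧ 0 < H' (q, 0) ∧ H' (q, τ q) < 0 := by
  have hcd : ContDiffAt ℝ n H (q₀, t₀) := hH.contDiffAt
  have hinv : (fderiv ℝ H (q₀, t₀) ∘L .inr ℝ E ℝ).IsInvertible := by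
    apply isInvertible_toSpanSingleton
    have h1 : HasFDerivAt H (fderiv ℝ H (q₀, t₀)) (q₀, t₀) :=
      (hcd.differentiableAt hn).hasFDerivAt
    have h2 : HasDerivAt (fun t : ℝ => ((q₀, t) : E × ℝ)) ((0 : E), (1 : ℝ)) t₀ :=
      (hasDerivAt_const t₀ q₀).prodMk (hasDerivAt_id t₀)
    have h3 := (h1.comp_hasDerivAt t₀ h2).unique (hd q₀ t₀)
    simp only [ContinuousLinearMap.comp_apply, ContinuousLinearMap.inr_apply]
    rw [h3]
    exact hend'.ne
  have hτc := hcd.contDiffAt_implicitFunction hn hinv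
  have hτ0 := hcd.implicitFunction_apply_self hn hinv
  have hτe := hcd.eventually_apply_implicitFunction hn hinv
  set τ := hcd.implicitFunction hn hinv
  simp only at hτc hτ0 hτe
  have hτt : Tendsto τ (𝓝 q₀) (𝓝 t₀) := by
    have := hτc.continuousAt.tendsto
    rwa [hτ0] at this
  refine ⟨τ, hτ0, hτc, ?_⟩
  have hA : ∀ᶠ x in 𝓝 (q₀, (0 : ℝ)), 0 < H' x :=
    hH'.continuousAt.eventually (lt_mem_nhds hstart')
  have hB : ∀ᶠ x in 𝓝 (q₀, t₀), H' x < 0 := hH'.continuousAt.eventually (gt_mem_nhds hend')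
  rw [nhds_prod_eq] at hA hB
  obtain ⟨pa, hpa, pb, hpb, hAB⟩ := eventually_prod_iff.1 hA
  obtain ⟨pc, hpc, pd, hpd, hCD⟩ := eventually_prod_iff.1 hB
  obtain ⟨δ₁, hδ₁, hδ₁'⟩ := Metric.eventually_nhds_iff.1 hpb
  obtain ⟨δ₂, hδ₂, hδ₂'⟩ := Metric.eventually_nhds_iff.1 hpd
  -- The interval `(0, τ q)` is cut into three pieces. Near `0` the function increases from `0`,
  -- near `t₀` it decreases to `0`, and on the compact middle piece positivity is an open condition.
  -- Taking minima with `t₀` keeps the middle piece inside `(0, t₀)`.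
  have hK : ∀ᶠ q in 𝓝 q₀, ∀ t ∈ Icc (min δ₁ t₀ / 2) (t₀ - min δ₂ t₀ / 2), 0 < H (q, t) := by
    refine isCompact_Icc.eventually_forall_of_forall_eventually fun t ht => ?_
    refine hH.continuous.continuousAt.eventually (lt_mem_nhds (hpos t ⟨?_, ?_⟩))
    · have := lt_min hδ₁ ht₀
      linarith [ht.1]
    · have := lt_min hδ₂ ht₀
      linarith [ht.2]
  filter_upwards [hpa, hpc, hK, hτe, hτt.eventually (lt_mem_nhds ht₀),
    hτt.eventually (Metric.ball_mem_nhds t₀ (show 0 < min δ₂ t₀ / 2 from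
      half_pos (lt_min hδ₂ ht₀)))] with q h1 h2 h3 h4 h5 h6
  rw [hend] at h4
  have hmin₁ := min_le_left δ₁ t₀
  have hmin₂ := min_le_left δ₂ t₀
  have hm₁ := lt_min hδ₁ ht₀
  have hm₂ := lt_min hδ₂ ht₀
  rw [Real.dist_eq, abs_lt] at h6
  have hcq : Continuous fun t => H (q, t) := hH.continuous.comp (by fun_prop)
  refine ⟨h5, h4, fun t ht => ?_, hAB h1 (hδ₁' (by simpa using hδ₁)), hCD h2 (hδ₂' ?_)⟩
  · rcases lt_or_ge t (min δ₁ t₀ / 2) with hc | hc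
    · have hmono : StrictMonoOn (fun t => H (q, t)) (Icc 0 t) := by
        refine strictMonoOn_of_deriv_pos (convex_Icc 0 t) hcq.continuousOn fun s hs => ?_
        rw [interior_Icc] at hs
        rw [(hd q s).deriv]
        refine hAB h1 (hδ₁' ?_)
        rw [Real.dist_eq, sub_zero, abs_of_pos hs.1]
        linarith [hs.2]
      have := hmono (left_mem_Icc.2 ht.1.le) (right_mem_Icc.2 ht.1.le) ht.1
      simpa only [h0] using this
    rcases le_or_gt t (t₀ - min δ₂ t₀ / 2) with hc' | hc'
    · exact h3 t ⟨hc, hc'⟩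
    · have hanti : StrictAntiOn (fun t => H (q, t)) (Icc t (τ q)) := by
        refine strictAntiOn_of_deriv_neg (convex_Icc _ _) hcq.continuousOn fun s hs => ?_
        rw [interior_Icc] at hs
        rw [(hd q s).deriv]
        refine hCD h2 (hδ₂' ?_)
        rw [Real.dist_eq, abs_lt]
        constructor <;> linarith [hs.1, hs.2, h6.2]
      have := hanti (left_mem_Icc.2 ht.2.le) (right_mem_Icc.2 ht.2.le) ht.2
      simpa only [h4] using this
  · rw [Real.dist_eq, abs_lt]
    constructor <;> linarith [h6.1, h6.2]

end HittingTime

/-! ### Hadamard's lemma -/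

section Hadamard

variable {F : Type*} [NormedAddCommGroup F] [NormedSpace ℝ F]

/-- Differentiation under the integral sign. The maps `m s` contract the first coordinate and fix
`(0, q₀)`, so they preserve the balls about it, on which the derivative of `φ` is bounded by the
constant `C`. -/
theorem contDiffAt_integral_smul_left {φ : ℝ × F → ℝ} {q₀ : F}
    (hφ : ContDiffAt ℝ 1 φ (0, q₀)) :
    ContDiffAt ℝ 1 (fun e : ℝ × F => ∫ s in (0 : ℝ)..1, φ (s * e.1, e.2)) (0, q₀) := by
  obtain ⟨φ', u, hu, hφ'c, hφ'⟩ := contDiffAt_one_iff.1 hφ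
  have hcont : ContinuousAt φ' (0, q₀) := hφ'c.continuousAt hu
  have hbd : ∀ᶠ e in 𝓝 ((0 : ℝ), q₀), ‖φ' e‖ < ‖φ' (0, q₀)‖ + 1 :=
    hcont.norm.eventually (gt_mem_nhds (lt_add_one _))
  obtain ⟨r, hr, hball⟩ := Metric.mem_nhds_iff.1 (inter_mem hu hbd)
  set C := ‖φ' (0, q₀)‖ + 1
  let m : ℝ → ℝ × F →L[ℝ] ℝ × F := fun s =>
    (s • ContinuousLinearMap.fst ℝ ℝ F).prod (ContinuousLinearMap.snd ℝ ℝ F)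
  have hm : ∀ s e, m s e = (s * e.1, e.2) := fun s e => rfl
  have hmn : ∀ s ∈ Icc (0 : ℝ) 1, ‖m s‖ ≤ 1 := by
    intro s hs
    refine ContinuousLinearMap.opNorm_le_bound _ zero_le_one fun e => ?_
    rw [hm, one_mul, Prod.norm_def, Prod.norm_def]
    refine max_le_max ?_ le_rfl
    rw [norm_mul, Real.norm_eq_abs s, abs_of_nonneg hs.1]
    exact mul_le_of_le_one_left (norm_nonneg _) hs.2
  have hmb : ∀ s ∈ Icc (0 : ℝ) 1, ∀ e ∈ Metric.ball ((0 : ℝ), q₀) r,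
      m s e ∈ Metric.ball ((0 : ℝ), q₀) r := by
    intro s hs e he
    rw [mem_ball_iff_norm] at he ⊢
    have h1 : m s (0, q₀) = (0, q₀) := by rw [hm, mul_zero]
    have h2 : m s e - (0, q₀) = m s (e - (0, q₀)) := by rw [map_sub, h1]
    rw [h2]
    refine lt_of_le_of_lt ((m s).le_opNorm _) (lt_of_le_of_lt ?_ he)
    exact mul_le_of_le_one_left (norm_nonneg _) (hmn s hs)
  have hmc : Continuous m := by
    have h1 : m = fun s => s • (ContinuousLinearMap.fst ℝ ℝ F).prod 0 +
        ContinuousLinearMap.prod 0 (ContinuousLinearMap.snd ℝ ℝ F) := by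
      funext s
      ext e <;> simp [hm]
    rw [h1]
    fun_prop
  have hmc2 : ∀ e, Continuous fun s => m s e := fun e => by simp only [hm]; fun_prop
  have hφb : ContinuousOn φ (Metric.ball ((0 : ℝ), q₀) r) := fun e he =>
    (hφ' e (hball he).1).continuousAt.continuousWithinAt
  have hφ'b : ContinuousOn φ' (Metric.ball ((0 : ℝ), q₀) r) :=
    hφ'c.mono fun e he => (hball he).1
  have hi : uIoc (0 : ℝ) 1 = Ioc 0 1 := uIoc_of_le zero_le_one
  have hc1 : ∀ e ∈ Metric.ball ((0 : ℝ), q₀) r, ContinuousOn (fun s => φ (m s e)) (Icc 0 1) :=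
    fun e he => hφb.comp (hmc2 e).continuousOn fun s hs => hmb s hs e he
  have hc2 : ∀ e ∈ Metric.ball ((0 : ℝ), q₀) r,
      ContinuousOn (fun s => (φ' (m s e)).comp (m s)) (Icc 0 1) := by
    intro e he
    exact (hφ'b.comp (hmc2 e).continuousOn fun s hs => hmb s hs e he).clm_comp hmc.continuousOn
  have hbound : ∀ s ∈ Icc (0 : ℝ) 1, ∀ e ∈ Metric.ball ((0 : ℝ), q₀) r,
      ‖(φ' (m s e)).comp (m s)‖ ≤ C := by
    intro s hs e he
    refine (ContinuousLinearMap.opNorm_comp_le _ _).trans ?_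
    have h1 := (hball (hmb s hs e he)).2
    exact (mul_le_of_le_one_right (norm_nonneg _) (hmn s hs)).trans (le_of_lt h1)
  rw [contDiffAt_one_iff]
  refine ⟨fun e => ∫ s in (0 : ℝ)..1, (φ' (m s e)).comp (m s), Metric.ball (0, q₀) r,
    Metric.ball_mem_nhds _ hr, ?_, ?_⟩
  · intro e he
    refine ContinuousAt.continuousWithinAt ?_
    have hnb : Metric.ball ((0 : ℝ), q₀) r ∈ 𝓝 e := Metric.isOpen_ball.mem_nhds he
    refine intervalIntegral.continuousAt_of_dominated_interval (bound := fun _ => C) ?_ ?_ ?_ ?_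
    · filter_upwards [hnb] with e' he'
      rw [hi]
      exact ((hc2 e' he').mono Ioc_subset_Icc_self).aestronglyMeasurable measurableSet_Ioc
    · filter_upwards [hnb] with e' he'
      refine MeasureTheory.ae_of_all _ fun s hs => ?_
      rw [hi] at hs
      exact hbound s (Ioc_subset_Icc_self hs) e' he'
    · exact intervalIntegrable_const
    · refine MeasureTheory.ae_of_all _ fun s hs => ?_
      rw [hi] at hs
      have h1 := hmb s (Ioc_subset_Icc_self hs) e he
      have h2 : ContinuousAt φ' (m s e) := hφ'b.continuousAt (Metric.isOpen_ball.mem_nhds h1)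
      have h3 : ContinuousAt (fun e => φ' (m s e)) e :=
        ContinuousAt.comp (f := fun e => m s e) h2 (m s).continuous.continuousAt
      exact h3.clm_comp continuousAt_const
  · intro e he
    have hnb : Metric.ball ((0 : ℝ), q₀) r ∈ 𝓝 e := Metric.isOpen_ball.mem_nhds he
    refine intervalIntegral.hasFDerivAt_integral_of_dominated_of_fderiv_le
      (F := fun e s => φ (s * e.1, e.2)) (F' := fun e s => (φ' (m s e)).comp (m s)) (bound := fun _ => C) hnb ?_ ?_ ?_ ?_ ?_ ?_
    · filter_upwards [hnb] with e' he'
      rw [hi]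
      exact ((hc1 e' he').mono Ioc_subset_Icc_self).aestronglyMeasurable measurableSet_Ioc
    · refine ContinuousOn.intervalIntegrable ?_
      rw [uIcc_of_le zero_le_one]
      exact hc1 e he
    · rw [hi]
      exact ((hc2 e he).mono Ioc_subset_Icc_self).aestronglyMeasurable measurableSet_Ioc
    · refine MeasureTheory.ae_of_all _ fun s hs e' he' => ?_
      rw [hi] at hs
      exact hbound s (Ioc_subset_Icc_self hs) e' he'
    · exact intervalIntegrable_const
    · refine MeasureTheory.ae_of_all _ fun s hs e' he' => ?_
      rw [hi] at hs
      have h1 := hmb s (Ioc_subset_Icc_self hs) e' he'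
      exact (hφ' _ (hball h1).1).comp e' (m s).hasFDerivAt

/-- **Hadamard's lemma**: a `C²` function that vanishes for `ε = 0` is `ε` times a `C¹` function. -/
theorem exists_eq_mul_of_eq_zero {f : ℝ × F → ℝ} {q₀ : F} (hf : ContDiffAt ℝ 2 f (0, q₀))
    (h0 : ∀ᶠ q in 𝓝 q₀, f (0, q) = 0) :
    ∃ g : ℝ × F → ℝ, ContDiffAt ℝ 1 g (0, q₀) ∧ ∀ᶠ e in 𝓝 ((0 : ℝ), q₀), f e = e.1 * g e := by
  have hφ : ContDiffAt ℝ 1 (fun e => fderiv ℝ f e (1, 0)) (0, q₀) := by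
    have := hf.fderiv_right (m := 1) (by norm_num)
    exact this.clm_apply contDiffAt_const
  -- The quotient is the integral over `s` in `[0, 1]` of the partial derivative of `f` with respect
  -- to `ε` at `(s ε, q)`; the identity is the fundamental theorem of calculus along this segment.
  refine ⟨_, contDiffAt_integral_smul_left hφ, ?_⟩
  have hf1 : ∀ᶠ e in 𝓝 ((0 : ℝ), q₀), ContDiffAt ℝ 2 f e := hf.eventually (by simp)
  have h0' : ∀ᶠ e in 𝓝 ((0 : ℝ), q₀), f (0, e.2) = 0 :=
    (continuous_snd.tendsto ((0 : ℝ), q₀)).eventually h0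
  obtain ⟨r, hr, hball⟩ := Metric.mem_nhds_iff.1 (inter_mem hf1 h0')
  filter_upwards [Metric.ball_mem_nhds _ hr] with e he
  have hmem : ∀ s ∈ uIcc (0 : ℝ) 1, (s * e.1, e.2) ∈ Metric.ball ((0 : ℝ), q₀) r := by
    intro s hs
    rw [uIcc_of_le zero_le_one] at hs
    rw [Metric.mem_ball, Prod.dist_eq, max_lt_iff] at he ⊢
    refine ⟨lt_of_le_of_lt ?_ he.1, he.2⟩
    rw [Real.dist_eq, Real.dist_eq, sub_zero, sub_zero, abs_mul, abs_of_nonneg hs.1]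
    exact mul_le_of_le_one_left (abs_nonneg _) hs.2
  have hd : ∀ s ∈ uIcc (0 : ℝ) 1, HasDerivAt (fun s => f (s * e.1, e.2))
      (e.1 * fderiv ℝ f (s * e.1, e.2) (1, 0)) s := by
    intro s hs
    have h1 : HasFDerivAt f (fderiv ℝ f (s * e.1, e.2)) (s * e.1, e.2) :=
      ((show ContDiffAt ℝ 2 f _ from (hball (hmem s hs)).1).differentiableAt (by simp)).hasFDerivAt
    have h2 : HasDerivAt (fun s : ℝ => ((s * e.1, e.2) : ℝ × F)) (e.1, 0) s :=
      (hasDerivAt_mul_const e.1).prodMk (hasDerivAt_const s e.2)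
    refine (h1.comp_hasDerivAt s h2).congr_deriv ?_
    rw [show ((e.1, 0) : ℝ × F) = e.1 • (1, 0) by simp, map_smul, smul_eq_mul]
  have hcont : ContinuousOn (fun s => e.1 * fderiv ℝ f (s * e.1, e.2) (1, 0)) (uIcc (0 : ℝ) 1) := by
    intro s hs
    have h1 : ContinuousAt (fderiv ℝ f) (s * e.1, e.2) :=
      ((show ContDiffAt ℝ 2 f _ from (hball (hmem s hs)).1).fderiv_right (m := 1)
        (by norm_num)).continuousAt
    have h2 : ContinuousAt (fun s : ℝ => fderiv ℝ f (s * e.1, e.2)) s :=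
      ContinuousAt.comp (f := fun s : ℝ => ((s * e.1, e.2) : ℝ × F)) h1 (by fun_prop)
    exact (continuousAt_const.mul (h2.clm_apply continuousAt_const)).continuousWithinAt
  have := intervalIntegral.integral_eq_sub_of_hasDerivAt hd hcont.intervalIntegrable
  have hz : f (0, e.2) = 0 := (hball he).2
  rw [intervalIntegral.integral_const_mul, one_mul, zero_mul, hz, sub_zero] at this
  exact this.symm

end Hadamard

/-! ### Isolated fixed points of perturbed planar maps -/

/-- A fixed point at which the derivative is diagonalizable with positive eigenvalues different
from `1` is the only periodic point whose orbit stays near it. -/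
theorem exists_nhds_periodic_eq {F : ℝ × ℝ → ℝ × ℝ} {p : ℝ × ℝ} (hp : F p = p)
    {D : ℝ × ℝ →L[ℝ] ℝ × ℝ} (hF : HasFDerivAt F D p) {w : Fin 2 → (ℝ × ℝ →L[ℝ] ℝ)} {κ : Fin 2 → ℝ}
    (hw : ∀ i v, w i (D v) = κ i * w i v) (hκ0 : ∀ i, 0 < κ i) (hκ1 : ∀ i, κ i ≠ 1)
    (hinj : ∀ v, (∀ i, w i v = 0) → v = 0) :
    ∃ V ∈ 𝓝 p, ∀ (x : ℕ → ℝ × ℝ) (n : ℕ), 0 < n → (∀ k, x k ∈ V) → (∀ k, x (k + 1) = F (x k)) →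
      x n = x 0 → x 0 = p := by
  let W : ℝ × ℝ →L[ℝ] (Fin 2 → ℝ) := ContinuousLinearMap.pi w
  have hWinj : Function.Injective W := by
    rw [injective_iff_map_eq_zero]
    intro v hv
    exact hinj v fun i => congrFun hv i
  obtain ⟨C, hCpos, hC⟩ := (W : ℝ × ℝ →ₗ[ℝ] (Fin 2 → ℝ)).exists_antilipschitzWith
    (LinearMap.ker_eq_bot.2 hWinj)
  have hCb : ∀ v, ‖v‖ ≤ C * ‖W v‖ := fun v => by
    simpa using hC.le_mul_dist v 0
  obtain ⟨η, hη, hηκ⟩ : ∃ η > 0, ∀ i, η < |κ i - 1| := by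
    refine ⟨min |κ 0 - 1| |κ 1 - 1| / 2, ?_, ?_⟩
    · exact half_pos (lt_min (abs_pos.2 (sub_ne_zero.2 (hκ1 0))) (abs_pos.2 (sub_ne_zero.2 (hκ1 1))))
    · have h0 := lt_min (abs_pos.2 (sub_ne_zero.2 (hκ1 0))) (abs_pos.2 (sub_ne_zero.2 (hκ1 1)))
      intro i
      have h1 := min_le_left |κ 0 - 1| |κ 1 - 1|
      have h2 := min_le_right |κ 0 - 1| |κ 1 - 1|
      fin_cases i
      · simp only [Fin.zero_eta]; linarith
      · simp only [Fin.mk_one]; linarith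
  -- The scaling makes the linearization error, measured in the eigencoordinates `W`, at most `η ‖W
  -- (x - p)‖`, with `η` below every distance of an eigenvalue from `1`. Adding `1` to `‖W‖` gives a
  -- positive denominator.
  have hden : 0 < (‖W‖ + 1) * C := mul_pos (by positivity) (by exact_mod_cast hCpos)
  have hsmall := hF.isLittleO.def (show 0 < η / ((‖W‖ + 1) * C) from div_pos hη hden)
  refine ⟨_, hsmall, ?_⟩
  intro x n hn hxV hx hxn
  have hstep : ∀ k i, |w i (x (k + 1) - p) - κ i * w i (x k - p)| ≤ η * ‖W (x k - p)‖ := by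
    intro k i
    have h1 : ‖F (x k) - F p - D (x k - p)‖ ≤ η / ((‖W‖ + 1) * C) * ‖x k - p‖ := hxV k
    rw [hp, ← hx k] at h1
    rw [← hw, ← map_sub]
    calc |w i (x (k + 1) - p - D (x k - p))| = ‖W (x (k + 1) - p - D (x k - p)) i‖ := rfl
      _ ≤ ‖W (x (k + 1) - p - D (x k - p))‖ := norm_le_pi_norm _ i
      _ ≤ ‖W‖ * ‖x (k + 1) - p - D (x k - p)‖ := W.le_opNorm _
      _ ≤ (‖W‖ + 1) * (η / ((‖W‖ + 1) * C) * (C * ‖W (x k - p)‖)) := by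
          refine mul_le_mul (by linarith) (h1.trans ?_) (norm_nonneg _) (by positivity)
          exact mul_le_mul_of_nonneg_left (hCb _) (div_pos hη hden).le
      _ = η * ‖W (x k - p)‖ := by
          have : (C : ℝ) ≠ 0 := by exact_mod_cast hCpos.ne'
          have : ‖W‖ + 1 ≠ 0 := by positivity
          field_simp
  have hper : ∀ k, x (k + n) = x k := by
    intro k
    induction k with
    | zero => simpa using hxn
    | succ k ih => rw [show k + 1 + n = k + n + 1 by ring, hx, ih, ← hx]
  obtain ⟨m, -, hm⟩ := Finset.exists_max_image (Finset.range n) (fun k => ‖W (x k - p)‖)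
    ⟨0, Finset.mem_range.2 hn⟩
  have hmax : ∀ k, ‖W (x k - p)‖ ≤ ‖W (x m - p)‖ := by
    intro k
    induction k using Nat.strong_induction_on with
    | _ k ih =>
      rcases lt_or_ge k n with h | h
      · exact hm k (Finset.mem_range.2 h)
      · have := ih (k - n) (by omega)
        rwa [← hper (k - n), Nat.sub_add_cancel h] at this
  set M := ‖W (x m - p)‖ with hM
  obtain ⟨i, hi⟩ : ∃ i, |w i (x m - p)| = M := by
    have h1 : ∃ i, M ≤ |w i (x m - p)| := by
      by_contra hcon
      push Not at hcon
      have hMpos : 0 < M := lt_of_le_of_lt (abs_nonneg _) (hcon 0)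
      exact lt_irrefl M ((pi_norm_lt_iff hMpos).2 hcon)
    obtain ⟨i, hi⟩ := h1
    exact ⟨i, le_antisymm (norm_le_pi_norm (W (x m - p)) i) hi⟩
  -- At the point of a cycle where `‖W (x - p)‖` is maximal, take an eigencoordinate that attains
  -- the maximum. If its eigenvalue exceeds `1`, the next point would be farther away; if it is
  -- below `1`, the preceding point would have been. Periodicity supplies the preceding point.
  have hM0 : M ≤ 0 := by
    by_contra hcon
    have hMpos := not_le.1 hcon
    rcases lt_or_gt_of_ne (hκ1 i) with h | h
    · have h1 := hstep (m + n - 1) i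
      rw [show m + n - 1 + 1 = m + n by omega, hper m] at h1
      have h2 : |w i (x (m + n - 1) - p)| ≤ M :=
        (norm_le_pi_norm (W (x (m + n - 1) - p)) i).trans (hmax _)
      have h3 := hηκ i
      rw [abs_of_neg (by linarith)] at h3
      have h4 := abs_sub_abs_le_abs_sub (w i (x m - p)) (κ i * w i (x (m + n - 1) - p))
      rw [abs_mul, abs_of_pos (hκ0 i), hi] at h4
      have h5 := mul_le_mul_of_nonneg_left h2 (hκ0 i).le
      have h6 := mul_le_mul_of_nonneg_left (hmax (m + n - 1)) hη.le
      nlinarith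
    · have h1 := hstep m i
      have h2 : |w i (x (m + 1) - p)| ≤ M :=
        (norm_le_pi_norm (W (x (m + 1) - p)) i).trans (hmax _)
      have h3 := hηκ i
      rw [abs_of_pos (by linarith)] at h3
      have h4 := abs_sub_abs_le_abs_sub (κ i * w i (x m - p)) (w i (x (m + 1) - p))
      rw [abs_mul, abs_of_pos (hκ0 i), hi, abs_sub_comm] at h4
      nlinarith
  have h0 : W (x 0 - p) = 0 := norm_le_zero_iff.1 ((hmax 0).trans hM0)
  have := hWinj (h0.trans (map_zero W).symm)
  exact sub_eq_zero.1 this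

theorem apply_eq_of_prod (A : ℝ × ℝ →L[ℝ] ℝ) (v : ℝ × ℝ) :
    A v = v.1 * A (1, 0) + v.2 * A (0, 1) := by
  conv_lhs => rw [show v = v.1 • ((1 : ℝ), (0 : ℝ)) + v.2 • ((0 : ℝ), (1 : ℝ)) by ext <;> simp]
  rw [map_add, map_smul, map_smul, smul_eq_mul, smul_eq_mul]

/-- A one-parameter family of maps of the plane, which for `ε = 0` is expanding in the first
coordinate and the identity in the second one: a simple zero of the first-order displacement gives a
curve of fixed points, isolated among the periodic points. -/
theorem exists_isolated_fixed_point {P₁ P₂ : ℝ × (ℝ × ℝ) → ℝ} {y₀ : ℝ} {X μ : ℝ → ℝ}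
    {X' μ' lam : ℝ} (hP₁ : ContDiffAt ℝ 2 P₁ (0, (X y₀, y₀)))
    (hP₂ : ContDiffAt ℝ 2 P₂ (0, (X y₀, y₀)))
    (hid : ∀ᶠ q in 𝓝 (X y₀, y₀), P₂ (0, q) = q.2) (hX : HasDerivAt X X' y₀)
    (hfix : ∀ᶠ y in 𝓝 y₀, P₁ (0, (X y, y)) = X y)
    (hlam : HasDerivAt (fun ξ => P₁ (0, (ξ, y₀))) lam (X y₀)) (hlam1 : 1 < lam)
    (hμ : ∀ᶠ y in 𝓝 y₀, HasDerivAt (fun ε => P₂ (ε, (X y, y))) (μ y) 0) (hμ0 : μ y₀ = 0)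
    (hμ' : HasDerivAt μ μ' y₀) (hμ'0 : μ' ≠ 0) :
    ∃ p : ℝ → ℝ × ℝ, Tendsto p (𝓝[≠] 0) (𝓝 (X y₀, y₀)) ∧ ∀ᶠ ε in 𝓝[≠] 0,
      (P₁ (ε, p ε), P₂ (ε, p ε)) = p ε ∧ ∃ V ∈ 𝓝 (p ε), ∀ (x : ℕ → ℝ × ℝ) (n : ℕ), 0 < n →
        (∀ k, x k ∈ V) → (∀ k, x (k + 1) = (P₁ (ε, x k), P₂ (ε, x k))) → x n = x 0 →
          x 0 = p ε := by
  set q₀ : ℝ × ℝ := (X y₀, y₀) with hq₀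
  -- The second component of the fixed point equation is degenerate at `ε = 0`. Dividing it by `ε`
  -- gives the system `G = (P₁ - ξ, g)`, to which the implicit function theorem applies.
  obtain ⟨g, hg, hfg⟩ := exists_eq_mul_of_eq_zero (f := fun e => P₂ e - e.2.2) (q₀ := q₀)
    (hP₂.sub (by fun_prop)) (by filter_upwards [hid] with q hq; simp [hq])
  set G₁ : ℝ × (ℝ × ℝ) → ℝ := fun e => P₁ e - e.2.1 with hG₁
  have hG₁c : ContDiffAt ℝ 1 G₁ (0, q₀) :=
    (hP₁.of_le (by norm_num)).sub (by fun_prop)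
  set G : ℝ × (ℝ × ℝ) → ℝ × ℝ := fun e => (G₁ e, g e) with hG
  have hGc : ContDiffAt ℝ 1 G (0, q₀) := hG₁c.prodMk hg
  -- `g (0, ·)` is the first-order displacement
  have hgc : ∀ᶠ e in 𝓝 ((0 : ℝ), q₀), ContinuousAt g e :=
    (hg.eventually (by simp)).mono fun e he => he.continuousAt
  have hcurve : Tendsto (fun y => ((0 : ℝ), (X y, y))) (𝓝 y₀) (𝓝 (0, q₀)) := by
    have := hX.continuousAt
    have h : ContinuousAt (fun y => ((0 : ℝ), (X y, y))) y₀ := by fun_prop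
    exact h
  have hgμ : ∀ᶠ y in 𝓝 y₀, g (0, (X y, y)) = μ y := by
    filter_upwards [hμ, hcurve.eventually hgc, hcurve.eventually hfg.eventually_nhds]
      with y h1 h2 h3
    have h4 : Tendsto (fun ε : ℝ => (ε, (X y, y))) (𝓝 0) (𝓝 (0, (X y, y))) := by
      have h : ContinuousAt (fun ε : ℝ => (ε, (X y, y))) 0 := by fun_prop
      exact h
    have h6 : Tendsto (fun ε : ℝ => g (ε, (X y, y))) (𝓝[≠] 0) (𝓝 (g (0, (X y, y)))) :=
      (h2.tendsto.comp h4).mono_left nhdsWithin_le_nhds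
    refine tendsto_nhds_unique h6 ((hasDerivAt_iff_tendsto_slope.1 h1).congr' ?_)
    have h7 : P₂ (0, (X y, y)) - y = 0 := by simpa using h3.self_of_nhds
    filter_upwards [self_mem_nhdsWithin, (h4.eventually h3).filter_mono nhdsWithin_le_nhds]
      with ε hε h8
    have hε' : ε ≠ 0 := hε
    rw [slope_def_field, sub_zero, div_eq_iff hε', mul_comm, ← h8]
    linarith
  -- the derivative with respect to `q`
  have hdG : HasFDerivAt G (fderiv ℝ G (0, q₀)) (0, q₀) :=
    (hGc.differentiableAt one_ne_zero).hasFDerivAt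
  have hdG₁ : ∀ᶠ e in 𝓝 ((0 : ℝ), q₀), ContDiffAt ℝ 1 G₁ e := hG₁c.eventually (by simp)
  have hdg : ∀ᶠ e in 𝓝 ((0 : ℝ), q₀), ContDiffAt ℝ 1 g e := hg.eventually (by simp)
  have hG₁' : HasFDerivAt G₁ (fderiv ℝ G₁ (0, q₀)) (0, q₀) :=
    (hG₁c.differentiableAt one_ne_zero).hasFDerivAt
  have hg' : HasFDerivAt g (fderiv ℝ g (0, q₀)) (0, q₀) :=
    (hg.differentiableAt one_ne_zero).hasFDerivAt
  have hGeq : fderiv ℝ G (0, q₀) = (fderiv ℝ G₁ (0, q₀)).prod (fderiv ℝ g (0, q₀)) :=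
    hdG.unique (hG₁'.prodMk hg')
  have hG₁ξ : fderiv ℝ G₁ (0, q₀) (0, (1, 0)) = lam - 1 := by
    have h1 : HasDerivAt (fun ξ : ℝ => ((0 : ℝ), (ξ, y₀))) (0, (1, 0)) (X y₀) :=
      (hasDerivAt_const _ _).prodMk ((hasDerivAt_id _).prodMk (hasDerivAt_const _ _))
    have h2 : HasDerivAt (fun ξ => G₁ (0, (ξ, y₀))) (lam - 1) (X y₀) := hlam.sub (hasDerivAt_id _)
    have h3 := HasFDerivAt.comp_hasDerivAt (l := G₁) (X y₀) hG₁' h1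
    exact h3.unique h2
  have hcurve' : HasDerivAt (fun y => ((0 : ℝ), (X y, y))) (0, (X', 1)) y₀ :=
    (hasDerivAt_const _ _).prodMk (hX.prodMk (hasDerivAt_id _))
  have hG₁y : fderiv ℝ G₁ (0, q₀) (0, (X', 1)) = 0 := by
    refine (hG₁'.comp_hasDerivAt y₀ hcurve').unique ?_
    refine (hasDerivAt_const y₀ (0 : ℝ)).congr_of_eventuallyEq ?_
    filter_upwards [hfix] with y hy
    simp [G₁, hy]
  have hgy : fderiv ℝ g (0, q₀) (0, (X', 1)) = μ' :=
    (hg'.comp_hasDerivAt y₀ hcurve').unique (hμ'.congr_of_eventuallyEq hgμ)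
  -- On the basis `(X', 1)`, `(1, 0)` the derivative is triangular: the tangent of the curve of
  -- fixed points goes to `(0, μ')`, and the first component of the image of `(1, 0)` is `lam - 1`.
  have hinv : (fderiv ℝ G (0, q₀) ∘L .inr ℝ ℝ (ℝ × ℝ)).IsInvertible := by
    set A := fderiv ℝ G (0, q₀) ∘L .inr ℝ ℝ (ℝ × ℝ) with hA
    have hAv : ∀ v, A v = (fderiv ℝ G₁ (0, q₀) (0, v), fderiv ℝ g (0, q₀) (0, v)) := by
      intro v; rw [hA, hGeq]; rfl
    have hinj : Function.Injective A := by
      rw [injective_iff_map_eq_zero]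
      intro v hv
      have hv' : v = v.2 • (X', (1 : ℝ)) + (v.1 - v.2 * X') • ((1 : ℝ), (0 : ℝ)) := by
        ext <;> simp
      have h1 : A (X', 1) = (0, μ') := by rw [hAv, hG₁y, hgy]
      have h2 : (A (1, 0)).1 = lam - 1 := by rw [hAv, hG₁ξ]
      rw [hv', map_add, map_smul, map_smul, h1] at hv
      have h3 := congrArg Prod.fst hv
      have h4 := congrArg Prod.snd hv
      simp only [Prod.fst_add, Prod.smul_fst, Prod.snd_add, Prod.smul_snd, smul_eq_mul, mul_zero,
        zero_add, h2, Prod.fst_zero, Prod.snd_zero] at h3 h4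
      have h5 : v.1 - v.2 * X' = 0 := by
        rcases mul_eq_zero.1 h3 with h | h
        · exact h
        · linarith
      rw [h5, zero_mul, add_zero] at h4
      have h6 : v.2 = 0 := by
        rcases mul_eq_zero.1 h4 with h | h
        · exact h
        · exact absurd h hμ'0
      rw [h6] at h5
      exact Prod.ext (by simpa using h5) h6
    refine ⟨(LinearEquiv.ofInjectiveEndo (A : ℝ × ℝ →ₗ[ℝ] ℝ × ℝ) hinj).toContinuousLinearEquiv, ?_⟩
    ext <;> rfl
  have hG0 : G (0, q₀) = 0 := by
    have h1 := hgμ.self_of_nhds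
    have h2 := hfix.self_of_nhds
    simp [G, G₁, hq₀, h1, h2, hμ0]
  set p := hGc.implicitFunction one_ne_zero hinv with hp
  have hp0 : p 0 = q₀ := hGc.implicitFunction_apply_self one_ne_zero hinv
  have hpc : Tendsto p (𝓝 0) (𝓝 q₀) := by
    have := (hGc.contDiffAt_implicitFunction one_ne_zero hinv).continuousAt.tendsto
    rwa [← hp, hp0] at this
  have hpG : ∀ᶠ ε in 𝓝 0, G (ε, p ε) = 0 := by
    have := hGc.eventually_apply_implicitFunction one_ne_zero hinv
    rwa [hG0] at this
  refine ⟨p, hpc.mono_left nhdsWithin_le_nhds, ?_⟩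
  have hpp : Tendsto (fun ε => (ε, p ε)) (𝓝 0) (𝓝 (0, q₀)) := by
    rw [nhds_prod_eq]; exact tendsto_id.prodMk hpc
  -- the entries of the derivative minus the identity
  have hcG₁ : Tendsto (fun ε => fderiv ℝ G₁ (ε, p ε)) (𝓝 0) (𝓝 (fderiv ℝ G₁ (0, q₀))) :=
    (hG₁c.fderiv_right (m := 0) (by norm_num)).continuousAt.tendsto.comp hpp
  have hcg : Tendsto (fun ε => fderiv ℝ g (ε, p ε)) (𝓝 0) (𝓝 (fderiv ℝ g (0, q₀))) :=
    (hg.fderiv_right (m := 0) (by norm_num)).continuousAt.tendsto.comp hpp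
  have happ : ∀ {A : ℝ → (ℝ × (ℝ × ℝ) →L[ℝ] ℝ)} {A₀ : ℝ × (ℝ × ℝ) →L[ℝ] ℝ} (v : ℝ × (ℝ × ℝ)),
      Tendsto A (𝓝 0) (𝓝 A₀) → Tendsto (fun ε => A ε v) (𝓝 0) (𝓝 (A₀ v)) := fun v h =>
    ((ContinuousLinearMap.apply ℝ ℝ v).continuous.tendsto _).comp h
  set k := lam - 1 with hk
  have hkpos : 0 < k := by rw [hk]; linarith
  set a : ℝ → ℝ := fun ε => fderiv ℝ G₁ (ε, p ε) (0, (1, 0)) with ha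
  set b : ℝ → ℝ := fun ε => fderiv ℝ G₁ (ε, p ε) (0, (0, 1)) with hb
  set c' : ℝ → ℝ := fun ε => fderiv ℝ g (ε, p ε) (0, (1, 0)) with hc'
  set d' : ℝ → ℝ := fun ε => fderiv ℝ g (ε, p ε) (0, (0, 1)) with hd'
  have ta : Tendsto a (𝓝 0) (𝓝 k) := by rw [← hG₁ξ]; exact happ _ hcG₁
  obtain ⟨b₀, tb⟩ : ∃ b₀, Tendsto b (𝓝 0) (𝓝 b₀) := ⟨_, happ _ hcG₁⟩
  obtain ⟨c₀, tc, hc₀⟩ : ∃ c₀, Tendsto c' (𝓝 0) (𝓝 c₀) ∧ c₀ = fderiv ℝ g (0, q₀) (0, (1, 0)) :=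
    ⟨_, happ _ hcg, rfl⟩
  obtain ⟨d₀, td, hd₀⟩ : ∃ d₀, Tendsto d' (𝓝 0) (𝓝 d₀) ∧ d₀ = fderiv ℝ g (0, q₀) (0, (0, 1)) :=
    ⟨_, happ _ hcg, rfl⟩
  have hb₀ : b₀ = fderiv ℝ G₁ (0, q₀) (0, (0, 1)) := tendsto_nhds_unique tb (happ _ hcG₁)
  have hdet0 : k * d₀ - b₀ * c₀ = k * μ' := by
    have h1 : ((0 : ℝ), (X', (1 : ℝ))) = X' • ((0 : ℝ), ((1 : ℝ), (0 : ℝ))) + (0, (0, 1)) := by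
      simp
    rw [h1, map_add, map_smul, smul_eq_mul] at hG₁y hgy
    rw [hG₁ξ, ← hb₀] at hG₁y
    rw [← hc₀, ← hd₀] at hgy
    linear_combination k * hgy - c₀ * hG₁y
  have tid : Tendsto (fun ε : ℝ => ε) (𝓝 0) (𝓝 0) := tendsto_id
  have tn21 : Tendsto (fun ε => ε * c' ε) (𝓝 0) (𝓝 0) := by simpa using tid.mul tc
  have tn22 : Tendsto (fun ε => ε * d' ε) (𝓝 0) (𝓝 0) := by simpa using tid.mul td
  have tdet : Tendsto (fun ε => a ε * d' ε - b ε * c' ε) (𝓝 0) (𝓝 (k * μ')) := by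
    rw [← hdet0]; exact (ta.mul td).sub (tb.mul tc)
  -- The derivative of the map minus the identity has the rows `(a, b)` and `ε (c', d')`; `s` and
  -- `Δ` are its trace and determinant.
  set s : ℝ → ℝ := fun ε => a ε + ε * d' ε with hs
  have ts : Tendsto s (𝓝 0) (𝓝 k) := by simpa using ta.add tn22
  set Δ : ℝ → ℝ := fun ε => ε * (a ε * d' ε - b ε * c' ε) with hΔ
  have tΔ : Tendsto Δ (𝓝 0) (𝓝 0) := by simpa using tid.mul tdet
  -- The larger root of the characteristic polynomial tends to `lam - 1`. The other root `s - ν`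
  -- tends to `0`, but it is nonzero for `ε ≠ 0` because the product of the roots is `Δ`.
  set ν : ℝ → ℝ := fun ε => (s ε + √(s ε ^ 2 - 4 * Δ ε)) / 2 with hν
  have tdisc : Tendsto (fun ε => s ε ^ 2 - 4 * Δ ε) (𝓝 0) (𝓝 (k ^ 2)) := by
    simpa using (ts.pow 2).sub (tΔ.const_mul 4)
  have tν : Tendsto ν (𝓝 0) (𝓝 k) := by
    have := (ts.add (Real.continuous_sqrt.continuousAt.tendsto.comp tdisc)).div_const 2
    simp only [Real.sqrt_sq hkpos.le, add_self_div_two] at this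
    exact this
  have tν₂ : Tendsto (fun ε => s ε - ν ε) (𝓝 0) (𝓝 0) := by simpa using ts.sub tν
  -- Up to sign this is the determinant of the two left eigenvectors used below. Its positive limit
  -- makes them independent.
  have tw : Tendsto (fun ε => (ν ε - ε * d' ε) ^ 2 + b ε * (ε * c' ε)) (𝓝 0) (𝓝 (k ^ 2)) := by
    simpa using ((tν.sub tn22).pow 2).add (tb.mul tn21)
  have hdetne : ∀ᶠ ε in 𝓝 (0 : ℝ), a ε * d' ε - b ε * c' ε ≠ 0 :=
    tdet.eventually_ne (mul_ne_zero hkpos.ne' hμ'0)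
  have hkk : 0 < k ^ 2 := by positivity
  have hall : ∀ᶠ ε in 𝓝 (0 : ℝ), G (ε, p ε) = 0 ∧ (∀ᶠ e in 𝓝 (ε, p ε), P₂ e - e.2.2 = e.1 * g e) ∧
      ContDiffAt ℝ 1 G₁ (ε, p ε) ∧ ContDiffAt ℝ 1 g (ε, p ε) ∧ 0 < s ε ^ 2 - 4 * Δ ε ∧ 0 < ν ε ∧
      |s ε - ν ε| < 1 ∧ 0 < (ν ε - ε * d' ε) ^ 2 + b ε * (ε * c' ε) ∧
      a ε * d' ε - b ε * c' ε ≠ 0 := by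
    filter_upwards [hpG, hpp.eventually hfg.eventually_nhds, hpp.eventually hdG₁,
      hpp.eventually hdg, tdisc.eventually (lt_mem_nhds hkk), tν.eventually (lt_mem_nhds hkpos),
      (by simpa using tν₂.abs : Tendsto (fun ε => |s ε - ν ε|) (𝓝 0) (𝓝 0)).eventually
        (gt_mem_nhds zero_lt_one), tw.eventually (lt_mem_nhds hkk), hdetne]
      with ε h1 h2 h3 h4 h5 h6 h7 h8 h9
    exact ⟨h1, h2, h3, h4, h5, h6, h7, h8, h9⟩
  filter_upwards [hall.filter_mono nhdsWithin_le_nhds, self_mem_nhdsWithin] with ε hε hεne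
  have hεne' : ε ≠ 0 := hεne
  obtain ⟨h1, h2, h3, h4, h5, h6, h7, h8, h9⟩ := hε
  have e1 : P₁ (ε, p ε) = (p ε).1 := sub_eq_zero.1 (congrArg Prod.fst h1)
  have e2 : P₂ (ε, p ε) = (p ε).2 := by
    have h10 : g (ε, p ε) = 0 := congrArg Prod.snd h1
    have h11 := h2.self_of_nhds
    rw [h10, mul_zero] at h11
    exact sub_eq_zero.1 h11
  have hfixed : (P₁ (ε, p ε), P₂ (ε, p ε)) = p ε := Prod.ext e1 e2
  refine ⟨hfixed, ?_⟩
  have hinr : HasFDerivAt (fun q : ℝ × ℝ => (ε, q)) (.inr ℝ ℝ (ℝ × ℝ)) (p ε) :=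
    hasFDerivAt_prodMk_right ε (p ε)
  have hd₁ : HasFDerivAt (fun q : ℝ × ℝ => P₁ (ε, q))
      (fderiv ℝ G₁ (ε, p ε) ∘L .inr ℝ ℝ (ℝ × ℝ) + .fst ℝ ℝ ℝ) (p ε) := by
    have := ((h3.differentiableAt one_ne_zero).hasFDerivAt.comp (p ε) hinr).add
      (hasFDerivAt_fst (p := p ε))
    refine this.congr_of_eventuallyEq (Eventually.of_forall fun q => ?_)
    simp [G₁]
  have hd₂ : HasFDerivAt (fun q : ℝ × ℝ => P₂ (ε, q))
      (ε • (fderiv ℝ g (ε, p ε) ∘L .inr ℝ ℝ (ℝ × ℝ)) + .snd ℝ ℝ ℝ) (p ε) := by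
    have := (((h4.differentiableAt one_ne_zero).hasFDerivAt.comp (p ε) hinr).const_smul ε).add
      (hasFDerivAt_snd (p := p ε))
    refine this.congr_of_eventuallyEq ?_
    have ht : Tendsto (fun q : ℝ × ℝ => (ε, q)) (𝓝 (p ε)) (𝓝 (ε, p ε)) := hinr.continuousAt.tendsto
    filter_upwards [ht.eventually h2] with q hq
    simp only [Pi.add_apply, Pi.smul_apply, Function.comp_apply, smul_eq_mul]
    linarith
  set ν₂ := s ε - ν ε with hν₂
  have hνν : ν ε * ν₂ = Δ ε := by
    have := Real.sq_sqrt h5.le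
    simp only [hν₂, hν]
    linear_combination (-1 / 4 : ℝ) * this
  have hchar : (ν ε - ε * d' ε) * (ν ε - a ε) = b ε * (ε * c' ε) := by
    have h11 : ν₂ = a ε + ε * d' ε - ν ε := rfl
    have h12 : Δ ε = ε * (a ε * d' ε - b ε * c' ε) := rfl
    rw [h11, h12] at hνν
    linear_combination -hνν
  have hν₂0 : ν₂ ≠ 0 := by
    intro h
    rw [h, mul_zero] at hνν
    exact mul_ne_zero hεne' h9 hνν.symm
  have hν₂e : ν₂ = a ε + ε * d' ε - ν ε := rfl
  rw [abs_lt] at h7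
  refine exists_nhds_periodic_eq (F := fun q => (P₁ (ε, q), P₂ (ε, q))) hfixed (hd₁.prodMk hd₂)
    (w := ![(ν ε - ε * d' ε) • .fst ℝ ℝ ℝ + b ε • .snd ℝ ℝ ℝ,
      (ε * c' ε) • .fst ℝ ℝ ℝ + (ν₂ - a ε) • .snd ℝ ℝ ℝ]) (κ := ![1 + ν ε, 1 + ν₂]) ?_ ?_ ?_ ?_
  · intro i v
    have hA₁ := apply_eq_of_prod (fderiv ℝ G₁ (ε, p ε) ∘L .inr ℝ ℝ (ℝ × ℝ)) v
    have hA₂ := apply_eq_of_prod (fderiv ℝ g (ε, p ε) ∘L .inr ℝ ℝ (ℝ × ℝ)) v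
    simp only [ContinuousLinearMap.comp_apply, ContinuousLinearMap.inr_apply] at hA₁ hA₂
    fin_cases i
    · simp [hA₁, hA₂]
      change (ν ε - ε * d' ε) * (v.1 * a ε + v.2 * b ε + v.1) +
        b ε * (ε * (v.1 * c' ε + v.2 * d' ε) + v.2) =
          (1 + ν ε) * ((ν ε - ε * d' ε) * v.1 + b ε * v.2)
      linear_combination -v.1 * hchar
    · simp [hA₁, hA₂]
      change (ε * c' ε) * (v.1 * a ε + v.2 * b ε + v.1) +
        (ν₂ - a ε) * (ε * (v.1 * c' ε + v.2 * d' ε) + v.2) =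
          (1 + ν₂) * (ε * c' ε * v.1 + (ν₂ - a ε) * v.2)
      rw [hν₂e]
      linear_combination -v.2 * hchar
  · intro i
    fin_cases i
    · simp; linarith
    · simp; linarith
  · intro i
    fin_cases i
    · simp; exact h6.ne'
    · simp; exact hν₂0
  · intro v hv
    have e0 := hv 0
    have e1' := hv 1
    simp at e0 e1'
    rw [hν₂e] at e1'
    have hv1 : v.1 * ((ν ε - ε * d' ε) ^ 2 + b ε * (ε * c' ε)) = 0 := by
      linear_combination (ν ε - ε * d' ε) * e0 + b ε * e1'
    have hv2 : v.2 * ((ν ε - ε * d' ε) ^ 2 + b ε * (ε * c' ε)) = 0 := by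
      linear_combination (ε * c' ε) * e0 - (ν ε - ε * d' ε) * e1'
    exact Prod.ext ((mul_eq_zero.1 hv1).resolve_right h8.ne')
      ((mul_eq_zero.1 hv2).resolve_right h8.ne')

/-! ### Affine flows, scaled coordinates and half turns -/

/-- `ψ (ε, p, t)` is the flow of the family of vector fields `X ε`. -/
structure IsFlow (X : ℝ → Space3 → Space3) (ψ : ℝ × Space3 × ℝ → Space3) : Prop where
  contDiff : ContDiff ℝ 2 ψ
  zero : ∀ ε p, ψ (ε, p, 0) = p
  hasDerivAt : ∀ ε p t, HasDerivAt (fun t => ψ (ε, p, t)) (X ε (ψ (ε, p, t))) t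

/-- An affine field becomes linear on `Space3 × ℝ` when the added coordinate is kept equal to `1`.
The flow is then an operator exponential, hence smooth in time, point and parameter together. -/
theorem exists_flow_of_affine (A₀ A₁ : Space3 →L[ℝ] Space3) (m₀ m₁ : Space3) :
    ∃ ψ, IsFlow (fun ε p => m₀ + A₀ p + ε • (m₁ + A₁ p)) ψ := by
  let B : (Space3 →L[ℝ] Space3) → Space3 → (Space3 × ℝ →L[ℝ] Space3 × ℝ) := fun A m =>
    (A ∘L .fst ℝ Space3 ℝ + (ContinuousLinearMap.snd ℝ Space3 ℝ).smulRight m).prod 0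
  have hB : ∀ A m w, B A m w = (A w.1 + w.2 • m, 0) := fun A m w => rfl
  let C : ℝ → (Space3 × ℝ →L[ℝ] Space3 × ℝ) := fun ε => B A₀ m₀ + ε • B A₁ m₁
  have hexp : ContDiff ℝ 2 (NormedSpace.exp : (Space3 × ℝ →L[ℝ] Space3 × ℝ) → _) :=
    contDiff_iff_contDiffAt.2 fun x => (NormedSpace.exp_analytic (𝕂 := ℝ) x).contDiffAt
  let Ψ : ℝ × Space3 × ℝ → Space3 × ℝ := fun a => NormedSpace.exp (a.2.2 • C a.1) (a.2.1, 1)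
  have hΨ : ContDiff ℝ 2 Ψ := by
    have h1 : ContDiff ℝ 2 fun a : ℝ × Space3 × ℝ => a.2.2 • C a.1 := by
      simp only [C]; fun_prop
    exact (hexp.comp h1).clm_apply (by fun_prop)
  have hd : ∀ ε p t, HasDerivAt (fun t => Ψ (ε, p, t)) (C ε (Ψ (ε, p, t))) t := by
    intro ε p t
    have h1 := hasDerivAt_exp_smul_const' (𝕂 := ℝ) (C ε) t
    have h2 := h1.clm_apply (hasDerivAt_const t ((p, 1) : Space3 × ℝ))
    simpa using h2
  have h0 : ∀ ε p, Ψ (ε, p, 0) = (p, 1) := by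
    intro ε p
    simp [Ψ]
  have hsnd : ∀ ε p t, (Ψ (ε, p, t)).2 = 1 := by
    intro ε p t
    have h1 : ∀ t, HasDerivAt (fun t => (Ψ (ε, p, t)).2) 0 t := by
      intro t
      have := (ContinuousLinearMap.snd ℝ Space3 ℝ).hasFDerivAt.comp_hasDerivAt t (hd ε p t)
      exact this.congr_deriv (by simp [C, hB])
    have := is_const_of_deriv_eq_zero (fun t => (h1 t).differentiableAt) (fun t => (h1 t).deriv) t 0
    rw [this, h0]
  refine ⟨fun a => (Ψ a).1, hΨ.fst, fun ε p => by rw [h0], fun ε p t => ?_⟩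
  have h1 := (ContinuousLinearMap.fst ℝ Space3 ℝ).hasFDerivAt.comp_hasDerivAt t (hd ε p t)
  refine h1.congr_deriv ?_
  simp [C, hB, hsnd, add_comm]

/-- The point `(x, y, z)` that has the scaled coordinates `(x / ε, y, z)`. -/
def unscale (ε : ℝ) (p : Space3) : Space3 := ![ε * p 0, p 1, p 2]

/-- The scaled coordinates of the point of the switching manifold with `x = ε ξ`, as a function
of `(ε, (ξ, y))`. -/
def sigmaPoint (c d : ℝ) (e : ℝ × (ℝ × ℝ)) : Space3 :=
  ![e.2.1, e.2.2, d * (e.1 * e.2.1) ^ 2 + c * (e.1 * e.2.1) * e.2.2 + e.2.2 ^ 2]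

theorem switchingFunction_unscale_sigmaPoint (c d : ℝ) (e : ℝ × (ℝ × ℝ)) :
    switchingFunction c d (unscale e.1 (sigmaPoint c d e)) = 0 := by
  simp [switchingFunction, unscale, sigmaPoint]

theorem eq_sigmaPoint {c d ε : ℝ} {p : Space3} (h : switchingFunction c d (unscale ε p) = 0) :
    p = sigmaPoint c d (ε, (p 0, p 1)) := by
  ext i
  fin_cases i
  · simp [sigmaPoint]
  · simp [sigmaPoint]
  · simp [switchingFunction, unscale] at h
    simp [sigmaPoint]
    linarith

theorem contDiff_sigmaPoint (c d : ℝ) {n : WithTop ℕ∞} : ContDiff ℝ n (sigmaPoint c d) := by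
  rw [contDiff_pi]
  intro i
  fin_cases i
  · simp only [sigmaPoint, Fin.zero_eta, Matrix.cons_val_zero]; fun_prop
  · simp only [sigmaPoint, Fin.mk_one, Matrix.cons_val_one, Matrix.cons_val_zero]; fun_prop
  · simp only [sigmaPoint, Fin.reduceFinMk, Matrix.cons_val]; fun_prop

/-- The derivative of the switching function along the scaled field `X ε`. -/
noncomputable def scaledLie (c d : ℝ) (X : ℝ → Space3 → Space3) (ε : ℝ) (p : Space3) : ℝ :=
  fderiv ℝ (switchingFunction c d) (unscale ε p) (unscale ε (X ε p))

theorem hasDerivAt_unscale {ε : ℝ} {α : ℝ → Space3} {v : Space3} {t : ℝ} (h : HasDerivAt α v t) :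
    HasDerivAt (fun t => unscale ε (α t)) (unscale ε v) t := by
  rw [hasDerivAt_pi] at h ⊢
  intro i
  fin_cases i
  · exact (h 0).const_mul ε
  · exact h 1
  · exact h 2

/-- The trajectory of a point of the switching manifold runs on one side of it (given by the sign
`s`), and returns to it transversally after time `t`. -/
structure IsHalfTurn (c d s : ℝ) (X : ℝ → Space3 → Space3) (ψ : ℝ × Space3 × ℝ → Space3)
    (e : ℝ × (ℝ × ℝ)) (t : ℝ) : Prop where
  pos : 0 < t
  end_eq : switchingFunction c d (unscale e.1 (ψ (e.1, sigmaPoint c d e, t))) = 0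
  side : ∀ r ∈ Ioo 0 t, 0 < s * switchingFunction c d (unscale e.1 (ψ (e.1, sigmaPoint c d e, r)))
  lie_start : 0 < s * scaledLie c d X e.1 (sigmaPoint c d e)
  lie_end : s * scaledLie c d X e.1 (ψ (e.1, sigmaPoint c d e, t)) < 0

/-- The point at which a half turn ends. -/
def halfTurnEnd (c d : ℝ) (ψ : ℝ × Space3 × ℝ → Space3) (τ : ℝ × (ℝ × ℝ) → ℝ) (e : ℝ × (ℝ × ℝ)) :
    ℝ × (ℝ × ℝ) :=
  (e.1, (ψ (e.1, sigmaPoint c d e, τ e) 0, ψ (e.1, sigmaPoint c d e, τ e) 1))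

section HalfTurn

variable {c d s : ℝ} {X : ℝ → Space3 → Space3} {ψ : ℝ × Space3 × ℝ → Space3}

theorem IsHalfTurn.sigmaPoint_end {τ : ℝ × (ℝ × ℝ) → ℝ} {e : ℝ × (ℝ × ℝ)}
    (h : IsHalfTurn c d s X ψ e (τ e)) :
    sigmaPoint c d (halfTurnEnd c d ψ τ e) = ψ (e.1, sigmaPoint c d e, τ e) :=
  (eq_sigmaPoint h.end_eq).symm

theorem contDiffAt_halfTurnEnd (hψ : IsFlow X ψ) {τ : ℝ × (ℝ × ℝ) → ℝ} {e : ℝ × (ℝ × ℝ)}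
    (hτ : ContDiffAt ℝ 2 τ e) : ContDiffAt ℝ 2 (halfTurnEnd c d ψ τ) e := by
  have h1 : ContDiffAt ℝ 2 (fun e => ψ (e.1, sigmaPoint c d e, τ e)) e :=
    hψ.contDiff.contDiffAt.comp e
      (contDiffAt_fst.prodMk ((contDiff_sigmaPoint c d).contDiffAt.prodMk hτ))
  rw [contDiffAt_pi] at h1
  exact contDiffAt_fst.prodMk ((h1 0).prodMk (h1 1))

/-- If the trajectories of the points with `ε = 0` make half turns, then so do those nearby. -/
theorem exists_halfTurn (hψ : IsFlow X ψ) {q₀ : ℝ × ℝ} {T : ℝ × ℝ → ℝ}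
    (hT : ∀ᶠ q in 𝓝 q₀, IsHalfTurn c d s X ψ (0, q) (T q)) :
    ∃ τ : ℝ × (ℝ × ℝ) → ℝ, ContDiffAt ℝ 2 τ (0, q₀) ∧ (∀ᶠ q in 𝓝 q₀, τ (0, q) = T q) ∧
      ∀ᶠ e in 𝓝 (0, q₀), IsHalfTurn c d s X ψ e (τ e) := by
  let H : (ℝ × (ℝ × ℝ)) × ℝ → ℝ := fun a =>
    s * switchingFunction c d (unscale a.1.1 (ψ (a.1.1, sigmaPoint c d a.1, a.2)))
  have hH : ContDiff ℝ 2 H := by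
    have h1 : ContDiff ℝ 2 fun a : (ℝ × (ℝ × ℝ)) × ℝ => ψ (a.1.1, sigmaPoint c d a.1, a.2) := by
      refine hψ.contDiff.comp ?_
      have := (contDiff_sigmaPoint c d (n := 2)).comp
        (contDiff_fst : ContDiff ℝ 2 (Prod.fst : (ℝ × (ℝ × ℝ)) × ℝ → _))
      exact (contDiff_fst.comp contDiff_fst).prodMk (this.prodMk contDiff_snd)
    rw [contDiff_pi] at h1
    have h10 := h1 0
    have h11 := h1 1
    have h12 := h1 2
    have key : ∀ f₀ f₁ f₂ : (ℝ × (ℝ × ℝ)) × ℝ → ℝ, ContDiff ℝ 2 f₀ → ContDiff ℝ 2 f₁ →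
        ContDiff ℝ 2 f₂ → ContDiff ℝ 2 fun a => s * (-d * (a.1.1 * f₀ a) ^ 2 -
          c * (a.1.1 * f₀ a) * f₁ a - f₁ a ^ 2 + f₂ a) := by
      intro f₀ f₁ f₂ h₀ h₁ h₂
      fun_prop
    exact key _ _ _ h10 h11 h12
  have hd : ∀ e t, HasDerivAt (fun t => H (e, t))
      (s * scaledLie c d X e.1 (ψ (e.1, sigmaPoint c d e, t))) t := by
    intro e t
    have h1 := hasDerivAt_unscale (ε := e.1) (hψ.hasDerivAt e.1 (sigmaPoint c d e) t)
    exact ((differentiable_switchingFunction c d _).hasFDerivAt.comp_hasDerivAt t h1).const_mul s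
  have hH'eq : ∀ a : (ℝ × (ℝ × ℝ)) × ℝ,
      s * scaledLie c d X a.1.1 (ψ (a.1.1, sigmaPoint c d a.1, a.2)) = fderiv ℝ H a (0, 1) := by
    rintro ⟨e, t⟩
    have h1 : HasFDerivAt H (fderiv ℝ H (e, t)) (e, t) :=
      (hH.differentiable (by norm_num) _).hasFDerivAt
    have h2 : HasDerivAt (fun t : ℝ => (e, t)) (0, 1) t :=
      (hasDerivAt_const t e).prodMk (hasDerivAt_id t)
    exact (hd e t).unique (h1.comp_hasDerivAt t h2)
  have hH'c : Continuous fun a : (ℝ × (ℝ × ℝ)) × ℝ =>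
      s * scaledLie c d X a.1.1 (ψ (a.1.1, sigmaPoint c d a.1, a.2)) := by
    simp only [hH'eq]
    exact (hH.continuous_fderiv (by norm_num)).clm_apply continuous_const
  have hT0 := hT.self_of_nhds
  obtain ⟨τ, -, hτc, hτ⟩ := exists_hitting_time (n := 2) (by norm_num) hH hH'c hd
    (fun e => by simp only [H, hψ.zero, switchingFunction_unscale_sigmaPoint, mul_zero])
    (q₀ := ((0 : ℝ), q₀)) (t₀ := T q₀) hT0.pos (by simp only [H, hT0.end_eq, mul_zero])
    (by simpa only [hψ.zero] using hT0.lie_start) hT0.lie_end hT0.side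
  have hs : s ≠ 0 := by
    rintro rfl
    simpa using hT0.lie_start
  refine ⟨τ, hτc, ?_, ?_⟩
  -- Both `τ (0, q)` and `T q` are first positive zeros of the same function, so neither can precede
  -- the other.
  · have h1 : Tendsto (fun q : ℝ × ℝ => ((0 : ℝ), q)) (𝓝 q₀) (𝓝 (0, q₀)) := by
      have : Continuous fun q : ℝ × ℝ => ((0 : ℝ), q) := by fun_prop
      exact this.tendsto q₀
    filter_upwards [hT, h1.eventually hτ] with q h2 h3
    rcases lt_trichotomy (τ (0, q)) (T q) with h | h | h
    · have h4 := h2.side _ ⟨h3.1, h⟩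
      have h5 := h3.2.1
      simp only [H] at h5
      rw [h5] at h4
      exact absurd h4 (lt_irrefl _)
    · exact h
    · have h4 := h3.2.2.1 _ ⟨h2.pos, h⟩
      simp only [H] at h4
      rw [h2.end_eq, mul_zero] at h4
      exact absurd h4 (lt_irrefl _)
  · filter_upwards [hτ] with e he
    refine ⟨he.1, (mul_eq_zero.1 he.2.1).resolve_left hs, he.2.2.1, ?_, he.2.2.2.2⟩
    simpa only [hψ.zero] using he.2.2.2.1

end HalfTurn

/-! ### The eight-parameter family of perturbations -/

section Family

/-- The field `X⁺ + ε X₁⁺` in scaled coordinates. -/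
def scaledPlus (v : Fin 8 → ℝ) (ε : ℝ) (p : Space3) : Space3 :=
  ![p 0 - (v 0 + v 1) + (v 2 - v 1) * p 1 - (v 2 + v 1) * p 2,
    -p 2 - 1 + ε * (v 5 * p 1),
    p 1 + ε * (p 0 - (v 0 + v 1 * p 1 + v 2 * p 2) + v 3 + v 4 * (p 2 + 1))]

/-- The field `X⁻ + ε X₁⁻` in scaled coordinates. -/
def scaledMinus (v : Fin 8 → ℝ) (ε : ℝ) (p : Space3) : Space3 :=
  ![p 0, -p 2 + 1 + ε * (v 7 * p 1), p 1 + ε * (p 0 + v 6)]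

/-- The perturbed system that depends on eight parameters. -/
def familySystem (c d : ℝ) (v : Fin 8 → ℝ) (ε : ℝ) : PiecewiseSystem :=
  perturbedSystem c d ![-(v 0 + v 1), 0, -v 0 + v 3 + v 4] ![0, 0, v 6]
    !![0, v 2 - v 1, -(v 2 + v 1); 0, v 5, 0; 0, -v 1, -v 2 + v 4] !![0, 0, 0; 0, v 7, 0; 0, 0, 0] ε

theorem familySystem_Xp_unscale (c d : ℝ) (v : Fin 8 → ℝ) (ε : ℝ) (p : Space3) :
    (familySystem c d v ε).Xp (unscale ε p) = unscale ε (scaledPlus v ε p) := by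
  ext i
  fin_cases i <;>
  · simp [familySystem, perturbedSystem, baseField, unscale, scaledPlus, Matrix.vecHead,
      Matrix.vecTail]
    try ring

theorem familySystem_Xm_unscale (c d : ℝ) (v : Fin 8 → ℝ) (ε : ℝ) (p : Space3) :
    (familySystem c d v ε).Xm (unscale ε p) = unscale ε (scaledMinus v ε p) := by
  ext i
  fin_cases i
  · simp [familySystem, perturbedSystem, baseField, unscale, scaledMinus, Matrix.vecHead,
      Matrix.vecTail]
  · simp [familySystem, perturbedSystem, baseField, unscale, scaledMinus, Matrix.vecHead,
      Matrix.vecTail]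
  · simp [familySystem, perturbedSystem, baseField, unscale, scaledMinus, Matrix.vecHead,
      Matrix.vecTail]
    ring

theorem exists_lipschitzWith_Xp (c d : ℝ) (v : Fin 8 → ℝ) (ε : ℝ) :
    ∃ K, LipschitzWith K (familySystem c d v ε).Xp := by
  refine lipschitzWith_of_affine
    (v := ![0, -1, 0] + ε • ![-(v 0 + v 1), 0, -v 0 + v 3 + v 4])
    (A := Matrix.toLin' (!![1, 0, 0; 0, 0, -1; 1, 1, 0] +
      ε • !![0, v 2 - v 1, -(v 2 + v 1); 0, v 5, 0; 0, -v 1, -v 2 + v 4])) fun p => ?_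
  ext i
  fin_cases i <;>
  · simp [familySystem, perturbedSystem, baseField, Matrix.vecHead, Matrix.vecTail]
    ring

theorem exists_lipschitzWith_Xm (c d : ℝ) (v : Fin 8 → ℝ) (ε : ℝ) :
    ∃ K, LipschitzWith K (familySystem c d v ε).Xm := by
  refine lipschitzWith_of_affine (v := ![0, 1, 0] + ε • ![0, 0, v 6])
    (A := Matrix.toLin' (!![1, 0, 0; 0, 0, -1; 1, 1, 0] +
      ε • !![0, 0, 0; 0, v 7, 0; 0, 0, 0])) fun p => ?_
  ext i
  fin_cases i <;>
  · simp [familySystem, perturbedSystem, baseField, Matrix.vecHead, Matrix.vecTail]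
    try ring

theorem exists_flow_scaledPlus (v : Fin 8 → ℝ) : ∃ ψ, IsFlow (scaledPlus v) ψ := by
  obtain ⟨ψ, hψ⟩ := exists_flow_of_affine
    (Matrix.toLin' !![1, v 2 - v 1, -(v 2 + v 1); 0, 0, -1; 0, 1, 0]).toContinuousLinearMap
    (Matrix.toLin' !![0, 0, 0; 0, v 5, 0; 1, -v 1, -v 2 + v 4]).toContinuousLinearMap
    ![-(v 0 + v 1), -1, 0] ![0, 0, -v 0 + v 3 + v 4]
  refine ⟨ψ, hψ.contDiff, hψ.zero, fun ε p t => (hψ.hasDerivAt ε p t).congr_deriv ?_⟩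
  ext i
  fin_cases i <;>
  · simp [scaledPlus, Matrix.vecHead, Matrix.vecTail]
    first | done | ring1 | (left; ring1)

theorem exists_flow_scaledMinus (v : Fin 8 → ℝ) : ∃ ψ, IsFlow (scaledMinus v) ψ := by
  obtain ⟨ψ, hψ⟩ := exists_flow_of_affine
    (Matrix.toLin' !![1, 0, 0; 0, 0, -1; 0, 1, 0]).toContinuousLinearMap
    (Matrix.toLin' !![0, 0, 0; 0, v 7, 0; 1, 0, 0]).toContinuousLinearMap
    ![0, 1, 0] ![0, 0, v 6]
  refine ⟨ψ, hψ.contDiff, hψ.zero, fun ε p t => (hψ.hasDerivAt ε p t).congr_deriv ?_⟩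
  ext i
  fin_cases i <;>
  · simp [scaledMinus, Matrix.vecHead, Matrix.vecTail]
    first | done | ring1 | (left; ring1)

theorem exists_lipschitzWith_scaledPlus_zero (v : Fin 8 → ℝ) :
    ∃ K, LipschitzWith K (scaledPlus v 0) := by
  refine lipschitzWith_of_affine (v := ![-(v 0 + v 1), -1, 0])
    (A := Matrix.toLin' !![1, v 2 - v 1, -(v 2 + v 1); 0, 0, -1; 0, 1, 0]) fun p => ?_
  ext i
  fin_cases i <;>
  · simp [scaledPlus, Matrix.vecHead, Matrix.vecTail]
    try ring

theorem exists_lipschitzWith_scaledMinus_zero (v : Fin 8 → ℝ) :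
    ∃ K, LipschitzWith K (scaledMinus v 0) := by
  refine lipschitzWith_of_affine (v := ![0, 1, 0])
    (A := Matrix.toLin' !![1, 0, 0; 0, 0, -1; 0, 1, 0]) fun p => ?_
  ext i
  fin_cases i <;>
  · simp [scaledMinus, Matrix.vecHead, Matrix.vecTail]
    try ring

theorem IsFlow.eq_of_hasDerivAt {X : ℝ → Space3 → Space3} {ψ : ℝ × Space3 × ℝ → Space3}
    (hψ : IsFlow X ψ) {ε : ℝ} {K : NNReal} (hX : LipschitzWith K (X ε)) {α : ℝ → Space3}
    (hα : ∀ t, HasDerivAt α (X ε (α t)) t) {t : ℝ} (ht : 0 ≤ t) : ψ (ε, α 0, t) = α t := by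
  have hc : ∀ {f : ℝ → Space3} {f' : ℝ → Space3}, (∀ t, HasDerivAt f (f' t) t) → Continuous f :=
    fun h => continuous_iff_continuousAt.2 fun t => (h t).continuousAt
  exact eqOn_Icc_of_hasDerivAt_Ioo (a := 0) (b := t) hX (f := fun t => ψ (ε, α 0, t))
    (hc (hψ.hasDerivAt ε (α 0))).continuousOn (hc hα).continuousOn (hψ.zero _ _)
    (fun s _ => hψ.hasDerivAt _ _ _) (fun s _ => hα s) (right_mem_Icc.2 ht)

/-- The value of `δ₀ + δ₁ y + δ₂ z` at the point `(0, y, y²)`. -/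
def ellAt (v : Fin 8 → ℝ) (y : ℝ) : ℝ := v 0 + v 1 * y + v 2 * y ^ 2

/-- At `ε = 0` the equations for `(y, z)` do not contain `ξ`, and the coefficients of `scaledPlus`
are chosen such that the plane `ξ = v 0 + v 1 y + v 2 z` is invariant. The deviation from it grows
like `exp t`. -/
theorem flowPlus_zero {v : Fin 8 → ℝ} {ψ : ℝ × Space3 × ℝ → Space3}
    (hψ : IsFlow (scaledPlus v) ψ) (c d ξ y : ℝ) {t : ℝ} (ht : 0 ≤ t) :
    ψ (0, sigmaPoint c d (0, (ξ, y)), t) =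
      ![v 0 + v 1 * circlePlus y t 1 + v 2 * circlePlus y t 2 + (ξ - ellAt v y) * Real.exp t,
        circlePlus y t 1, circlePlus y t 2] := by
  obtain ⟨K, hK⟩ := exists_lipschitzWith_scaledPlus_zero v
  let α : ℝ → Space3 := fun t =>
    ![v 0 + v 1 * circlePlus y t 1 + v 2 * circlePlus y t 2 + (ξ - ellAt v y) * Real.exp t,
        circlePlus y t 1, circlePlus y t 2]
  have h0 : α 0 = sigmaPoint c d (0, (ξ, y)) := by
    simp only [α, circlePlus_zero]
    ext i
    fin_cases i <;> simp [sigmaPoint, ellAt]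
  rw [← h0]
  refine hψ.eq_of_hasDerivAt hK (α := α) (fun t => ?_) ht
  have hc := hasDerivAt_pi.1 (hasDerivAt_circlePlus y t)
  rw [hasDerivAt_pi]
  intro i
  fin_cases i
  · refine ((((hc 1).const_mul (v 1)).const_add (v 0)).add ((hc 2).const_mul (v 2))).add
      ((Real.hasDerivAt_exp t).const_mul (ξ - ellAt v y)) |>.congr_deriv ?_
    simp [α, scaledPlus, baseField, circlePlus]
    ring
  · refine (hc 1).congr_deriv ?_
    simp [α, scaledPlus, baseField]
  · refine (hc 2).congr_deriv ?_
    simp [α, scaledPlus, baseField, circlePlus]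

/-- On the `-` side the invariant plane is `ξ = 0`. -/
theorem flowMinus_zero {v : Fin 8 → ℝ} {ψ : ℝ × Space3 × ℝ → Space3}
    (hψ : IsFlow (scaledMinus v) ψ) (c d ξ y : ℝ) {t : ℝ} (ht : 0 ≤ t) :
    ψ (0, sigmaPoint c d (0, (ξ, -y)), t) =
      ![ξ * Real.exp t, circleMinus y t 1, circleMinus y t 2] := by
  obtain ⟨K, hK⟩ := exists_lipschitzWith_scaledMinus_zero v
  let α : ℝ → Space3 := fun t => ![ξ * Real.exp t, circleMinus y t 1, circleMinus y t 2]
  have h0 : α 0 = sigmaPoint c d (0, (ξ, -y)) := by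
    simp only [α, circleMinus_zero]
    ext i
    fin_cases i <;> simp [sigmaPoint]
  rw [← h0]
  refine hψ.eq_of_hasDerivAt hK (α := α) (fun t => ?_) ht
  have hc := hasDerivAt_pi.1 (hasDerivAt_circleMinus y t)
  rw [hasDerivAt_pi]
  intro i
  fin_cases i
  · refine ((Real.hasDerivAt_exp t).const_mul ξ).congr_deriv ?_
    simp [α, scaledMinus]
  · refine (hc 1).congr_deriv ?_
    simp [α, scaledMinus, baseField]
  · refine (hc 2).congr_deriv ?_
    simp [α, scaledMinus, baseField, circleMinus]

theorem unscale_zero_circlePlus (y t r : ℝ) :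
    unscale 0 ![r, circlePlus y t 1, circlePlus y t 2] = circlePlus y t := by
  ext i; fin_cases i <;> simp [unscale, circlePlus]

theorem unscale_zero_circleMinus (y t r : ℝ) :
    unscale 0 ![r, circleMinus y t 1, circleMinus y t 2] = circleMinus y t := by
  ext i; fin_cases i <;> simp [unscale, circleMinus]

theorem scaledLie_plus_zero (c d : ℝ) (v : Fin 8 → ℝ) (p : Space3) :
    scaledLie c d (scaledPlus v) 0 p = p 1 * (2 * p 2 + 3) := by
  rw [scaledLie, fderiv_switchingFunction]
  simp [unscale, scaledPlus]; ring

theorem scaledLie_minus_zero (c d : ℝ) (v : Fin 8 → ℝ) (p : Space3) :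
    scaledLie c d (scaledMinus v) 0 p = p 1 * (2 * p 2 - 1) := by
  rw [scaledLie, fderiv_switchingFunction]
  simp [unscale, scaledMinus]; ring

theorem isHalfTurn_plus_zero {v : Fin 8 → ℝ} {ψ : ℝ × Space3 × ℝ → Space3}
    (hψ : IsFlow (scaledPlus v) ψ) (c d ξ : ℝ) {y : ℝ} (hy : 1 < y) :
    IsHalfTurn c d 1 (scaledPlus v) ψ (0, (ξ, y)) (2 * halfTimePlus y) := by
  have hpos := halfTimePlus_pos (y := y) (by linarith)
  have hend : ψ (0, sigmaPoint c d (0, (ξ, y)), 2 * halfTimePlus y) = _ :=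
    flowPlus_zero hψ c d ξ y (by linarith)
  refine ⟨by linarith, ?_, fun r hr => ?_, ?_, ?_⟩
  · simp only
    rw [hend, unscale_zero_circlePlus, circlePlus_end, switchingFunction_of_zero]; ring
  · simp only
    rw [flowPlus_zero hψ c d ξ y hr.1.le, unscale_zero_circlePlus, one_mul]
    exact switchingFunction_circlePlus_pos c d hr
  · simp only
    rw [scaledLie_plus_zero, one_mul]
    simp [sigmaPoint]
    positivity
  · simp only
    rw [hend, scaledLie_plus_zero, one_mul, circlePlus_end]
    simp
    positivity

theorem isHalfTurn_minus_zero {v : Fin 8 → ℝ} {ψ : ℝ × Space3 × ℝ → Space3}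
    (hψ : IsFlow (scaledMinus v) ψ) (c d ξ : ℝ) {y : ℝ} (hy : 1 < y) :
    IsHalfTurn c d (-1) (scaledMinus v) ψ (0, (ξ, -y)) (2 * halfTimeMinus y) := by
  have hpos := halfTimeMinus_pos y
  have hend : ψ (0, sigmaPoint c d (0, (ξ, -y)), 2 * halfTimeMinus y) = _ :=
    flowMinus_zero hψ c d ξ y (by linarith)
  refine ⟨by linarith, ?_, fun r hr => ?_, ?_, ?_⟩
  · simp only
    rw [hend, unscale_zero_circleMinus, circleMinus_end (by linarith), switchingFunction_of_zero]
    ring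
  · simp only
    rw [flowMinus_zero hψ c d ξ y hr.1.le, unscale_zero_circleMinus]
    linarith [switchingFunction_circleMinus_neg c d hy hr]
  · simp only
    rw [scaledLie_minus_zero]
    simp [sigmaPoint]
    nlinarith
  · simp only
    rw [hend, scaledLie_minus_zero, circleMinus_end (by linarith)]
    simp
    nlinarith

end Family

/-! ### The Melnikov function as the first-order displacement -/

/-- The scaled first coordinate of the fixed point of the return map for `ε = 0`. -/
noncomputable def fixedXi (v : Fin 8 → ℝ) (y : ℝ) : ℝ :=
  Real.exp (2 * halfTimeMinus y) * (ellAt v (-y) - ellAt v y * Real.exp (2 * halfTimePlus y)) /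
    (1 - Real.exp (2 * halfTimePlus y) * Real.exp (2 * halfTimeMinus y))

/-- The scaled first coordinate after the `+` half turn of that fixed point. -/
noncomputable def leftXi (v : Fin 8 → ℝ) (y : ℝ) : ℝ :=
  ellAt v (-y) + (fixedXi v y - ellAt v y) * Real.exp (2 * halfTimePlus y)

/-- The first-order change of `y² + (z + 1)²` along the `+` half turn. -/
noncomputable def energyPlus (v : Fin 8 → ℝ) (y : ℝ) : ℝ :=
  2 * (v 5 * (radSqPlus y * halfTimePlus y - (y ^ 2 + 1) * y) +
    (fixedXi v y - ellAt v y) *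
      (Real.exp (2 * halfTimePlus y) * (y ^ 2 + 1 + y) - (y ^ 2 + 1 - y)) / 2 +
    2 * v 3 * y + v 4 * (radSqPlus y * halfTimePlus y + (y ^ 2 + 1) * y))

/-- The first-order change of `y² + (z - 1)²` along the `-` half turn. -/
noncomputable def energyMinus (v : Fin 8 → ℝ) (y : ℝ) : ℝ :=
  2 * (v 7 * (radSqMinus y * halfTimeMinus y + (y ^ 2 - 1) * y) +
    leftXi v y * (Real.exp (2 * halfTimeMinus y) * (y ^ 2 - 1 - y) - (y ^ 2 - 1 + y)) / 2 -
    2 * v 6 * y)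

/-- The first-order displacement of the return map. -/
noncomputable def melnikov (c : ℝ) (v : Fin 8 → ℝ) (y : ℝ) : ℝ :=
  ((2 * y ^ 2 - 1) * energyPlus v y + (2 * y ^ 2 + 3) * energyMinus v y +
    4 * c * y * (fixedXi v y + leftXi v y)) / (2 * y * (2 * y ^ 2 - 1) * (2 * y ^ 2 + 3))

theorem one_lt_exp_mul_exp {y : ℝ} (hy : 0 < y) :
    1 < Real.exp (2 * halfTimePlus y) * Real.exp (2 * halfTimeMinus y) := by
  rw [← Real.exp_add, Real.one_lt_exp_iff]
  linarith [halfTimePlus_pos hy, halfTimeMinus_pos y]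

/-- The `-` half turn multiplies `ξ` by `exp (2 b)`, so this is the fixed point equation from which
`fixedXi` is solved. -/
theorem leftXi_mul_exp (v : Fin 8 → ℝ) {y : ℝ} (hy : 0 < y) :
    leftXi v y * Real.exp (2 * halfTimeMinus y) = fixedXi v y := by
  have h := one_lt_exp_mul_exp hy
  have h' : 1 - Real.exp (2 * halfTimePlus y) * Real.exp (2 * halfTimeMinus y) ≠ 0 := by linarith
  have key : fixedXi v y * (1 - Real.exp (2 * halfTimePlus y) * Real.exp (2 * halfTimeMinus y)) =
      Real.exp (2 * halfTimeMinus y) *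
        (ellAt v (-y) - ellAt v y * Real.exp (2 * halfTimePlus y)) := div_mul_cancel₀ _ h'
  unfold leftXi
  linear_combination -key

/-- The difference quotient at `0` is `J` itself, so continuity suffices. It spares differentiating
the energy integrals in `ε`. -/
theorem hasDerivAt_mul_self_of_continuousAt {J : ℝ → ℝ} (hJ : ContinuousAt J 0) :
    HasDerivAt (fun ε => ε * J ε) (J 0) 0 := by
  rw [hasDerivAt_iff_tendsto_slope]
  refine (hJ.tendsto.mono_left nhdsWithin_le_nhds).congr' ?_
  filter_upwards [self_mem_nhdsWithin] with ε hε
  have : ε ≠ 0 := hε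
  rw [slope_def_field]
  field_simp
  ring

section Energy

variable {v : Fin 8 → ℝ} {ψ : ℝ × Space3 × ℝ → Space3}

/-- `ε` times this is the derivative of `y² + (z + 1)²` along the scaled `+` field. -/
def energyRatePlus (v : Fin 8 → ℝ) (p : Space3) : ℝ :=
  2 * (v 5 * p 1 ^ 2 +
    (p 2 + 1) * (p 0 - (v 0 + v 1 * p 1 + v 2 * p 2) + v 3 + v 4 * (p 2 + 1)))

/-- `ε` times this is the derivative of `y² + (z - 1)²` along the scaled `-` field. -/
def energyRateMinus (v : Fin 8 → ℝ) (p : Space3) : ℝ :=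
  2 * (v 7 * p 1 ^ 2 + (p 2 - 1) * (p 0 + v 6))

theorem continuous_energyRatePlus (v : Fin 8 → ℝ) : Continuous (energyRatePlus v) := by
  unfold energyRatePlus; fun_prop

theorem continuous_energyRateMinus (v : Fin 8 → ℝ) : Continuous (energyRateMinus v) := by
  unfold energyRateMinus; fun_prop

theorem energy_plus_sub (hψ : IsFlow (scaledPlus v) ψ) (ε : ℝ) (p : Space3) (t : ℝ) :
    ψ (ε, p, t) 1 ^ 2 + (ψ (ε, p, t) 2 + 1) ^ 2 - (p 1 ^ 2 + (p 2 + 1) ^ 2) =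
      ε * ∫ s in (0 : ℝ)..t, energyRatePlus v (ψ (ε, p, s)) := by
  have hc : Continuous fun s => ψ (ε, p, s) := hψ.contDiff.continuous.comp (by fun_prop)
  have hd : ∀ s ∈ uIcc 0 t, HasDerivAt (fun s => ψ (ε, p, s) 1 ^ 2 + (ψ (ε, p, s) 2 + 1) ^ 2)
      (ε * energyRatePlus v (ψ (ε, p, s))) s := by
    intro s _
    have h := hasDerivAt_pi.1 (hψ.hasDerivAt ε p s)
    refine (((h 1).pow 2).add (((h 2).add_const 1).pow 2)).congr_deriv ?_
    simp [scaledPlus, energyRatePlus]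
    ring
  rw [← intervalIntegral.integral_const_mul, intervalIntegral.integral_eq_sub_of_hasDerivAt hd, hψ.zero]
  exact (continuous_const.mul ((continuous_energyRatePlus v).comp hc)).intervalIntegrable _ _

theorem energy_minus_sub (hψ : IsFlow (scaledMinus v) ψ) (ε : ℝ) (p : Space3) (t : ℝ) :
    ψ (ε, p, t) 1 ^ 2 + (ψ (ε, p, t) 2 - 1) ^ 2 - (p 1 ^ 2 + (p 2 - 1) ^ 2) =
      ε * ∫ s in (0 : ℝ)..t, energyRateMinus v (ψ (ε, p, s)) := by
  have hc : Continuous fun s => ψ (ε, p, s) := hψ.contDiff.continuous.comp (by fun_prop)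
  have hd : ∀ s ∈ uIcc 0 t, HasDerivAt (fun s => ψ (ε, p, s) 1 ^ 2 + (ψ (ε, p, s) 2 - 1) ^ 2)
      (ε * energyRateMinus v (ψ (ε, p, s))) s := by
    intro s _
    have h := hasDerivAt_pi.1 (hψ.hasDerivAt ε p s)
    refine (((h 1).pow 2).add (((h 2).sub_const 1).pow 2)).congr_deriv ?_
    simp [scaledMinus, energyRateMinus]
    ring
  rw [← intervalIntegral.integral_const_mul, intervalIntegral.integral_eq_sub_of_hasDerivAt hd, hψ.zero]
  exact (continuous_const.mul ((continuous_energyRateMinus v).comp hc)).intervalIntegrable _ _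

theorem continuous_integral_flow (hψ : Continuous ψ) {k : Space3 → ℝ} (hk : Continuous k)
    (c d : ℝ) : Continuous fun a : (ℝ × (ℝ × ℝ)) × ℝ =>
      ∫ s in (0 : ℝ)..a.2, k (ψ (a.1.1, sigmaPoint c d a.1, s)) := by
  refine intervalIntegral.continuous_parametric_intervalIntegral_of_continuous
    (f := fun (a : (ℝ × (ℝ × ℝ)) × ℝ) s => k (ψ (a.1.1, sigmaPoint c d a.1, s))) ?_ continuous_snd
  have h : Continuous fun b : ((ℝ × (ℝ × ℝ)) × ℝ) × ℝ => sigmaPoint c d b.1.1 :=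
    (contDiff_sigmaPoint c d (n := 0)).continuous.comp (by fun_prop)
  exact hk.comp (hψ.comp ((by fun_prop : Continuous fun b : ((ℝ × (ℝ × ℝ)) × ℝ) × ℝ =>
    b.1.1.1).prodMk (h.prodMk continuous_snd)))

theorem integral_energyRatePlus (hψ : IsFlow (scaledPlus v) ψ) (c d : ℝ) {y : ℝ} (hy : 0 < y) :
    ∫ s in (0 : ℝ)..(2 * halfTimePlus y),
      energyRatePlus v (ψ (0, sigmaPoint c d (0, (fixedXi v y, y)), s)) = energyPlus v y := by
  have hpos := halfTimePlus_pos hy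
  set K := fixedXi v y - ellAt v y with hK
  -- An explicit antiderivative along the circle. With `q = z + 1` one has `y' = -q` and `q' = y`,
  -- so `y q` has derivative `y² - q²` and `exp s (q - y)` has derivative `2 q exp s`; the constancy
  -- of `y² + q²` does the rest.
  let A : ℝ → ℝ := fun s =>
    v 5 * (radSqPlus y * s + circlePlus y s 1 * (circlePlus y s 2 + 1)) +
    K * (Real.exp s * (circlePlus y s 2 + 1 - circlePlus y s 1)) - 2 * v 3 * circlePlus y s 1 +
    v 4 * (radSqPlus y * s - circlePlus y s 1 * (circlePlus y s 2 + 1))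
  have hr : ∀ s, circlePlus y s 1 ^ 2 + (circlePlus y s 2 + 1) ^ 2 = radSqPlus y := by
    intro s
    have := Real.sin_sq_add_cos_sq s
    simp [circlePlus, radSqPlus]
    linear_combination (y ^ 2 + (y ^ 2 + 1) ^ 2) * this
  have hA : ∀ s, HasDerivAt A (2 * (v 5 * circlePlus y s 1 ^ 2 +
      (circlePlus y s 2 + 1) * (K * Real.exp s + v 3 + v 4 * (circlePlus y s 2 + 1)))) s := by
    intro s
    have hc := hasDerivAt_pi.1 (hasDerivAt_circlePlus y s)
    have hq := (hc 2).add_const 1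
    have hid := (hasDerivAt_id s).const_mul (radSqPlus y)
    have h1 := (hid.add ((hc 1).mul hq)).const_mul (v 5)
    have h2 := (((Real.hasDerivAt_exp s).mul (hq.sub (hc 1)))).const_mul K
    have h3 := (hc 1).const_mul (2 * v 3)
    have h4 := (hid.sub ((hc 1).mul hq)).const_mul (v 4)
    refine (((h1.add h2).sub h3).add h4).congr_deriv ?_
    have h0 : circlePlus y s 0 = 0 := by simp [circlePlus]
    simp only [baseField, Matrix.cons_val, h0, ← hr s, Pi.sub_apply]
    ring
  have hcong : ∀ s ∈ uIcc 0 (2 * halfTimePlus y),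
      energyRatePlus v (ψ (0, sigmaPoint c d (0, (fixedXi v y, y)), s)) =
      2 * (v 5 * circlePlus y s 1 ^ 2 +
        (circlePlus y s 2 + 1) * (K * Real.exp s + v 3 + v 4 * (circlePlus y s 2 + 1))) := by
    intro s hs
    rw [uIcc_of_le (by linarith)] at hs
    rw [flowPlus_zero hψ c d _ y hs.1]
    simp [energyRatePlus]
    left; ring
  rw [intervalIntegral.integral_congr hcong,
    intervalIntegral.integral_eq_sub_of_hasDerivAt (fun s _ => hA s)]
  · simp only [A, circlePlus_end, circlePlus_zero, Matrix.cons_val, energyPlus, ← hK, Real.exp_zero]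
    ring
  · refine Continuous.intervalIntegrable ?_ _ _
    have h1 : Continuous fun s => circlePlus y s 1 := by simp [circlePlus]; fun_prop
    have h2 : Continuous fun s => circlePlus y s 2 := by simp [circlePlus]; fun_prop
    fun_prop

theorem integral_energyRateMinus (hψ : IsFlow (scaledMinus v) ψ) (c d : ℝ) {y : ℝ} (hy : 0 < y) :
    ∫ s in (0 : ℝ)..(2 * halfTimeMinus y),
      energyRateMinus v (ψ (0, sigmaPoint c d (0, (leftXi v y, -y)), s)) = energyMinus v y := by
  have hpos := halfTimeMinus_pos y
  set K := leftXi v y with hK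
  let A : ℝ → ℝ := fun s =>
    v 7 * (radSqMinus y * s + circleMinus y s 1 * (circleMinus y s 2 - 1)) +
    K * (Real.exp s * (circleMinus y s 2 - 1 - circleMinus y s 1)) - 2 * v 6 * circleMinus y s 1
  have hr : ∀ s, circleMinus y s 1 ^ 2 + (circleMinus y s 2 - 1) ^ 2 = radSqMinus y := by
    intro s
    have := Real.sin_sq_add_cos_sq s
    simp [circleMinus, radSqMinus]
    linear_combination (y ^ 2 + (y ^ 2 - 1) ^ 2) * this
  have hA : ∀ s, HasDerivAt A (2 * (v 7 * circleMinus y s 1 ^ 2 +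
      (circleMinus y s 2 - 1) * (K * Real.exp s + v 6))) s := by
    intro s
    have hc := hasDerivAt_pi.1 (hasDerivAt_circleMinus y s)
    have hq := (hc 2).sub_const 1
    have hid := (hasDerivAt_id s).const_mul (radSqMinus y)
    have h1 := (hid.add ((hc 1).mul hq)).const_mul (v 7)
    have h2 := (((Real.hasDerivAt_exp s).mul (hq.sub (hc 1)))).const_mul K
    have h3 := (hc 1).const_mul (2 * v 6)
    refine ((h1.add h2).sub h3).congr_deriv ?_
    have h0 : circleMinus y s 0 = 0 := by simp [circleMinus]
    simp only [baseField, Matrix.cons_val, h0, ← hr s, Pi.sub_apply]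
    ring
  have hcong : ∀ s ∈ uIcc 0 (2 * halfTimeMinus y),
      energyRateMinus v (ψ (0, sigmaPoint c d (0, (leftXi v y, -y)), s)) =
      2 * (v 7 * circleMinus y s 1 ^ 2 + (circleMinus y s 2 - 1) * (K * Real.exp s + v 6)) := by
    intro s hs
    rw [uIcc_of_le (by linarith)] at hs
    rw [flowMinus_zero hψ c d _ y hs.1]
    simp [energyRateMinus, hK]
  rw [intervalIntegral.integral_congr hcong,
    intervalIntegral.integral_eq_sub_of_hasDerivAt (fun s _ => hA s)]
  · simp only [A, circleMinus_end hy, circleMinus_zero, Matrix.cons_val, energyMinus, ← hK,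
      Real.exp_zero]
    ring
  · refine Continuous.intervalIntegrable ?_ _ _
    have h1 : Continuous fun s => circleMinus y s 1 := by simp [circleMinus]; fun_prop
    have h2 : Continuous fun s => circleMinus y s 2 := by simp [circleMinus]; fun_prop
    fun_prop

end Energy

/-- The value of `y² + (z + k)²` at a point of the switching manifold. -/
def sigmaLevel (c d k : ℝ) (e : ℝ × (ℝ × ℝ)) : ℝ :=
  sigmaPoint c d e 1 ^ 2 + (sigmaPoint c d e 2 + k) ^ 2

/-- With `x = ε f` the term `d x²` is of second order, so `d` does not enter the Melnikov function;
the term `c x y` contributes `c f(0) g(0)`. -/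
theorem hasDerivAt_sigmaLevel (c d k : ℝ) {f g : ℝ → ℝ} {f' g' : ℝ} (hf : HasDerivAt f f' 0)
    (hg : HasDerivAt g g' 0) :
    HasDerivAt (fun ε => sigmaLevel c d k (ε, (f ε, g ε)))
      (2 * g 0 * g' + 2 * (g 0 ^ 2 + k) * (2 * g 0 * g' + c * f 0 * g 0)) 0 := by
  have hx := (hasDerivAt_id (0 : ℝ)).mul hf
  have h1 := hg.pow 2
  have h2 := (((hx.pow 2).const_mul d).add ((hx.const_mul c).mul hg)).add (hg.pow 2)
  refine (h1.add ((h2.add_const k).pow 2)).congr_deriv ?_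
  simp
  first | ring1 | (left; ring1)

theorem HasDerivAt.fst_snd_comp {E : ℝ × (ℝ × ℝ) → ℝ × (ℝ × ℝ)} {q : ℝ × ℝ}
    (hE : DifferentiableAt ℝ E (0, q)) :
    (∃ f', HasDerivAt (fun ε => (E (ε, q)).2.1) f' 0) ∧
      ∃ g', HasDerivAt (fun ε => (E (ε, q)).2.2) g' 0 := by
  have h1 : HasDerivAt (fun ε : ℝ => (ε, q)) (1, 0) 0 :=
    (hasDerivAt_id _).prodMk (hasDerivAt_const _ _)
  have h2 := hE.hasFDerivAt.comp_hasDerivAt (0 : ℝ) h1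
  have h3 := (ContinuousLinearMap.snd ℝ ℝ (ℝ × ℝ)).hasFDerivAt.comp_hasDerivAt (0 : ℝ) h2
  exact ⟨⟨_, (ContinuousLinearMap.fst ℝ ℝ ℝ).hasFDerivAt.comp_hasDerivAt (0 : ℝ) h3⟩,
    ⟨_, (ContinuousLinearMap.snd ℝ ℝ ℝ).hasFDerivAt.comp_hasDerivAt (0 : ℝ) h3⟩⟩

section ReturnMap

variable {c d : ℝ} {v : Fin 8 → ℝ} {ψ ψ' : ℝ × Space3 × ℝ → Space3} {τ τ' : ℝ × (ℝ × ℝ) → ℝ}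

theorem halfTurnEnd_plus_zero (hψ : IsFlow (scaledPlus v) ψ) {ξ y : ℝ} (hy : 0 < y)
    (hτ : τ (0, (ξ, y)) = 2 * halfTimePlus y) :
    halfTurnEnd c d ψ τ (0, (ξ, y)) =
      (0, (ellAt v (-y) + (ξ - ellAt v y) * Real.exp (2 * halfTimePlus y), -y)) := by
  have := halfTimePlus_pos hy
  rw [halfTurnEnd, hτ]
  simp only
  rw [flowPlus_zero hψ c d ξ y (by linarith), circlePlus_end]
  simp [ellAt]

theorem halfTurnEnd_minus_zero (hψ : IsFlow (scaledMinus v) ψ) {ξ y : ℝ} (hy : 0 < y)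
    (hτ : τ (0, (ξ, -y)) = 2 * halfTimeMinus y) :
    halfTurnEnd c d ψ τ (0, (ξ, -y)) = (0, (ξ * Real.exp (2 * halfTimeMinus y), y)) := by
  have := halfTimeMinus_pos y
  rw [halfTurnEnd, hτ]
  simp only
  rw [flowMinus_zero hψ c d ξ y (by linarith), circleMinus_end hy]
  simp

/-- The first-order displacement of the return map is the Melnikov function. -/
theorem hasDerivAt_returnMap (hψ : IsFlow (scaledPlus v) ψ) (hψ' : IsFlow (scaledMinus v) ψ')
    {y : ℝ} (hy : 1 < y) (hτ : ContDiffAt ℝ 2 τ (0, (fixedXi v y, y)))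
    (hτ0 : τ (0, (fixedXi v y, y)) = 2 * halfTimePlus y)
    (hτ' : ContDiffAt ℝ 2 τ' (0, (leftXi v y, -y)))
    (hτ'0 : τ' (0, (leftXi v y, -y)) = 2 * halfTimeMinus y)
    (hturn : ∀ᶠ e in 𝓝 (0, (fixedXi v y, y)), IsHalfTurn c d 1 (scaledPlus v) ψ e (τ e))
    (hturn' : ∀ᶠ e in 𝓝 (0, (leftXi v y, -y)), IsHalfTurn c d (-1) (scaledMinus v) ψ' e (τ' e)) :
    HasDerivAt (fun ε => (halfTurnEnd c d ψ' τ' (halfTurnEnd c d ψ τ (ε, (fixedXi v y, y)))).2.2)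
      (melnikov c v y) 0 := by
  have hy0 : 0 < y := by linarith
  set q : ℝ × ℝ := (fixedXi v y, y) with hq
  have hE0 : halfTurnEnd c d ψ τ (0, q) = (0, (leftXi v y, -y)) :=
    halfTurnEnd_plus_zero hψ hy0 hτ0
  have hF0 : halfTurnEnd c d ψ' τ' (0, (leftXi v y, -y)) = (0, (fixedXi v y, y)) := by
    rw [halfTurnEnd_minus_zero hψ' hy0 hτ'0, leftXi_mul_exp v hy0]
  have hEc := contDiffAt_halfTurnEnd (c := c) (d := d) hψ hτ
  have hFc : ContDiffAt ℝ 2 (halfTurnEnd c d ψ' τ') (halfTurnEnd c d ψ τ (0, q)) := by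
    rw [hE0]; exact contDiffAt_halfTurnEnd (c := c) (d := d) hψ' hτ'
  have hFEc := hFc.comp (0, q) hEc
  obtain ⟨⟨f₁', hf₁⟩, ⟨g₁', hg₁⟩⟩ := HasDerivAt.fst_snd_comp (hEc.differentiableAt (by norm_num))
  obtain ⟨⟨f₂', hf₂⟩, ⟨g₂', hg₂⟩⟩ := HasDerivAt.fst_snd_comp (hFEc.differentiableAt (by norm_num))
  simp only [Function.comp_apply] at hf₂ hg₂
  have hline : Tendsto (fun ε : ℝ => (ε, q)) (𝓝 0) (𝓝 (0, q)) := by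
    have : Continuous fun ε : ℝ => (ε, q) := by fun_prop
    exact this.tendsto 0
  have hEline : Tendsto (fun ε : ℝ => halfTurnEnd c d ψ τ (ε, q)) (𝓝 0) (𝓝 (0, (leftXi v y, -y))) := by
    rw [← hE0]; exact hEc.continuousAt.tendsto.comp hline
  -- the balance on the `+` side
  have hplus : 2 * (-y) * g₁' + 2 * ((-y) ^ 2 + 1) * (2 * (-y) * g₁' + c * leftXi v y * (-y)) -
      2 * (y ^ 2 + 1) * (c * fixedXi v y * y) = energyPlus v y := by
    have hs1 := hasDerivAt_sigmaLevel c d 1 hf₁ hg₁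
    have hs2 := hasDerivAt_sigmaLevel c d 1 (hasDerivAt_const (0 : ℝ) (fixedXi v y))
      (hasDerivAt_const (0 : ℝ) y)
    rw [hE0] at hs1
    have hJ := hasDerivAt_mul_self_of_continuousAt
      (J := fun ε => ∫ s in (0 : ℝ)..τ (ε, q), energyRatePlus v (ψ (ε, sigmaPoint c d (ε, q), s))) (by
        have h1 : ContinuousAt (fun ε : ℝ => ((ε, q), τ (ε, q))) 0 :=
          ContinuousAt.prodMk (by fun_prop)
            (ContinuousAt.comp (f := fun ε : ℝ => (ε, q)) hτ.continuousAt (by fun_prop))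
        exact ContinuousAt.comp (f := fun ε : ℝ => ((ε, q), τ (ε, q)))
          (continuous_integral_flow hψ.contDiff.continuous
            (continuous_energyRatePlus v) c d).continuousAt h1)
    simp only [hτ0] at hJ
    rw [hq, integral_energyRatePlus hψ c d hy0] at hJ
    have huniq := (hs1.sub hs2).unique (hJ.congr_of_eventuallyEq ?_)
    · rw [← huniq]; ring
    · filter_upwards [hline.eventually hturn] with ε hε
      rw [← energy_plus_sub hψ, ← hε.sigmaPoint_end]
      rfl
  have hminus : 2 * y * g₂' + 2 * (y ^ 2 - 1) * (2 * y * g₂' + c * fixedXi v y * y) -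
      (2 * (-y) * g₁' + 2 * ((-y) ^ 2 - 1) * (2 * (-y) * g₁' + c * leftXi v y * (-y))) =
        energyMinus v y := by
    have hs1 := hasDerivAt_sigmaLevel c d (-1) hf₁ hg₁
    have hs2 := hasDerivAt_sigmaLevel c d (-1) hf₂ hg₂
    rw [hE0] at hs1 hs2
    rw [hF0] at hs2
    have hJ := hasDerivAt_mul_self_of_continuousAt
      (J := fun ε => ∫ s in (0 : ℝ)..τ' (halfTurnEnd c d ψ τ (ε, q)), energyRateMinus v
        (ψ' (ε, sigmaPoint c d (halfTurnEnd c d ψ τ (ε, q)), s))) (by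
        have h0 : ContinuousAt (fun ε : ℝ => halfTurnEnd c d ψ τ (ε, q)) 0 :=
          ContinuousAt.comp (f := fun ε : ℝ => (ε, q)) hEc.continuousAt (by fun_prop)
        have h1 : ContinuousAt (fun ε : ℝ => (halfTurnEnd c d ψ τ (ε, q),
            τ' (halfTurnEnd c d ψ τ (ε, q)))) 0 :=
          ContinuousAt.prodMk h0
            (ContinuousAt.comp (g := τ') (f := fun ε : ℝ => halfTurnEnd c d ψ τ (ε, q))
              (by rw [hE0]; exact hτ'.continuousAt) h0)
        exact ContinuousAt.comp (f := fun ε : ℝ => (halfTurnEnd c d ψ τ (ε, q),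
            τ' (halfTurnEnd c d ψ τ (ε, q))))
          (continuous_integral_flow hψ'.contDiff.continuous
            (continuous_energyRateMinus v) c d).continuousAt h1)
    simp only [hE0, hτ'0] at hJ
    rw [integral_energyRateMinus hψ' c d hy0] at hJ
    have huniq := (hs2.sub hs1).unique (hJ.congr_of_eventuallyEq ?_)
    · rw [← huniq]; ring
    · filter_upwards [hEline.eventually hturn'] with ε hε
      have h2 := energy_minus_sub hψ' ε (sigmaPoint c d (halfTurnEnd c d ψ τ (ε, q)))
        (τ' (halfTurnEnd c d ψ τ (ε, q)))
      rw [← h2]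
      have h3 := hε.sigmaPoint_end
      have h4 : (halfTurnEnd c d ψ τ (ε, q)).1 = ε := rfl
      rw [h4] at h3
      rw [← h3]
      rfl
  -- The first-order displacement `g₁'` at the left crossing enters the balances with the factors
  -- `-2 y (2 y² + 3)` and `2 y (2 y² - 1)`. The weights in the numerator of `melnikov` eliminate
  -- it.
  have hval : g₂' = melnikov c v y := by
    have h1 : 2 * y ^ 2 - 1 ≠ 0 := by nlinarith
    have h2 : 2 * y ^ 2 + 3 ≠ 0 := by positivity
    rw [melnikov, eq_div_iff (by positivity)]
    rw [← hplus, ← hminus]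
    ring
  rw [← hval]
  exact hg₂

end ReturnMap

/-! ### From isolated fixed points of the return map to limit cycles -/

namespace PiecewiseSystem

variable {Z : PiecewiseSystem}

/-- A trajectory of the `+` field leads from `p` to `q` in time `t`, through `h > 0`. -/
def IsPlusArc (Z : PiecewiseSystem) (p q : Space3) (t : ℝ) : Prop :=
  0 < t ∧ ∃ α : ℝ → Space3, α 0 = p ∧ α t = q ∧ (∀ s, HasDerivAt α (Z.Xp (α s)) s) ∧
    ∀ s ∈ Ioo 0 t, 0 < Z.h (α s)

/-- A trajectory of the `-` field leads from `p` to `q` in time `t`, through `h < 0`. -/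
def IsMinusArc (Z : PiecewiseSystem) (p q : Space3) (t : ℝ) : Prop :=
  0 < t ∧ ∃ β : ℝ → Space3, β 0 = p ∧ β t = q ∧ (∀ s, HasDerivAt β (Z.Xm (β s)) s) ∧
    ∀ s ∈ Ioo 0 t, Z.h (β s) < 0

/-- Half return maps `F` (through `h > 0`) and `G` (through `h < 0`), defined on the parts of the
switching manifold in `B` and `C`. -/
structure IsReturnPair (Z : PiecewiseSystem) (B C : Set Space3) (F G : Space3 → Space3)
    (m : ℝ) : Prop where
  pos : 0 < m
  lie_B : ∀ p ∈ B, Z.h p = 0 → 0 < Z.liePlus p ∧ 0 < Z.lieMinus p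
  lie_C : ∀ p ∈ C, Z.h p = 0 → Z.liePlus p < 0 ∧ Z.lieMinus p < 0
  end_B : ∀ p ∈ B, Z.h p = 0 → Z.h (F p) = 0 ∧ Z.liePlus (F p) < 0
  end_C : ∀ p ∈ C, Z.h p = 0 → Z.h (G p) = 0 ∧ 0 < Z.lieMinus (G p)
  arc_B : ∀ p ∈ B, Z.h p = 0 → ∃ t, m ≤ t ∧ Z.IsPlusArc p (F p) t
  arc_C : ∀ p ∈ C, Z.h p = 0 → ∃ t, Z.IsMinusArc p (G p) t

section Return

variable {B C : Set Space3} {F G : Space3 → Space3} {m : ℝ} {K K' : NNReal} {γ : ℝ → Space3}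

/-- The sign of the Lie derivative at the end of the half turn excludes `C`, so the solution arrives
in `B` and the next half turn can begin. -/
theorem IsReturnPair.step_minus (H : Z.IsReturnPair B C F G m) (hh : Differentiable ℝ Z.h)
    (hX' : LipschitzWith K' Z.Xm) (hγ : Z.IsSolutionOn γ univ)
    (hmem : ∀ t, Z.h (γ t) = 0 → γ t ∈ B ∪ C) {t : ℝ} (ht : γ t ∈ C) (ht' : Z.h (γ t) = 0) :
    ∃ t' > t, γ t' ∈ B ∧ Z.h (γ t') = 0 ∧ γ t' = G (γ t) ∧ ∀ s ∈ Ioo t t', Z.h (γ s) < 0 := by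
  obtain ⟨τ, hτ, β, hβ0, hβ1, hβ, hβn⟩ := H.arc_C _ ht ht'
  have hl := H.lie_C _ ht ht'
  have hf := hγ.follow_minus hh hX' hβ hβ0 hβn ht' hl.1 hl.2
  have he : γ (t + τ) = G (γ t) := by rw [hf τ ⟨hτ.le, le_rfl⟩, hβ1]
  have hG := H.end_C _ ht ht'
  rw [← he] at hG
  refine ⟨t + τ, by linarith, ?_, hG.1, he, fun s hs => ?_⟩
  · rcases hmem _ hG.1 with h | h
    · exact h
    · linarith [(H.lie_C _ h hG.1).2, hG.2]
  · have := hf (s - t) ⟨by linarith [hs.1], by linarith [hs.2]⟩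
    rw [add_sub_cancel] at this
    rw [this]
    exact hβn _ ⟨by linarith [hs.1], by linarith [hs.2]⟩

theorem IsReturnPair.step_plus (H : Z.IsReturnPair B C F G m) (hh : Differentiable ℝ Z.h)
    (hX : LipschitzWith K Z.Xp) (hγ : Z.IsSolutionOn γ univ)
    (hmem : ∀ t, Z.h (γ t) = 0 → γ t ∈ B ∪ C) {t : ℝ} (ht : γ t ∈ B) (ht' : Z.h (γ t) = 0) :
    ∃ t', t + m ≤ t' ∧ γ t' ∈ C ∧ Z.h (γ t') = 0 ∧ γ t' = F (γ t) ∧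
      ∀ s ∈ Ioo t t', 0 < Z.h (γ s) := by
  obtain ⟨σ, hmσ, hσ, α, hα0, hα1, hα, hαp⟩ := H.arc_B _ ht ht'
  have hl := H.lie_B _ ht ht'
  have hf := hγ.follow_plus hh hX hα hα0 hαp ht' hl.1 hl.2
  have he : γ (t + σ) = F (γ t) := by rw [hf σ ⟨hσ.le, le_rfl⟩, hα1]
  have hF := H.end_B _ ht ht'
  rw [← he] at hF
  refine ⟨t + σ, by linarith, ?_, hF.1, he, fun s hs => ?_⟩
  · rcases hmem _ hF.1 with h | h
    · linarith [(H.lie_B _ h hF.1).1, hF.2]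
    · exact h
  · have := hf (s - t) ⟨by linarith [hs.1], by linarith [hs.2]⟩
    rw [add_sub_cancel] at this
    rw [this]
    exact hαp _ ⟨by linarith [hs.1], by linarith [hs.2]⟩

theorem IsReturnPair.step (H : Z.IsReturnPair B C F G m) (hh : Differentiable ℝ Z.h)
    (hX : LipschitzWith K Z.Xp) (hX' : LipschitzWith K' Z.Xm) (hγ : Z.IsSolutionOn γ univ)
    (hmem : ∀ t, Z.h (γ t) = 0 → γ t ∈ B ∪ C) {t : ℝ} (ht : γ t ∈ B ∧ Z.h (γ t) = 0) :
    ∃ t', t + m ≤ t' ∧ (γ t' ∈ B ∧ Z.h (γ t') = 0) ∧ γ t' = G (F (γ t)) ∧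
      ∀ s ∈ Ioo t t', ¬ (γ s ∈ B ∧ Z.h (γ s) = 0) := by
  obtain ⟨t₁, h1, hC, hC', he, hp⟩ := H.step_plus hh hX hγ hmem ht.1 ht.2
  obtain ⟨t₂, h2, hB, hB', he', hn⟩ := H.step_minus hh hX' hγ hmem hC hC'
  refine ⟨t₂, by linarith, ⟨hB, hB'⟩, by rw [he', he], fun s hs hs' => ?_⟩
  rcases lt_trichotomy s t₁ with h | h | h
  · exact (hp s ⟨hs.1, h⟩).ne' hs'.2
  · rw [h] at hs'
    linarith [(H.lie_B _ hs'.1 hs'.2).1, (H.lie_C _ hC hC').1]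
  · exact (hn s ⟨h, hs.2⟩).ne hs'.2

/-- The points where a periodic solution crosses in `B` form a periodic orbit of the return map. -/
theorem IsReturnPair.exists_periodic_sequence (H : Z.IsReturnPair B C F G m)
    (hh : Differentiable ℝ Z.h) (hX : LipschitzWith K Z.Xp) (hX' : LipschitzWith K' Z.Xm)
    (hγ : Z.IsSolutionOn γ univ) (hmem : ∀ t, Z.h (γ t) = 0 → γ t ∈ B ∪ C) {T : ℝ} (hT : 0 < T)
    (hper : Function.Periodic γ T) {t₀ : ℝ} (ht₀ : γ t₀ ∈ B ∧ Z.h (γ t₀) = 0) :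
    ∃ (x : ℕ → Space3) (n : ℕ), 0 < n ∧ (∀ k, x k ∈ B ∧ Z.h (x k) = 0) ∧
      (∀ k, x (k + 1) = G (F (x k))) ∧ x n = x 0 ∧ x 0 = γ t₀ := by
  choose! N hN1 hN2 hN3 hN4 using
    fun t (ht : γ t ∈ B ∧ Z.h (γ t) = 0) => H.step hh hX hX' hγ hmem ht
  let θ : ℕ → ℝ := fun k => N^[k] t₀
  have hθs : ∀ k, θ (k + 1) = N (θ k) := fun k => Function.iterate_succ_apply' N k t₀
  have hθ : ∀ k, γ (θ k) ∈ B ∧ Z.h (γ (θ k)) = 0 := by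
    intro k
    induction k with
    | zero => exact ht₀
    | succ k ih => rw [hθs]; exact hN2 _ ih
  -- Each `+` half turn lasts at least `m`, so the crossing times do not accumulate and eventually
  -- pass `t₀ + T`.
  have hgrow : ∀ k : ℕ, t₀ + k * m ≤ θ k := by
    intro k
    induction k with
    | zero => simp [θ]
    | succ k ih =>
      rw [hθs]
      push_cast
      linarith [hN1 _ (hθ k)]
  have hex : ∃ k, t₀ + T < θ k := by
    obtain ⟨k, hk⟩ := exists_nat_gt (T / m)
    refine ⟨k, lt_of_lt_of_le ?_ (hgrow k)⟩
    rw [div_lt_iff₀ H.pos] at hk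
    linarith
  classical
  obtain ⟨n, hn⟩ : ∃ n, Nat.find hex = n + 1 := by
    refine Nat.exists_eq_succ_of_ne_zero fun h0 => ?_
    have := Nat.find_spec hex
    rw [h0] at this
    simp only [θ, Function.iterate_zero, id_eq] at this
    linarith
  have hlt : t₀ + T < θ (n + 1) := hn ▸ Nat.find_spec hex
  have hle : θ n ≤ t₀ + T := not_lt.1 (Nat.find_min hex (by omega))
  have hTB : γ (t₀ + T) ∈ B ∧ Z.h (γ (t₀ + T)) = 0 := by rw [hper t₀]; exact ht₀
  -- By periodicity `t₀ + T` is itself a time of crossing in `B`, and there is none strictly between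
  -- two consecutive terms of `θ`.
  have heq : θ n = t₀ + T := by
    by_contra hne
    exact hN4 _ (hθ n) (t₀ + T) ⟨lt_of_le_of_ne hle hne, by rw [← hθs]; exact hlt⟩ hTB
  refine ⟨fun k => γ (θ k), n, ?_, hθ, fun k => ?_, ?_, rfl⟩
  · rcases Nat.eq_zero_or_pos n with h | h
    · rw [h] at heq
      simp only [θ, Function.iterate_zero, id_eq] at heq
      linarith
    · exact h
  · simp only [hθs]
    exact hN3 _ (hθ k)
  · simp only [heq, hper t₀]
    rfl

/-- A criterion for a closed curve made of two arcs to be a limit cycle. -/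
theorem IsTwoArc.isLimitCycle {R L : Space3} {σ τ : ℝ} {α β : ℝ → Space3}
    (A : Z.IsTwoArc R L σ τ α β) (H : Z.IsReturnPair B C F G m) (hh : Differentiable ℝ Z.h)
    (hX : LipschitzWith K Z.Xp) (hX' : LipschitzWith K' Z.Xm) (hB : IsOpen B) (hC : IsOpen C)
    (hR : R ∈ B) (hL : L ∈ C)
    (hiso : ∀ (x : ℕ → Space3) (n : ℕ), 0 < n → (∀ k, x k ∈ B ∧ Z.h (x k) = 0) →
      (∀ k, x (k + 1) = G (F (x k))) → x n = x 0 → x 0 = R)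
    {W : Set Space3} (hW : IsOpen W) (hBC : ∀ p ∈ B ∪ C, 0 < Z.h p → p ∈ W)
    (hα : ∀ s ∈ Ioo 0 σ, α s ∈ W)
    (hpos : ∀ (γ : ℝ → Space3) (T : ℝ), 0 < T → Function.Periodic γ T →
      (∀ t, HasDerivAt γ (Z.Xp (γ t)) t) → ¬ ∀ t, 0 < Z.h (γ t) ∧ γ t ∈ W)
    (hneg : ∀ (γ : ℝ → Space3) (T : ℝ), 0 < T → Function.Periodic γ T →
      (∀ t, HasDerivAt γ (Z.Xm (γ t)) t) → ¬ ∀ t, Z.h (γ t) < 0) :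
    Z.IsLimitCycle (arcs σ τ α β) := by
  have hhc := hh.continuous
  -- This neighbourhood meets `Σ` only in `B ∪ C`, so a periodic orbit in it that meets `Σ` is
  -- governed by the return map. The whole of `h < 0` and the part of `h > 0` in `W` may be included
  -- because by `hneg` and `hpos` no periodic solution stays in either.
  refine ⟨A.isCrossingPeriodicOrbit, B ∪ C ∪ ({p | 0 < Z.h p} ∩ W) ∪ {p | Z.h p < 0}, ?_, ?_, ?_⟩
  · exact ((hB.union hC).union ((isOpen_lt continuous_const hhc).inter hW)).union
      (isOpen_lt hhc continuous_const)
  · intro p hp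
    rcases lt_trichotomy (Z.h p) 0 with h | h | h
    · exact Or.inr h
    · rcases A.mem_arcs_switching hp h with rfl | rfl
      · exact Or.inl (Or.inl (Or.inl hR))
      · exact Or.inl (Or.inl (Or.inr hL))
    · refine Or.inl (Or.inr ⟨h, ?_⟩)
      rcases hp with ⟨t, ht, rfl⟩ | ⟨t, ht, rfl⟩
      · refine hα t ⟨lt_of_le_of_ne ht.1 ?_, lt_of_le_of_ne ht.2 ?_⟩
        · rintro rfl
          rw [A.α_zero, A.h_R] at h
          exact lt_irrefl _ h
        · rintro rfl
          rw [A.α_end, A.h_L] at h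
          exact lt_irrefl _ h
      · exact absurd h (not_lt.2 (A.β_nonpos ht))
  · rintro Γ' ⟨γ, T, hT, hγ, hper, -, rfl⟩ hU
    have hγc : Continuous γ := continuous_iff_continuousAt.2 fun t => hγ.continuousAt (mem_univ t)
    have hmem : ∀ t, Z.h (γ t) = 0 → γ t ∈ B ∪ C := by
      intro t ht
      rcases hU (mem_range_self t) with (h | h) | h
      · exact h
      · exact absurd ht (ne_of_gt h.1)
      · exact absurd ht (ne_of_lt h)
    have hmeet : ∃ t, Z.h (γ t) = 0 := by
      by_contra! hno
      have hc : Continuous fun t => Z.h (γ t) := hhc.comp hγc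
      have hconst : (∀ t, 0 < Z.h (γ t)) ∨ ∀ t, Z.h (γ t) < 0 := by
        by_contra! hcon
        obtain ⟨⟨a, ha⟩, b, hb⟩ := hcon
        obtain ⟨t, -, ht⟩ := (convex_univ (𝕜 := ℝ)).isPreconnected.intermediate_value
          (mem_univ a) (mem_univ b) hc.continuousOn ⟨ha, hb⟩
        exact hno t ht
      rcases hconst with h | h
      · refine hpos γ T hT hper (fun t => hγ.hasDerivAt_of_pos (mem_univ t) (h t))
          fun t => ⟨h t, ?_⟩
        rcases hU (mem_range_self t) with (h' | h') | h'
        · exact hBC _ h' (h t)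
        · exact h'.2
        · exact absurd h' (not_lt.2 (h t).le)
      · exact hneg γ T hT hper (fun t => hγ.hasDerivAt_of_neg (mem_univ t) (h t)) h
    obtain ⟨t₀, ht₀⟩ : ∃ t, γ t ∈ B ∧ Z.h (γ t) = 0 := by
      obtain ⟨t, ht⟩ := hmeet
      rcases hmem t ht with h | h
      · exact ⟨t, h, ht⟩
      · obtain ⟨t', -, h1, h2, -⟩ := H.step_minus hh hX' hγ hmem h ht
        exact ⟨t', h1, h2⟩
    obtain ⟨x, n, hn, hx, hstep, hxn, hx0⟩ :=
      H.exists_periodic_sequence hh hX hX' hγ hmem hT hper ht₀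
    exact A.range_eq hh hX hX' hγ hT hper (hx0 ▸ hiso x n hn hx hstep hxn)

end Return

end PiecewiseSystem

/-! ### Limit cycles of the perturbed family -/

section FamilyOrbits

variable {c d ε : ℝ} {v : Fin 8 → ℝ}

theorem not_periodic_of_decreasing {Z : PiecewiseSystem} {γ : ℝ → Space3} {T : ℝ} (hT : 0 < T)
    (hper : Function.Periodic γ T) (hγ : ∀ t, HasDerivAt γ (Z.Xp (γ t)) t) :
    ¬ ∀ t, Z.Xp (γ t) 1 < 0 := by
  intro h
  have hd : ∀ t, HasDerivAt (fun t => γ t 1) (Z.Xp (γ t) 1) t := fun t => hasDerivAt_pi.1 (hγ t) 1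
  have := strictAnti_of_deriv_neg (f := fun t => γ t 1) fun t => by rw [(hd t).deriv]; exact h t
  have h1 := this hT
  have h2 := hper 0
  rw [zero_add] at h2
  simp only [h2] at h1
  exact lt_irrefl _ h1

theorem exists_forall_le_of_periodic {f : ℝ → ℝ} (hf : Continuous f) {T : ℝ} (hT : 0 < T)
    (hper : Function.Periodic f T) : ∃ t₀, ∀ t, f t ≤ f t₀ := by
  obtain ⟨t₀, -, h⟩ := isCompact_Icc.exists_isMaxOn (nonempty_Icc.2 hT.le) hf.continuousOn
  refine ⟨t₀, fun t => ?_⟩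
  obtain ⟨s, hs, hs'⟩ := hper.exists_mem_Ico₀ hT t
  rw [hs']
  exact h ⟨hs.1, hs.2.le⟩

/-- The perturbed `-` field still has first component `x`, so such a solution lies in `x = 0`. At a
maximum of `z` along it, `z' = 0` gives `y = -ε v₆`, and `h < 0` gives `z < ε² v₆²`. Then `z'' = y'
= 1 - z - ε² v₆ v₇` is positive for small `ε`, against maximality. -/
theorem familySystem_not_periodic_neg (hε : ε ^ 2 * (v 6 ^ 2 + |v 7 * v 6|) < 1) {γ : ℝ → Space3}
    {T : ℝ} (hT : 0 < T) (hper : Function.Periodic γ T)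
    (hγ : ∀ t, HasDerivAt γ ((familySystem c d v ε).Xm (γ t)) t) :
    ¬ ∀ t, (familySystem c d v ε).h (γ t) < 0 := by
  intro hneg
  have hp := fun t => hasDerivAt_pi.1 (hγ t)
  have hX : ∀ p : Space3, (familySystem c d v ε).Xm p =
      ![p 0, -p 2 + 1 + ε * (v 7 * p 1), p 0 + p 1 + ε * v 6] := by
    intro p
    ext i
    fin_cases i <;>
    simp [familySystem, perturbedSystem, baseField, Matrix.vecHead, Matrix.vecTail]
  have hx : ∀ t, γ t 0 = 0 := by
    refine eq_zero_of_periodic_of_hasDerivAt_self (x := fun t => γ t 0) (fun t => ?_) hT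
      (fun t => by simp only [hper t])
    exact (hp t 0).congr_deriv (by rw [hX]; rfl)
  have hy : ∀ t, HasDerivAt (fun t => γ t 1) (-γ t 2 + 1 + ε * (v 7 * γ t 1)) t :=
    fun t => (hp t 1).congr_deriv (by rw [hX]; rfl)
  have hz : ∀ t, HasDerivAt (fun t => γ t 2) (γ t 1 + ε * v 6) t :=
    fun t => (hp t 2).congr_deriv (by rw [hX]; simp [hx])
  have hzd : deriv (fun t => γ t 2) = fun t => γ t 1 + ε * v 6 := funext fun t => (hz t).deriv
  obtain ⟨t₀, hmax⟩ := exists_forall_le_of_periodic (f := fun t => γ t 2)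
    (continuous_iff_continuousAt.2 fun t => (hz t).continuousAt) hT
    (fun t => by simp only [hper t])
  have hmax' : IsLocalMax (fun t => γ t 2) t₀ := Eventually.of_forall hmax
  have hcrit : γ t₀ 1 + ε * v 6 = 0 := by rw [← (hz t₀).deriv]; exact hmax'.deriv_eq_zero
  have hh : γ t₀ 2 < γ t₀ 1 ^ 2 := by
    have := hneg t₀
    simp only [familySystem, perturbedSystem, switchingFunction, hx] at this
    linarith
  have hdd : 0 < deriv (deriv fun t => γ t 2) t₀ := by
    rw [hzd, ((hy t₀).add_const (ε * v 6)).deriv]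
    have h1 : γ t₀ 1 = -(ε * v 6) := by linarith
    rw [h1] at hh ⊢
    nlinarith [le_abs_self (v 7 * v 6), sq_nonneg ε]
  have hmin := isLocalMin_of_deriv_deriv_pos hdd (by rw [hzd]; exact hcrit) (hz t₀).continuousAt
  have hconst : (fun t => γ t 2) =ᶠ[𝓝 t₀] fun _ => γ t₀ 2 := by
    filter_upwards [hmin] with t ht
    exact le_antisymm (hmax t) ht
  have h2 := hconst.deriv.deriv_eq
  simp only [deriv_const', deriv_const] at h2
  exact hdd.ne' h2

/-- The scaled coordinates `(x / ε, y)`. -/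
noncomputable def sigmaCoords (ε : ℝ) (p : Space3) : ℝ × ℝ := (p 0 / ε, p 1)

theorem continuous_sigmaCoords (ε : ℝ) : Continuous (sigmaCoords ε) := by
  unfold sigmaCoords; fun_prop

theorem sigmaCoords_unscale_sigmaPoint (hε : ε ≠ 0) (q : ℝ × ℝ) :
    sigmaCoords ε (unscale ε (sigmaPoint c d (ε, q))) = q := by
  simp [sigmaCoords, unscale, sigmaPoint, hε]

theorem unscale_sigmaPoint_sigmaCoords (hε : ε ≠ 0) {p : Space3}
    (hp : switchingFunction c d p = 0) :
    unscale ε (sigmaPoint c d (ε, sigmaCoords ε p)) = p := by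
  have h1 : unscale ε ![p 0 / ε, p 1, p 2] = p := by
    ext i
    fin_cases i <;> simp [unscale, mul_div_cancel₀, hε]
  have h2 := eq_sigmaPoint (p := ![p 0 / ε, p 1, p 2]) (h1 ▸ hp)
  simp only [Matrix.cons_val_zero, Matrix.cons_val_one] at h2
  rw [sigmaCoords, ← h2, h1]

theorem familySystem_liePlus_unscale (p : Space3) :
    (familySystem c d v ε).liePlus (unscale ε p) = scaledLie c d (scaledPlus v) ε p := by
  rw [PiecewiseSystem.liePlus, familySystem_Xp_unscale]
  rfl

theorem familySystem_lieMinus_unscale (p : Space3) :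
    (familySystem c d v ε).lieMinus (unscale ε p) = scaledLie c d (scaledMinus v) ε p := by
  rw [PiecewiseSystem.lieMinus, familySystem_Xm_unscale]
  rfl

theorem familySystem_differentiable_h : Differentiable ℝ (familySystem c d v ε).h :=
  differentiable_switchingFunction c d

variable {ψ ψ' : ℝ × Space3 × ℝ → Space3} {τ τ' : ℝ × (ℝ × ℝ) → ℝ}
  {m : ℝ} {q : ℝ × ℝ}

theorem IsHalfTurn.isPlusArc (hψ : IsFlow (scaledPlus v) ψ)
    (h : IsHalfTurn c d 1 (scaledPlus v) ψ (ε, q) (τ (ε, q))) :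
    (familySystem c d v ε).IsPlusArc (unscale ε (sigmaPoint c d (ε, q)))
      (unscale ε (sigmaPoint c d (halfTurnEnd c d ψ τ (ε, q)))) (τ (ε, q)) := by
  refine ⟨h.pos, fun s => unscale ε (ψ (ε, sigmaPoint c d (ε, q), s)), by simp only [hψ.zero], ?_,
    fun s => ?_, fun s hs => ?_⟩
  · rw [h.sigmaPoint_end]
  · rw [familySystem_Xp_unscale]
    exact hasDerivAt_unscale (hψ.hasDerivAt _ _ _)
  · have := h.side s hs
    rwa [one_mul] at this

theorem IsHalfTurn.isMinusArc (hψ : IsFlow (scaledMinus v) ψ)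
    (h : IsHalfTurn c d (-1) (scaledMinus v) ψ (ε, q) (τ (ε, q))) :
    (familySystem c d v ε).IsMinusArc (unscale ε (sigmaPoint c d (ε, q)))
      (unscale ε (sigmaPoint c d (halfTurnEnd c d ψ τ (ε, q)))) (τ (ε, q)) := by
  refine ⟨h.pos, fun s => unscale ε (ψ (ε, sigmaPoint c d (ε, q), s)), by simp only [hψ.zero], ?_,
    fun s => ?_, fun s hs => ?_⟩
  · rw [h.sigmaPoint_end]
  · rw [familySystem_Xm_unscale]
    exact hasDerivAt_unscale (hψ.hasDerivAt _ _ _)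
  · have := h.side s hs
    simp only [neg_mul, one_mul, Left.neg_pos_iff] at this
    exact this

/-- The closed curve through the point with scaled coordinates `e.2`. -/
noncomputable def familyOrbit (c d : ℝ) (ψ ψ' : ℝ × Space3 × ℝ → Space3)
    (τ τ' : ℝ × (ℝ × ℝ) → ℝ) (e : ℝ × (ℝ × ℝ)) : Set Space3 :=
  PiecewiseSystem.arcs (τ e) (τ' (halfTurnEnd c d ψ τ e))
    (fun s => unscale e.1 (ψ (e.1, sigmaPoint c d e, s)))
    (fun s => unscale e.1 (ψ' (e.1, sigmaPoint c d (halfTurnEnd c d ψ τ e), s)))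

/-- The conditions on a starting point under which its `+` half turn leads from a crossing point
to the switching manifold. -/
def GoodPlus (c d : ℝ) (v : Fin 8 → ℝ) (ψ : ℝ × Space3 × ℝ → Space3) (τ : ℝ × (ℝ × ℝ) → ℝ) (m : ℝ)
    (e : ℝ × (ℝ × ℝ)) : Prop :=
  IsHalfTurn c d 1 (scaledPlus v) ψ e (τ e) ∧ m ≤ τ e ∧
    0 < scaledLie c d (scaledMinus v) e.1 (sigmaPoint c d e)

/-- The conditions on a starting point under which its `-` half turn leads from a crossing point
to the switching manifold. -/
def GoodMinus (c d : ℝ) (v : Fin 8 → ℝ) (ψ : ℝ × Space3 × ℝ → Space3) (τ : ℝ × (ℝ × ℝ) → ℝ)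
    (e : ℝ × (ℝ × ℝ)) : Prop :=
  IsHalfTurn c d (-1) (scaledMinus v) ψ e (τ e) ∧
    scaledLie c d (scaledPlus v) e.1 (sigmaPoint c d e) < 0

theorem GoodPlus.lie (h : GoodPlus c d v ψ τ m (ε, q)) :
    0 < (familySystem c d v ε).liePlus (unscale ε (sigmaPoint c d (ε, q))) ∧
      0 < (familySystem c d v ε).lieMinus (unscale ε (sigmaPoint c d (ε, q))) := by
  have h1 := h.1.lie_start
  rw [one_mul] at h1
  rw [familySystem_liePlus_unscale, familySystem_lieMinus_unscale]
  exact ⟨h1, h.2.2⟩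

theorem GoodMinus.lie (h : GoodMinus c d v ψ τ (ε, q)) :
    (familySystem c d v ε).liePlus (unscale ε (sigmaPoint c d (ε, q))) < 0 ∧
      (familySystem c d v ε).lieMinus (unscale ε (sigmaPoint c d (ε, q))) < 0 := by
  have h1 := h.1.lie_start
  rw [neg_mul, one_mul, Left.neg_pos_iff] at h1
  rw [familySystem_liePlus_unscale, familySystem_lieMinus_unscale]
  exact ⟨h.2, h1⟩

theorem GoodPlus.lie_end (h : GoodPlus c d v ψ τ m (ε, q)) :
    (familySystem c d v ε).liePlus
      (unscale ε (sigmaPoint c d (halfTurnEnd c d ψ τ (ε, q)))) < 0 := by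
  have h1 := h.1.lie_end
  rw [one_mul] at h1
  rw [familySystem_liePlus_unscale, h.1.sigmaPoint_end]
  exact h1

theorem GoodMinus.lie_end (h : GoodMinus c d v ψ τ (ε, q)) :
    0 < (familySystem c d v ε).lieMinus
      (unscale ε (sigmaPoint c d (halfTurnEnd c d ψ τ (ε, q)))) := by
  have h1 := h.1.lie_end
  rw [neg_mul, one_mul, Left.neg_neg_iff] at h1
  rw [familySystem_lieMinus_unscale, h.1.sigmaPoint_end]
  exact h1

theorem familySystem_h : (familySystem c d v ε).h = switchingFunction c d := rfl

/-- The point of the switching manifold at which the half turn that begins at `p` ends. -/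
noncomputable def halfReturn (c d ε : ℝ) (ψ : ℝ × Space3 × ℝ → Space3) (τ : ℝ × (ℝ × ℝ) → ℝ)
    (p : Space3) : Space3 :=
  unscale ε (sigmaPoint c d (halfTurnEnd c d ψ τ (ε, sigmaCoords ε p)))

theorem switchingFunction_halfReturn (p : Space3) :
    switchingFunction c d (halfReturn c d ε ψ τ p) = 0 :=
  switchingFunction_unscale_sigmaPoint c d (halfTurnEnd c d ψ τ (ε, sigmaCoords ε p))

theorem sigmaCoords_halfReturn (hε : ε ≠ 0) (p : Space3) :
    sigmaCoords ε (halfReturn c d ε ψ τ p) = (halfTurnEnd c d ψ τ (ε, sigmaCoords ε p)).2 :=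
  sigmaCoords_unscale_sigmaPoint (c := c) (d := d) hε
    (halfTurnEnd c d ψ τ (ε, sigmaCoords ε p)).2

theorem familySystem_isReturnPair (hψ : IsFlow (scaledPlus v) ψ) (hψ' : IsFlow (scaledMinus v) ψ')
    (hε : ε ≠ 0) (hm : 0 < m) {B C : Set Space3}
    (hB : ∀ p ∈ B, GoodPlus c d v ψ τ m (ε, sigmaCoords ε p))
    (hC : ∀ p ∈ C, GoodMinus c d v ψ' τ' (ε, sigmaCoords ε p)) :
    (familySystem c d v ε).IsReturnPair B C
      (halfReturn c d ε ψ τ) (halfReturn c d ε ψ' τ') m where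
  pos := hm
  lie_B p hp h0 := by
    have h := (hB p hp).lie
    rwa [unscale_sigmaPoint_sigmaCoords hε h0] at h
  lie_C p hp h0 := by
    have h := (hC p hp).lie
    rwa [unscale_sigmaPoint_sigmaCoords hε h0] at h
  end_B p hp _ := ⟨by rw [familySystem_h, switchingFunction_halfReturn], (hB p hp).lie_end⟩
  end_C p hp _ := ⟨by rw [familySystem_h, switchingFunction_halfReturn], (hC p hp).lie_end⟩
  arc_B p hp h0 := by
    have h := (hB p hp).1.isPlusArc hψ
    rw [unscale_sigmaPoint_sigmaCoords hε h0] at h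
    exact ⟨_, (hB p hp).2.1, h⟩
  arc_C p hp h0 := by
    have h := (hC p hp).1.isMinusArc hψ'
    rw [unscale_sigmaPoint_sigmaCoords hε h0] at h
    exact ⟨_, h⟩

theorem familyOrbit_isTwoArc (hψ : IsFlow (scaledPlus v) ψ) (hψ' : IsFlow (scaledMinus v) ψ')
    (hfix : halfTurnEnd c d ψ' τ' (halfTurnEnd c d ψ τ (ε, q)) = (ε, q))
    (h : GoodPlus c d v ψ τ m (ε, q)) (h' : GoodMinus c d v ψ' τ' (halfTurnEnd c d ψ τ (ε, q))) :
    (familySystem c d v ε).IsTwoArc (unscale ε (sigmaPoint c d (ε, q)))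
      (unscale ε (sigmaPoint c d (halfTurnEnd c d ψ τ (ε, q)))) (τ (ε, q))
      (τ' (halfTurnEnd c d ψ τ (ε, q)))
      (fun s => unscale ε (ψ (ε, sigmaPoint c d (ε, q), s)))
      (fun s => unscale ε (ψ' (ε, sigmaPoint c d (halfTurnEnd c d ψ τ (ε, q)), s))) where
  σ_pos := h.1.pos
  τ_pos := h'.1.pos
  α_zero := by rw [hψ.zero]
  α_end := by rw [h.1.sigmaPoint_end]
  β_zero := by rw [hψ'.zero]
  β_end := by
    have := h'.1.sigmaPoint_end
    rw [hfix] at this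
    rw [this]
    rfl
  hasDerivAt_α t := by
    rw [familySystem_Xp_unscale]
    exact hasDerivAt_unscale (hψ.hasDerivAt _ _ _)
  hasDerivAt_β t := by
    rw [familySystem_Xm_unscale]
    exact hasDerivAt_unscale (hψ'.hasDerivAt _ _ _)
  α_pos t ht := by
    have := h.1.side t ht
    rw [one_mul] at this
    exact this
  β_neg t ht := by
    have := h'.1.side t ht
    simp only [neg_mul, one_mul, Left.neg_pos_iff] at this
    exact this
  h_R := switchingFunction_unscale_sigmaPoint c d (ε, q)
  h_L := switchingFunction_unscale_sigmaPoint c d (halfTurnEnd c d ψ τ (ε, q))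
  liePlus_R := h.lie.1
  lieMinus_R := h.lie.2
  liePlus_L := h'.lie.1
  lieMinus_L := h'.lie.2

/-- A criterion for the closed curve through a fixed point of the return map to be a limit
cycle. -/
theorem familyOrbit_isLimitCycle (hψ : IsFlow (scaledPlus v) ψ) (hψ' : IsFlow (scaledMinus v) ψ')
    (hε : ε ≠ 0) (hsmall : ε ^ 2 * (v 6 ^ 2 + |v 7 * v 6|) < 1) (hm : 0 < m)
    (hfix : halfTurnEnd c d ψ' τ' (halfTurnEnd c d ψ τ (ε, q)) = (ε, q))
    (h : ∀ᶠ e in 𝓝 (ε, q), GoodPlus c d v ψ τ m e)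
    (h' : ∀ᶠ e in 𝓝 (halfTurnEnd c d ψ τ (ε, q)), GoodMinus c d v ψ' τ' e)
    (hdec : ∀ s ∈ Icc 0 (τ (ε, q)), scaledPlus v ε (ψ (ε, sigmaPoint c d (ε, q), s)) 1 < 0)
    (hiso : ∃ V ∈ 𝓝 q, ∀ (x : ℕ → ℝ × ℝ) (n : ℕ), 0 < n → (∀ k, x k ∈ V) →
      (∀ k, x (k + 1) = (halfTurnEnd c d ψ' τ' (halfTurnEnd c d ψ τ (ε, x k))).2) →
      x n = x 0 → x 0 = q) :
    (familySystem c d v ε).IsLimitCycle (familyOrbit c d ψ ψ' τ τ' (ε, q)) := by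
  obtain ⟨V, hV, hiso⟩ := hiso
  obtain ⟨K, hK⟩ := exists_lipschitzWith_Xp c d v ε
  obtain ⟨K', hK'⟩ := exists_lipschitzWith_Xm c d v ε
  have A := familyOrbit_isTwoArc hψ hψ' hfix h.self_of_nhds h'.self_of_nhds
  have hline : ∀ q : ℝ × ℝ, Tendsto (fun q : ℝ × ℝ => (ε, q)) (𝓝 q) (𝓝 (ε, q)) := fun q =>
    (by fun_prop : Continuous fun q : ℝ × ℝ => (ε, q)).tendsto q
  obtain ⟨N, hN, hNo, hqN⟩ := eventually_nhds_iff.1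
    (((hline q).eventually h).and (eventually_mem_set.2 hV))
  obtain ⟨N', hN', hNo', hqN'⟩ := eventually_nhds_iff.1 ((hline _).eventually h')
  -- In `W` the `+` field decreases `y`, so none of its periodic solutions stays there. `B` and `C`
  -- are cut down to `W` so that all points of the neighbourhood with `h > 0` belong to it.
  let W : Set Space3 := {p | (familySystem c d v ε).Xp p 1 < 0}
  have hW : IsOpen W :=
    isOpen_lt ((continuous_apply 1).comp hK.continuous) continuous_const
  have hdec' : ∀ s ∈ Icc 0 (τ (ε, q)), unscale ε (ψ (ε, sigmaPoint c d (ε, q), s)) ∈ W := by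
    intro s hs
    show (familySystem c d v ε).Xp _ 1 < 0
    rw [familySystem_Xp_unscale]
    exact hdec s hs
  refine A.isLimitCycle (B := sigmaCoords ε ⁻¹' N ∩ W) (C := sigmaCoords ε ⁻¹' N' ∩ W) (W := W)
    (familySystem_isReturnPair (τ := τ) (τ' := τ') hψ hψ' hε hm (fun p hp => (hN _ hp.1).1)
      (fun p hp => hN' _ hp.1))
    familySystem_differentiable_h hK hK' ((hNo.preimage (continuous_sigmaCoords ε)).inter hW)
    ((hNo'.preimage (continuous_sigmaCoords ε)).inter hW) ⟨?_, ?_⟩ ⟨?_, ?_⟩ ?_ hW ?_ ?_ ?_ ?_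
  · rw [mem_preimage, sigmaCoords_unscale_sigmaPoint hε]
    exact hqN
  · have := hdec' 0 ⟨le_rfl, A.σ_pos.le⟩
    rwa [hψ.zero] at this
  · rw [mem_preimage]
    exact (sigmaCoords_unscale_sigmaPoint (c := c) (d := d) hε
      (halfTurnEnd c d ψ τ (ε, q)).2).symm ▸ hqN'
  · have := hdec' _ ⟨A.σ_pos.le, le_rfl⟩
    rwa [show unscale ε (ψ (ε, sigmaPoint c d (ε, q), τ (ε, q))) = _ from A.α_end] at this
  · intro x n hn hx hstep hxn
    have h0 := hiso (fun k => sigmaCoords ε (x k)) n hn (fun k => (hN _ (hx k).1.1).2)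
      (fun k => by rw [hstep, sigmaCoords_halfReturn hε, sigmaCoords_halfReturn hε]; rfl) (by simp only [hxn])
    rw [← h0, unscale_sigmaPoint_sigmaCoords hε (hx 0).2]
  · rintro p (hp | hp) -
    · exact hp.2
    · exact hp.2
  · exact fun s hs => hdec' s ⟨hs.1.le, hs.2.le⟩
  · exact fun γ T hT hper hγ hall => not_periodic_of_decreasing hT hper hγ fun t => (hall t).2
  · exact fun γ T hT hper hγ => familySystem_not_periodic_neg hsmall hT hper hγ

end FamilyOrbits

/-! ### Hausdorff convergence of the closed curves -/

section UniformConvergence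

variable {E ι : Type*} [TopologicalSpace E] {f g : E × ℝ → Space3} {e₀ : E}

theorem eventually_forall_edist_le (hf : ∀ s ∈ Icc (0 : ℝ) 1, ContinuousAt f (e₀, s))
    {δ : ENNReal} (hδ : 0 < δ) :
    ∀ᶠ e in 𝓝 e₀, ∀ s ∈ Icc (0 : ℝ) 1, edist (f (e, s)) (f (e₀, s)) ≤ δ := by
  refine isCompact_Icc.eventually_forall_of_forall_eventually fun s hs => ?_
  have h1 : Tendsto (fun a : E × ℝ => (e₀, a.2)) (𝓝 (e₀, s)) (𝓝 (e₀, s)) :=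
    (by fun_prop : Continuous fun a : E × ℝ => (e₀, a.2)).tendsto _
  have h2 := ((hf s hs).tendsto).edist ((hf s hs).tendsto.comp h1)
  rw [edist_self] at h2
  exact (h2.eventually_lt_const hδ).mono fun _ h => h.le

theorem tendsto_hausdorffEDist_union_image {l : Filter ι} {e : ι → E} (he : Tendsto e l (𝓝 e₀))
    (hf : ∀ s ∈ Icc (0 : ℝ) 1, ContinuousAt f (e₀, s))
    (hg : ∀ s ∈ Icc (0 : ℝ) 1, ContinuousAt g (e₀, s)) :
    Tendsto (fun i => Metric.hausdorffEDist
      ((fun s => f (e i, s)) '' Icc 0 1 ∪ (fun s => g (e i, s)) '' Icc 0 1)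
      ((fun s => f (e₀, s)) '' Icc 0 1 ∪ (fun s => g (e₀, s)) '' Icc 0 1)) l (𝓝 0) := by
  rw [ENNReal.tendsto_nhds_zero]
  intro δ hδ
  filter_upwards [he.eventually (eventually_forall_edist_le hf hδ),
    he.eventually (eventually_forall_edist_le hg hδ)] with i h1 h2
  refine Metric.hausdorffEDist_le_of_mem_edist ?_ ?_
  · rintro _ (⟨s, hs, rfl⟩ | ⟨s, hs, rfl⟩)
    · exact ⟨_, Or.inl ⟨s, hs, rfl⟩, h1 s hs⟩
    · exact ⟨_, Or.inr ⟨s, hs, rfl⟩, h2 s hs⟩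
  · rintro _ (⟨s, hs, rfl⟩ | ⟨s, hs, rfl⟩)
    · exact ⟨_, Or.inl ⟨s, hs, rfl⟩, by rw [edist_comm]; exact h1 s hs⟩
    · exact ⟨_, Or.inr ⟨s, hs, rfl⟩, by rw [edist_comm]; exact h2 s hs⟩

/-- Rescaling both arcs to the parameter interval `[0, 1]` makes curves with different flight times
comparable point by point. -/
theorem arcs_eq_union_image {σ τ : ℝ} (hσ : 0 < σ) (hτ : 0 < τ) (α β : ℝ → Space3) :
    PiecewiseSystem.arcs σ τ α β =
      (fun s => α (s * σ)) '' Icc 0 1 ∪ (fun s => β (s * τ)) '' Icc 0 1 := by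
  have key : ∀ {σ : ℝ} (_ : 0 < σ) (α : ℝ → Space3),
      α '' Icc 0 σ = (fun s => α (s * σ)) '' Icc 0 1 := by
    intro σ hσ α
    have : (fun s : ℝ => s * σ) '' Icc 0 1 = Icc 0 σ := by
      rw [Set.image_mul_right_Icc (by norm_num) hσ.le]
      simp
    rw [← this, image_image]
  rw [PiecewiseSystem.arcs, key hσ, key hτ]

end UniformConvergence

section Convergence

variable {c d : ℝ} {v : Fin 8 → ℝ} {ψ ψ' : ℝ × Space3 × ℝ → Space3} {τ τ' : ℝ × (ℝ × ℝ) → ℝ}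
  {e₀ : ℝ × (ℝ × ℝ)}

theorem continuousAt_flow_sigmaPoint (hψ : Continuous ψ) (hτ : ContinuousAt τ e₀) (s : ℝ) :
    ContinuousAt (fun a : (ℝ × (ℝ × ℝ)) × ℝ => ψ (a.1.1, sigmaPoint c d a.1, a.2 * τ a.1))
      (e₀, s) := by
  have h1 : ContinuousAt (fun a : (ℝ × (ℝ × ℝ)) × ℝ => sigmaPoint c d a.1) (e₀, s) :=
    ((contDiff_sigmaPoint c d (n := 0)).continuous.comp continuous_fst).continuousAt
  have h2 : ContinuousAt (fun a : (ℝ × (ℝ × ℝ)) × ℝ => τ a.1) (e₀, s) :=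
    ContinuousAt.comp (g := τ) (f := Prod.fst) hτ continuousAt_fst
  have h3 : ContinuousAt (fun a : (ℝ × (ℝ × ℝ)) × ℝ =>
      (a.1.1, sigmaPoint c d a.1, a.2 * τ a.1)) (e₀, s) :=
    ContinuousAt.prodMk (by fun_prop) (h1.prodMk (continuousAt_snd.mul h2))
  exact ContinuousAt.comp (g := ψ) hψ.continuousAt h3

theorem continuous_unscale : Continuous fun a : ℝ × Space3 => unscale a.1 a.2 := by
  refine continuous_pi fun i => ?_
  fin_cases i
  · show Continuous fun a : ℝ × Space3 => a.1 * a.2 0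
    fun_prop
  · show Continuous fun a : ℝ × Space3 => a.2 1
    fun_prop
  · show Continuous fun a : ℝ × Space3 => a.2 2
    fun_prop

theorem continuousAt_unscale_flow (hψ : Continuous ψ) (hτ : ContinuousAt τ e₀) (s : ℝ) :
    ContinuousAt (fun a : (ℝ × (ℝ × ℝ)) × ℝ =>
      unscale a.1.1 (ψ (a.1.1, sigmaPoint c d a.1, a.2 * τ a.1))) (e₀, s) :=
  ContinuousAt.comp (g := fun a : ℝ × Space3 => unscale a.1 a.2)
    (f := fun a : (ℝ × (ℝ × ℝ)) × ℝ => (a.1.1, ψ (a.1.1, sigmaPoint c d a.1, a.2 * τ a.1)))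
    continuous_unscale.continuousAt
    (ContinuousAt.prodMk (by fun_prop) (continuousAt_flow_sigmaPoint hψ hτ s))

theorem tendsto_familyOrbit {ι : Type*} {l : Filter ι} {e : ι → ℝ × (ℝ × ℝ)}
    (he : Tendsto e l (𝓝 e₀)) (hψ : Continuous ψ) (hψ' : Continuous ψ') (hτ : ContinuousAt τ e₀)
    (hE : ContinuousAt (halfTurnEnd c d ψ τ) e₀) (hτ' : ContinuousAt τ' (halfTurnEnd c d ψ τ e₀))
    (hpos : 0 < τ e₀) (hpos' : 0 < τ' (halfTurnEnd c d ψ τ e₀)) :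
    Tendsto (fun i => Metric.hausdorffEDist (familyOrbit c d ψ ψ' τ τ' (e i))
      (familyOrbit c d ψ ψ' τ τ' e₀)) l (𝓝 0) := by
  have h := tendsto_hausdorffEDist_union_image he
    (f := fun a => unscale a.1.1 (ψ (a.1.1, sigmaPoint c d a.1, a.2 * τ a.1)))
    (g := fun a => unscale a.1.1 (ψ' (a.1.1, sigmaPoint c d (halfTurnEnd c d ψ τ a.1),
      a.2 * τ' (halfTurnEnd c d ψ τ a.1))))
    (fun s _ => continuousAt_unscale_flow hψ hτ s) (fun s _ => by
      have h1 : ContinuousAt (fun a : (ℝ × (ℝ × ℝ)) × ℝ => halfTurnEnd c d ψ τ a.1) (e₀, s) :=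
        ContinuousAt.comp (g := halfTurnEnd c d ψ τ) (f := Prod.fst) hE continuousAt_fst
      exact ContinuousAt.comp (f := fun a : (ℝ × (ℝ × ℝ)) × ℝ => (halfTurnEnd c d ψ τ a.1, a.2))
        (continuousAt_unscale_flow hψ' hτ' s) (h1.prodMk continuousAt_snd))
  refine h.congr' ?_
  filter_upwards [he.eventually (hτ.eventually (lt_mem_nhds hpos)),
    he.eventually ((ContinuousAt.comp (g := τ') hτ' hE).eventually (lt_mem_nhds hpos'))]
    with i h1 h2
  rw [Function.comp_apply] at h2
  rw [familyOrbit, familyOrbit, arcs_eq_union_image h1 h2, arcs_eq_union_image hpos hpos']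

theorem continuous_scaledLie_plus :
    Continuous fun e : ℝ × (ℝ × ℝ) => scaledLie c d (scaledPlus v) e.1 (sigmaPoint c d e) := by
  simp only [scaledLie, fderiv_switchingFunction, unscale, scaledPlus, sigmaPoint, Matrix.cons_val]
  fun_prop

theorem continuous_scaledLie_minus :
    Continuous fun e : ℝ × (ℝ × ℝ) => scaledLie c d (scaledMinus v) e.1 (sigmaPoint c d e) := by
  simp only [scaledLie, fderiv_switchingFunction, unscale, scaledMinus, sigmaPoint,
    Matrix.cons_val]
  fun_prop

theorem differentiable_halfTimePlus : Differentiable ℝ halfTimePlus := by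
  intro y
  have : y ^ 2 + 1 ≠ 0 := by positivity
  unfold halfTimePlus
  refine DifferentiableAt.arctan ?_
  fun_prop (disch := assumption)

theorem differentiableAt_halfTimeMinus {y : ℝ} (hy : y ≠ 0) :
    DifferentiableAt ℝ halfTimeMinus y := by
  unfold halfTimeMinus
  refine (DifferentiableAt.arctan ?_).const_add _
  fun_prop (disch := assumption)

theorem differentiableAt_fixedXi (v : Fin 8 → ℝ) {y : ℝ} (hy : 0 < y) :
    DifferentiableAt ℝ (fixedXi v) y := by
  have h1 := differentiable_halfTimePlus y
  have h2 := differentiableAt_halfTimeMinus hy.ne'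
  have h3 : 1 - Real.exp (2 * halfTimePlus y) * Real.exp (2 * halfTimeMinus y) ≠ 0 := by
    linarith [one_lt_exp_mul_exp hy]
  unfold fixedXi ellAt
  fun_prop (disch := assumption)

theorem differentiableAt_melnikov (c : ℝ) (v : Fin 8 → ℝ) {y : ℝ} (hy : 1 < y) :
    DifferentiableAt ℝ (melnikov c v) y := by
  have h1 := differentiable_halfTimePlus y
  have h2 := differentiableAt_halfTimeMinus (y := y) (by linarith)
  have h3 := differentiableAt_fixedXi v (y := y) (by linarith)
  have h4 : 2 * y * (2 * y ^ 2 - 1) * (2 * y ^ 2 + 3) ≠ 0 := by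
    have : 0 < 2 * y ^ 2 - 1 := by nlinarith
    positivity
  unfold melnikov energyPlus energyMinus leftXi ellAt radSqPlus radSqMinus
  fun_prop (disch := assumption)

end Convergence

/-! ### Limit cycles from simple zeros -/

/-- A simple zero of the Melnikov function gives rise to limit cycles of the perturbed systems. -/
theorem exists_limitCycle_of_melnikov (c d : ℝ) (v : Fin 8 → ℝ) {y₀ μ' : ℝ} (hy₀ : 1 < y₀)
    (h0 : melnikov c v y₀ = 0) (hμ' : HasDerivAt (melnikov c v) μ' y₀) (hμ'0 : μ' ≠ 0) :
    ∃ Γ : ℝ → Set Space3, (∀ᶠ ε in 𝓝[≠] 0, (familySystem c d v ε).IsLimitCycle (Γ ε)) ∧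
      Tendsto (fun ε => Metric.hausdorffEDist (Γ ε) (unperturbedOrbit y₀)) (𝓝[≠] 0) (𝓝 0) := by
  obtain ⟨ψ, hψ⟩ := exists_flow_scaledPlus v
  obtain ⟨ψ', hψ'⟩ := exists_flow_scaledMinus v
  have hy0 : 0 < y₀ := by linarith
  have hgt : ∀ q₀ : ℝ × ℝ, 1 < q₀.2 → ∀ᶠ q : ℝ × ℝ in 𝓝 q₀, 1 < q.2 := fun q₀ h =>
    continuousAt_snd.eventually (lt_mem_nhds h)
  obtain ⟨τ, hτ, hτ0, hturn⟩ := exists_halfTurn (c := c) (d := d) (s := 1) hψ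
    (q₀ := (fixedXi v y₀, y₀)) (T := fun q => 2 * halfTimePlus q.2)
    ((hgt _ hy₀).mono fun q hq => isHalfTurn_plus_zero hψ c d q.1 hq)
  obtain ⟨τ', hτ', hτ'0, hturn'⟩ := exists_halfTurn (c := c) (d := d) (s := -1) hψ'
    (q₀ := (leftXi v y₀, -y₀)) (T := fun q => 2 * halfTimeMinus (-q.2)) (by
      have : ∀ᶠ q : ℝ × ℝ in 𝓝 (leftXi v y₀, -y₀), q.2 < -1 :=
        continuousAt_snd.eventually (gt_mem_nhds (by show -y₀ < -1; linarith))
      refine this.mono fun q hq => ?_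
      have h := isHalfTurn_minus_zero hψ' c d q.1 (y := -q.2) (by linarith)
      rwa [neg_neg] at h)
  have hE0 : ∀ q : ℝ × ℝ, 0 < q.2 → τ (0, q) = 2 * halfTimePlus q.2 →
      halfTurnEnd c d ψ τ (0, q) = (0, (ellAt v (-q.2) +
        (q.1 - ellAt v q.2) * Real.exp (2 * halfTimePlus q.2), -q.2)) := fun q hq h =>
    halfTurnEnd_plus_zero hψ hq h
  have hEbase : halfTurnEnd c d ψ τ (0, (fixedXi v y₀, y₀)) = (0, (leftXi v y₀, -y₀)) :=
    hE0 _ hy0 hτ0.self_of_nhds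
  have hEc := contDiffAt_halfTurnEnd (c := c) (d := d) hψ hτ
  have hE'c : ContDiffAt ℝ 2 (halfTurnEnd c d ψ' τ')
      (halfTurnEnd c d ψ τ (0, (fixedXi v y₀, y₀))) := by
    rw [hEbase]; exact contDiffAt_halfTurnEnd (c := c) (d := d) hψ' hτ'
  have hPc := hE'c.comp _ hEc
  have hline : ∀ q : ℝ × ℝ, Tendsto (fun q : ℝ × ℝ => ((0 : ℝ), q)) (𝓝 q) (𝓝 (0, q)) := fun q =>
    (by fun_prop : Continuous fun q : ℝ × ℝ => ((0 : ℝ), q)).tendsto q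
  have hEq : Tendsto (fun q => (halfTurnEnd c d ψ τ (0, q)).2) (𝓝 (fixedXi v y₀, y₀))
      (𝓝 (leftXi v y₀, -y₀)) := by
    have := (continuousAt_snd.tendsto.comp hEc.continuousAt.tendsto).comp (hline _)
    rw [hEbase] at this
    exact this
  have hP0 : ∀ᶠ q in 𝓝 (fixedXi v y₀, y₀),
      halfTurnEnd c d ψ' τ' (halfTurnEnd c d ψ τ (0, q)) = (0, ((ellAt v (-q.2) +
        (q.1 - ellAt v q.2) * Real.exp (2 * halfTimePlus q.2)) *
          Real.exp (2 * halfTimeMinus q.2), q.2)) := by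
    filter_upwards [hτ0, hgt (fixedXi v y₀, y₀) hy₀, hEq.eventually hτ'0] with q h1 h2 h3
    have h4 := hE0 q (by linarith) h1
    rw [h4] at h3 ⊢
    simp only [neg_neg] at h3
    exact halfTurnEnd_minus_zero hψ' (by linarith) h3
  have hX := (differentiableAt_fixedXi v hy0).hasDerivAt
  have hXline : Tendsto (fun y => (fixedXi v y, y)) (𝓝 y₀) (𝓝 (fixedXi v y₀, y₀)) :=
    hX.continuousAt.tendsto.prodMk_nhds tendsto_id
  have hXline' : Tendsto (fun y => ((0 : ℝ), (fixedXi v y, y))) (𝓝 y₀)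
      (𝓝 (0, (fixedXi v y₀, y₀))) := (hline _).comp hXline
  have hLline : Tendsto (fun y => (leftXi v y, -y)) (𝓝 y₀) (𝓝 (leftXi v y₀, -y₀)) := by
    have h1 := differentiable_halfTimePlus y₀
    have h2 := differentiableAt_fixedXi v hy0
    have : DifferentiableAt ℝ (leftXi v) y₀ := by
      unfold leftXi ellAt
      fun_prop
    exact this.continuousAt.tendsto.prodMk_nhds continuous_neg.continuousAt.tendsto
  obtain ⟨p, hp, hpe⟩ := exists_isolated_fixed_point
    (P₁ := fun e => (halfTurnEnd c d ψ' τ' (halfTurnEnd c d ψ τ e)).2.1)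
    (P₂ := fun e => (halfTurnEnd c d ψ' τ' (halfTurnEnd c d ψ τ e)).2.2)
    (y₀ := y₀) (X := fixedXi v) (μ := melnikov c v) (μ' := μ')
    (lam := Real.exp (2 * halfTimePlus y₀) * Real.exp (2 * halfTimeMinus y₀))
    (contDiffAt_fst.comp _ (contDiffAt_snd.comp _ hPc))
    (contDiffAt_snd.comp _ (contDiffAt_snd.comp _ hPc))
    (hP0.mono fun q hq => by rw [hq]) hX
    (by
      filter_upwards [hXline.eventually hP0, lt_mem_nhds hy0] with y hq hy
      rw [hq]
      exact leftXi_mul_exp v hy)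
    (by
      have hξ : Tendsto (fun ξ : ℝ => (ξ, y₀)) (𝓝 (fixedXi v y₀)) (𝓝 (fixedXi v y₀, y₀)) :=
        (by fun_prop : Continuous fun ξ : ℝ => (ξ, y₀)).tendsto _
      have h1 : HasDerivAt (fun ξ => (ellAt v (-y₀) +
          (ξ - ellAt v y₀) * Real.exp (2 * halfTimePlus y₀)) * Real.exp (2 * halfTimeMinus y₀))
          (Real.exp (2 * halfTimePlus y₀) * Real.exp (2 * halfTimeMinus y₀)) (fixedXi v y₀) := by
        have h2 := ((((hasDerivAt_id (fixedXi v y₀)).sub_const (ellAt v y₀)).mul_const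
          (Real.exp (2 * halfTimePlus y₀))).const_add (ellAt v (-y₀))).mul_const
            (Real.exp (2 * halfTimeMinus y₀))
        exact h2.congr_deriv (by ring)
      refine h1.congr_of_eventuallyEq ?_
      filter_upwards [hξ.eventually hP0] with ξ hq
      rw [hq])
    (one_lt_exp_mul_exp hy0)
    (by
      filter_upwards [lt_mem_nhds hy₀, hXline'.eventually (hτ.eventually (by simp)),
        hXline.eventually hτ0, ((hline _).comp hLline).eventually (hτ'.eventually (by simp)),
        hLline.eventually hτ'0, hXline'.eventually hturn.eventually_nhds,
        ((hline _).comp hLline).eventually hturn'.eventually_nhds] with y h1 h2 h3 h4 h5 h6 h7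
      exact hasDerivAt_returnMap hψ hψ' h1 h2 h3 h4 (by rw [h5, neg_neg]) h6 h7)
    h0 hμ' hμ'0
  have hpline : Tendsto (fun ε => (ε, p ε)) (𝓝[≠] 0) (𝓝 (0, (fixedXi v y₀, y₀))) :=
    (tendsto_id.mono_left nhdsWithin_le_nhds).prodMk_nhds hp
  have hτpos : 0 < τ (0, (fixedXi v y₀, y₀)) := hturn.self_of_nhds.pos
  have hgood : ∀ᶠ e in 𝓝 (0, (fixedXi v y₀, y₀)),
      GoodPlus c d v ψ τ (τ (0, (fixedXi v y₀, y₀)) / 2) e := by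
    have hlie : ∀ᶠ e in 𝓝 ((0 : ℝ), (fixedXi v y₀, y₀)),
        0 < scaledLie c d (scaledMinus v) e.1 (sigmaPoint c d e) := by
      refine continuous_scaledLie_minus.continuousAt.eventually (lt_mem_nhds ?_)
      simp only
      rw [scaledLie_minus_zero]
      simp [sigmaPoint]
      have : 1 < 2 * y₀ ^ 2 := by nlinarith
      nlinarith
    filter_upwards [hturn, hτ.continuousAt.eventually (lt_mem_nhds (half_lt_self hτpos)), hlie]
      with e h1 h2 h3
    exact ⟨h1, h2.le, h3⟩
  have hgood' : ∀ᶠ e in 𝓝 (0, (leftXi v y₀, -y₀)), GoodMinus c d v ψ' τ' e := by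
    have hlie : ∀ᶠ e in 𝓝 ((0 : ℝ), (leftXi v y₀, -y₀)),
        scaledLie c d (scaledPlus v) e.1 (sigmaPoint c d e) < 0 := by
      refine continuous_scaledLie_plus.continuousAt.eventually (gt_mem_nhds ?_)
      simp only
      rw [scaledLie_plus_zero]
      simp [sigmaPoint]
      positivity
    filter_upwards [hturn', hlie] with e h1 h2
    exact ⟨h1, h2⟩
  have hEp : Tendsto (fun ε => halfTurnEnd c d ψ τ (ε, p ε)) (𝓝[≠] 0)
      (𝓝 (0, (leftXi v y₀, -y₀))) := by
    rw [← hEbase]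
    exact hEc.continuousAt.tendsto.comp hpline
  -- On the unperturbed `+` arc `z ≥ y² ≥ 0`, hence `y' = -z - 1 < 0`; by compactness of the arc
  -- this persists nearby.
  have hdec : ∀ᶠ e in 𝓝 ((0 : ℝ), (fixedXi v y₀, y₀)), ∀ s ∈ Icc (0 : ℝ) 1,
      scaledPlus v e.1 (ψ (e.1, sigmaPoint c d e, s * τ e)) 1 < 0 := by
    refine isCompact_Icc.eventually_forall_of_forall_eventually fun s hs => ?_
    have h1 := continuousAt_flow_sigmaPoint (c := c) (d := d) hψ.contDiff.continuous
      hτ.continuousAt s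
    have h2 := continuousAt_pi.1 h1
    have h3 : ContinuousAt (fun a : (ℝ × (ℝ × ℝ)) × ℝ =>
        scaledPlus v a.1.1 (ψ (a.1.1, sigmaPoint c d a.1, a.2 * τ a.1)) 1)
        ((0, (fixedXi v y₀, y₀)), s) := by
      have h21 := h2 1
      have h22 := h2 2
      have key : ∀ f₁ f₂ : (ℝ × (ℝ × ℝ)) × ℝ → ℝ, ContinuousAt f₁ ((0, (fixedXi v y₀, y₀)), s) →
          ContinuousAt f₂ ((0, (fixedXi v y₀, y₀)), s) →
          ContinuousAt (fun a => -f₂ a - 1 + a.1.1 * (v 5 * f₁ a))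
            ((0, (fixedXi v y₀, y₀)), s) := by
        intro f₁ f₂ h₁ h₂
        fun_prop
      exact key _ _ h21 h22
    refine h3.eventually (gt_mem_nhds ?_)
    have hτs : 0 ≤ s * τ (0, (fixedXi v y₀, y₀)) := mul_nonneg hs.1 hτpos.le
    have hz : -1 < circlePlus y₀ (s * τ (0, (fixedXi v y₀, y₀))) 2 := by
      rw [hτ0.self_of_nhds]
      have A := isTwoArc_unperturbed c d hy₀
      have hσ := A.σ_pos
      have := A.α_nonneg (t := s * (2 * halfTimePlus y₀))
        ⟨mul_nonneg hs.1 hσ.le, by nlinarith [hs.2]⟩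
      simp only [unperturbedSystem, switchingFunction] at this
      have h0 : circlePlus y₀ (s * (2 * halfTimePlus y₀)) 0 = 0 := by simp [circlePlus]
      rw [h0] at this
      simp only
      nlinarith [sq_nonneg (circlePlus y₀ (s * (2 * halfTimePlus y₀)) 1)]
    simp only
    rw [flowPlus_zero hψ c d _ _ hτs]
    simp [scaledPlus]
    linarith
  have hsmall : ∀ᶠ ε : ℝ in 𝓝[≠] 0, ε ^ 2 * (v 6 ^ 2 + |v 7 * v 6|) < 1 := by
    have : Continuous fun ε : ℝ => ε ^ 2 * (v 6 ^ 2 + |v 7 * v 6|) := by fun_prop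
    exact (this.tendsto' 0 0 (by simp) |>.mono_left nhdsWithin_le_nhds).eventually
      (gt_mem_nhds one_pos)
  refine ⟨fun ε => familyOrbit c d ψ ψ' τ τ' (ε, p ε), ?_, ?_⟩
  · filter_upwards [hpe, hpline.eventually hgood.eventually_nhds,
      hEp.eventually hgood'.eventually_nhds, hpline.eventually hdec, hsmall, self_mem_nhdsWithin]
      with ε h1 h2 h3 h4 h5 h6
    have hτp : 0 < τ (ε, p ε) := h2.self_of_nhds.1.pos
    refine familyOrbit_isLimitCycle hψ hψ' h6 h5 (half_pos hτpos) ?_ h2 h3 (fun s hs => ?_) h1.2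
    · exact Prod.ext rfl h1.1
    · have := h4 (s / τ (ε, p ε)) ⟨div_nonneg hs.1 hτp.le, (div_le_one hτp).2 hs.2⟩
      simp only [div_mul_cancel₀ _ hτp.ne'] at this
      exact this
  · have h := tendsto_familyOrbit (c := c) (d := d) hpline hψ.contDiff.continuous
      hψ'.contDiff.continuous hτ.continuousAt hEc.continuousAt (τ' := τ')
      (by rw [hEbase]; exact hτ'.continuousAt) hτpos
      (by rw [hEbase]; exact hturn'.self_of_nhds.pos)
    have hbase : familyOrbit c d ψ ψ' τ τ' (0, (fixedXi v y₀, y₀)) = unperturbedOrbit y₀ := by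
      have e1 : τ (0, (fixedXi v y₀, y₀)) = 2 * halfTimePlus y₀ := hτ0.self_of_nhds
      have e2 : τ' (0, (leftXi v y₀, -y₀)) = 2 * halfTimeMinus y₀ := by
        rw [hτ'0.self_of_nhds, neg_neg]
      rw [familyOrbit, unperturbedOrbit, PiecewiseSystem.arcs, PiecewiseSystem.arcs, hEbase, e1, e2]
      congr 1
      · refine image_congr fun t ht => ?_
        simp only
        rw [flowPlus_zero hψ c d _ _ ht.1, unscale_zero_circlePlus]
      · refine image_congr fun t ht => ?_
        simp only
        rw [flowMinus_zero hψ' c d _ _ ht.1, unscale_zero_circleMinus]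
    rw [← hbase]
    exact h

/-! ### Analytic continuation of the Melnikov function -/

section Kernel

/-- The polynomial part of `melnikovKernel`. -/
def kernelPoly (v : Fin 8 → ℝ) (y : ℝ) : ℝ :=
  (2 * y ^ 2 - 1) * (2 * v 3 + (v 4 - v 5) * (y ^ 2 + 1)) * y +
    (2 * y ^ 2 + 3) * (-2 * v 6 + v 7 * (y ^ 2 - 1)) * y +
    (v 0 + v 2 * y ^ 2) * (1 - 2 * y ^ 2) * y + v 1 * y * (2 * y ^ 4 + y ^ 2 - 1)

/-- The Melnikov function up to a factor, as a function of `y` and of the half times `a`, `b`,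
with `κ = 2 - 2 c`. -/
noncomputable def melnikovKernel (κ : ℝ) (v : Fin 8 → ℝ) (y a b : ℝ) : ℝ :=
  Real.sinh (a + b) * (kernelPoly v y + (v 4 + v 5) * (2 * y ^ 2 - 1) * radSqPlus y * a +
    v 7 * (2 * y ^ 2 + 3) * radSqMinus y * b) -
  2 * ((v 0 + v 2 * y ^ 2) * Real.sinh a + v 1 * y * Real.cosh a) *
    (Real.sinh b + κ * y * Real.cosh b)

set_option maxRecDepth 20000 in
-- The denominator of `fixedXi` is `1 - exp (2 (a + b)) = -2 exp (a + b) sinh (a + b)`, which the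
-- factor `sinh (a + b)` cancels.
theorem melnikov_numerator_mul_sinh (c : ℝ) (v : Fin 8 → ℝ) {y : ℝ} (hy : 0 < y) :
    ((2 * y ^ 2 - 1) * energyPlus v y + (2 * y ^ 2 + 3) * energyMinus v y +
      4 * c * y * (fixedXi v y + leftXi v y)) * Real.sinh (halfTimePlus y + halfTimeMinus y) =
    2 * melnikovKernel (2 - 2 * c) v y (halfTimePlus y) (halfTimeMinus y) := by
  have h1 := one_lt_exp_mul_exp hy
  have h2 : 1 - Real.exp (2 * halfTimePlus y) * Real.exp (2 * halfTimeMinus y) ≠ 0 := by linarith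
  have hξ : fixedXi v y * (1 - Real.exp (2 * halfTimePlus y) * Real.exp (2 * halfTimeMinus y)) =
      Real.exp (2 * halfTimeMinus y) *
        (ellAt v (-y) - ellAt v y * Real.exp (2 * halfTimePlus y)) := div_mul_cancel₀ _ h2
  unfold melnikovKernel energyPlus energyMinus leftXi kernelPoly radSqPlus radSqMinus
  unfold ellAt at hξ ⊢
  generalize fixedXi v y = ξ at *
  generalize halfTimePlus y = a at *
  generalize halfTimeMinus y = b at *
  have ea : Real.exp (2 * a) = Real.exp a ^ 2 := by rw [← Real.exp_nat_mul]; norm_num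
  have eb : Real.exp (2 * b) = Real.exp b ^ 2 := by rw [← Real.exp_nat_mul]; norm_num
  clear h1 h2
  rw [ea, eb] at hξ ⊢
  have hx : Real.exp a ≠ 0 := (Real.exp_pos a).ne'
  have hz : Real.exp b ≠ 0 := (Real.exp_pos b).ne'
  have hsab : Real.sinh (a + b) =
      (Real.exp a ^ 2 * Real.exp b ^ 2 - 1) / (2 * Real.exp a * Real.exp b) := by
    rw [Real.sinh_eq, Real.exp_neg, Real.exp_add]; field_simp
  have hsa : Real.sinh a = (Real.exp a ^ 2 - 1) / (2 * Real.exp a) := by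
    rw [Real.sinh_eq, Real.exp_neg]; field_simp
  have hsb : Real.sinh b = (Real.exp b ^ 2 - 1) / (2 * Real.exp b) := by
    rw [Real.sinh_eq, Real.exp_neg]; field_simp
  have hca : Real.cosh a = (Real.exp a ^ 2 + 1) / (2 * Real.exp a) := by
    rw [Real.cosh_eq, Real.exp_neg]; field_simp
  have hcb : Real.cosh b = (Real.exp b ^ 2 + 1) / (2 * Real.exp b) := by
    rw [Real.cosh_eq, Real.exp_neg]; field_simp
  rw [hsab, hsa, hsb, hca, hcb]
  generalize Real.exp a = x at *
  generalize Real.exp b = z at *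
  -- In terms of `x = exp a` and `z = exp b` the denominators of the hyperbolic functions cancel,
  -- and what remains is a polynomial multiple of the fixed point equation `hξ`.
  have key : ∀ M K W₀ W₁ : ℝ, M * (x ^ 2 * z ^ 2 - 1) = 2 * (x ^ 2 * z ^ 2 - 1) * K -
      2 * (W₀ * (x ^ 2 - 1) + W₁ * (x ^ 2 + 1)) *
        (z ^ 2 - 1 + (2 - 2 * c) * y * (z ^ 2 + 1)) →
      M * ((x ^ 2 * z ^ 2 - 1) / (2 * x * z)) = 2 * ((x ^ 2 * z ^ 2 - 1) / (2 * x * z) * K -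
        2 * (W₀ * ((x ^ 2 - 1) / (2 * x)) + W₁ * ((x ^ 2 + 1) / (2 * x))) *
        ((z ^ 2 - 1) / (2 * z) + (2 - 2 * c) * y * ((z ^ 2 + 1) / (2 * z)))) := by
    intro M K W₀ W₁ hM
    field_simp
    linear_combination hM
  apply key
  linear_combination (-((2 * y ^ 2 - 1) * (x ^ 2 * (y ^ 2 + 1 + y) - (y ^ 2 + 1 - y)) +
    (2 * y ^ 2 + 3) * x ^ 2 * (z ^ 2 * (y ^ 2 - 1 - y) - (y ^ 2 - 1 + y)) +
    4 * c * y * (1 + x ^ 2))) * hξ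

theorem melnikovKernel_eq_zero (c : ℝ) (v : Fin 8 → ℝ) {y : ℝ} (hy : 1 < y)
    (h : melnikov c v y = 0) :
    melnikovKernel (2 - 2 * c) v y (halfTimePlus y) (halfTimeMinus y) = 0 := by
  have h1 := melnikov_numerator_mul_sinh c v (y := y) (by linarith)
  have h4 : 2 * y * (2 * y ^ 2 - 1) * (2 * y ^ 2 + 3) ≠ 0 := by
    have : 0 < 2 * y ^ 2 - 1 := by nlinarith
    positivity
  rw [melnikov, div_eq_zero_iff, or_iff_left h4] at h
  rw [h, zero_mul] at h1
  linarith

/-- `melnikovKernel` in homogeneous coordinates `y = S / C`, cleared of denominators. -/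
noncomputable def homogeneousKernel (κ : ℝ) (v : Fin 8 → ℝ) (S C a b : ℝ) : ℝ :=
  Real.sinh (a + b) * (C * ((2 * S ^ 2 - C ^ 2) * (2 * v 3 * C ^ 2 +
      (v 4 - v 5) * (S ^ 2 + C ^ 2)) * S +
    (2 * S ^ 2 + 3 * C ^ 2) * (-2 * v 6 * C ^ 2 + v 7 * (S ^ 2 - C ^ 2)) * S +
    (v 0 * C ^ 2 + v 2 * S ^ 2) * (C ^ 2 - 2 * S ^ 2) * S +
    v 1 * S * (2 * S ^ 4 + S ^ 2 * C ^ 2 - C ^ 4)) +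
    (v 4 + v 5) * (2 * S ^ 2 - C ^ 2) * (S ^ 2 * C ^ 2 + (S ^ 2 + C ^ 2) ^ 2) * a +
    v 7 * (2 * S ^ 2 + 3 * C ^ 2) * (S ^ 2 * C ^ 2 + (S ^ 2 - C ^ 2) ^ 2) * b) -
  2 * C ^ 3 * ((v 0 * C ^ 2 + v 2 * S ^ 2) * Real.sinh a + v 1 * S * C * Real.cosh a) *
    (C * Real.sinh b + κ * S * Real.cosh b)

/-- Degree six clears all denominators of `y = S / C`. With `S = sin θ` and `C = cos θ` the kernel
thus continues through `θ = π / 2`, where `y` is infinite. -/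
theorem homogeneousKernel_eq (κ : ℝ) (v : Fin 8 → ℝ) {S C : ℝ} (hC : C ≠ 0) (a b : ℝ) :
    homogeneousKernel κ v S C a b = C ^ 6 * melnikovKernel κ v (S / C) a b := by
  unfold homogeneousKernel melnikovKernel kernelPoly radSqPlus radSqMinus
  field_simp

/-- The analytic continuation of the half time of the `-` field as a function of the angle `θ`
with `y = tan θ`. -/
noncomputable def angleMinus (θ : ℝ) : ℝ :=
  2 * θ - Real.arctan (Real.sin (2 * θ) * Real.cos (2 * θ) / (1 + Real.cos (2 * θ) ^ 2))

theorem halfTimePlus_tan {θ : ℝ} (h : Real.cos θ ≠ 0) :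
    halfTimePlus (Real.tan θ) = Real.arctan (Real.sin (2 * θ) / 2) := by
  rw [halfTimePlus, Real.tan_eq_sin_div_cos, Real.sin_two_mul]
  congr 1
  have := Real.sin_sq_add_cos_sq θ
  field_simp
  rw [this, mul_one]

/-- With `w = 2 θ - π / 2` and `t = tan w` one has `(y² - 1) / y = 2 t`, and `arctan (2 t) = w +
arctan (t / (1 + 2 t²))`. The last term is periodic and analytic in `θ` on the whole line. -/
theorem halfTimeMinus_tan {θ : ℝ} (h0 : 0 < θ) (h1 : θ < Real.pi / 2) :
    halfTimeMinus (Real.tan θ) = angleMinus θ := by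
  set w := 2 * θ - Real.pi / 2 with hw
  have hs : 0 < Real.sin θ := Real.sin_pos_of_pos_of_lt_pi h0 (by linarith [Real.pi_pos])
  have hc : 0 < Real.cos θ := Real.cos_pos_of_mem_Ioo ⟨by linarith, h1⟩
  have hsw : Real.sin (2 * θ) = Real.cos w := by rw [hw, Real.cos_sub_pi_div_two]
  have hcw : Real.cos (2 * θ) = -Real.sin w := by rw [hw, Real.sin_sub_pi_div_two, neg_neg]
  have hcos : 0 < Real.cos w := Real.cos_pos_of_mem_Ioo ⟨by linarith, by linarith⟩
  have hone := Real.sin_sq_add_cos_sq w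
  have hone' := Real.sin_sq_add_cos_sq θ
  set t := Real.tan w with ht
  have htw : Real.arctan t = w := Real.arctan_tan (by linarith) (by linarith)
  have hq : Real.sin (2 * θ) * Real.cos (2 * θ) / (1 + Real.cos (2 * θ) ^ 2) =
      -(t / (1 + 2 * t ^ 2)) := by
    rw [hsw, hcw, ht, Real.tan_eq_sin_div_cos]
    have e1 : 1 + (-Real.sin w) ^ 2 = Real.cos w ^ 2 + 2 * Real.sin w ^ 2 := by
      rw [← hone]; ring
    rw [e1]
    field_simp
  have ht2 : (Real.tan θ ^ 2 - 1) / Real.tan θ = 2 * t := by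
    rw [ht, Real.tan_eq_sin_div_cos w, ← hsw, show Real.sin w = -Real.cos (2 * θ) by
      rw [hcw, neg_neg], Real.sin_two_mul, Real.cos_two_mul', Real.tan_eq_sin_div_cos]
    field_simp
    ring
  have hadd : Real.arctan t + Real.arctan (t / (1 + 2 * t ^ 2)) = Real.arctan (2 * t) := by
    have hpos : 0 < 1 + 2 * t ^ 2 := by positivity
    rw [Real.arctan_add]
    · congr 1
      have : 1 - t * (t / (1 + 2 * t ^ 2)) = (1 + t ^ 2) / (1 + 2 * t ^ 2) := by
        field_simp; ring
      rw [this]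
      have h2 : 1 + t ^ 2 ≠ 0 := by positivity
      field_simp
      ring
    · rw [mul_div_assoc', div_lt_one hpos]
      nlinarith [sq_nonneg t]
  rw [halfTimeMinus, ht2, angleMinus, hq, Real.arctan_neg, ← hadd, htw, hw]
  ring

open scoped ContDiff in
theorem contDiff_angleMinus : ContDiff ℝ ω angleMinus := by
  refine (contDiff_const.mul contDiff_id).sub (Real.contDiff_arctan.comp (ContDiff.div ?_ ?_ fun x => ?_))
  · exact (Real.contDiff_sin.comp (contDiff_const.mul contDiff_id)).mul
      (Real.contDiff_cos.comp (contDiff_const.mul contDiff_id))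
  · exact contDiff_const.add ((Real.contDiff_cos.comp (contDiff_const.mul contDiff_id)).pow 2)
  · positivity

/-- This is the monodromy: `θ + π` gives the same `tan θ` and the same `+` half time, but another
branch of the `-` half time. -/
theorem angleMinus_add (θ : ℝ) (k : ℕ) :
    angleMinus (θ + k * Real.pi) = angleMinus θ + 2 * Real.pi * k := by
  unfold angleMinus
  rw [show 2 * (θ + k * Real.pi) = 2 * θ + k * (2 * Real.pi) by ring,
    Real.sin_add_nat_mul_two_pi, Real.cos_add_nat_mul_two_pi]
  ring

open scoped ContDiff in
theorem contDiff_homogeneousKernel_comp (κ : ℝ) (v : Fin 8 → ℝ) {S C a b : ℝ → ℝ}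
    (hS : ContDiff ℝ ω S) (hC : ContDiff ℝ ω C) (ha : ContDiff ℝ ω a) (hb : ContDiff ℝ ω b) :
    ContDiff ℝ ω fun θ => homogeneousKernel κ v (S θ) (C θ) (a θ) (b θ) := by
  have h1 := (ha.add hb).sinh
  have h2 := ha.sinh
  have h3 := ha.cosh
  have h4 := hb.sinh
  have h5 := hb.cosh
  unfold homogeneousKernel
  fun_prop

/-- If the Melnikov function vanishes identically, then its kernel vanishes, also for all the
values of the half time of the `-` field that are obtained by analytic continuation. -/
theorem melnikovKernel_eq_zero_of_forall (c : ℝ) (v : Fin 8 → ℝ)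
    (h : ∀ y, 1 < y → melnikov c v y = 0) {y : ℝ} (hy : 0 < y) (k : ℕ) :
    melnikovKernel (2 - 2 * c) v y (halfTimePlus y) (halfTimeMinus y + 2 * Real.pi * k) = 0 := by
  let Φ : ℝ → ℝ := fun θ => homogeneousKernel (2 - 2 * c) v (Real.sin θ) (Real.cos θ)
    (Real.arctan (Real.sin (2 * θ) / 2)) (angleMinus θ)
  have hpi := Real.pi_pos
  have hΦ : AnalyticOnNhd ℝ Φ univ := by
    rw [← contDiff_omega_iff_analyticOnNhd]
    refine contDiff_homogeneousKernel_comp _ _ Real.contDiff_sin Real.contDiff_cos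
      (Real.contDiff_arctan.comp ?_) contDiff_angleMinus
    exact (Real.contDiff_sin.comp (contDiff_const.mul contDiff_id)).div_const 2
  -- Any `θ` in `(π / 4, π / 2)` would do, since `tan θ > 1` there; `3 π / 8` is the midpoint.
  have hev : Φ =ᶠ[𝓝 (3 * Real.pi / 8)] 0 := by
    filter_upwards [Ioo_mem_nhds (show Real.pi / 4 < 3 * Real.pi / 8 by linarith)
      (show 3 * Real.pi / 8 < Real.pi / 2 by linarith)] with θ hθ
    have hc : 0 < Real.cos θ := Real.cos_pos_of_mem_Ioo ⟨by linarith [hθ.1], hθ.2⟩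
    have h1 : 1 < Real.tan θ := by
      rw [← Real.tan_pi_div_four]
      exact Real.tan_lt_tan_of_lt_of_lt_pi_div_two (by linarith) hθ.2 hθ.1
    have h2 := melnikovKernel_eq_zero c v h1 (h _ h1)
    simp only [Φ, Pi.zero_apply]
    rw [homogeneousKernel_eq _ _ hc.ne', ← Real.tan_eq_sin_div_cos, ← halfTimePlus_tan hc.ne',
      ← halfTimeMinus_tan (by linarith [hθ.1]) hθ.2, h2, mul_zero]
  have hzero := hΦ.eqOn_zero_of_preconnected_of_eventuallyEq_zero isPreconnected_univ
    (mem_univ _) hev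
  have h0 : 0 < Real.arctan y := Real.arctan_pos.2 hy
  have h1 : Real.arctan y < Real.pi / 2 := Real.arctan_lt_pi_div_two y
  set θ := Real.arctan y with hθ
  have hty : Real.tan θ = y := Real.tan_arctan y
  have hc : 0 < Real.cos θ := Real.cos_arctan_pos y
  have hc' : Real.cos (θ + k * Real.pi) ≠ 0 := by
    rw [Real.cos_add_nat_mul_pi]
    exact mul_ne_zero (pow_ne_zero _ (by norm_num)) hc.ne'
  have hz : Φ (θ + k * Real.pi) = 0 := hzero (mem_univ _)
  simp only [Φ] at hz
  rw [homogeneousKernel_eq _ _ hc', ← Real.tan_eq_sin_div_cos, Real.tan_add_nat_mul_pi, hty,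
    angleMinus_add, ← halfTimeMinus_tan h0 h1, hty,
    show 2 * (θ + k * Real.pi) = 2 * θ + k * (2 * Real.pi) by ring, Real.sin_add_nat_mul_two_pi,
    ← halfTimePlus_tan hc.ne', hty] at hz
  exact (mul_eq_zero.1 hz).resolve_left (pow_ne_zero _ hc')

end Kernel

/-! ### Linear independence of the eight Melnikov functions -/

section Independence

/-- Division by `r ^ k` shows that `α + β k` tends to `0`; its increments are `β`, so both
coefficients vanish, and `k = 0` gives `γ`. -/
theorem eq_zero_of_pow_mul_eq {r α β γ δ : ℝ} (hr : 1 < r)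
    (h : ∀ k : ℕ, r ^ k * (α + β * k) = γ + δ * k) : α = 0 ∧ β = 0 ∧ γ = 0 := by
  have hr0 : ∀ k : ℕ, r ^ k ≠ 0 := fun k => pow_ne_zero _ (by linarith)
  have h0 := tendsto_pow_const_div_const_pow_of_one_lt 0 hr
  have h1 := tendsto_pow_const_div_const_pow_of_one_lt 1 hr
  have hlim : Tendsto (fun k : ℕ => α + β * k) atTop (𝓝 0) := by
    have := (h0.const_mul γ).add (h1.const_mul δ)
    simp only [mul_zero, add_zero] at this
    refine this.congr fun k => ?_
    have := h k
    have := hr0 k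
    field_simp
    linarith
  have hβ : β = 0 := by
    have h2 := ((tendsto_add_atTop_iff_nat 1).2 hlim).sub hlim
    have h3 : (fun k : ℕ => α + β * ((k + 1 : ℕ) : ℝ) - (α + β * k)) = fun _ => β := by
      funext k; push_cast; ring
    rw [h3, sub_zero] at h2
    exact tendsto_nhds_unique tendsto_const_nhds h2
  have hα : α = 0 := by
    rw [hβ] at hlim
    simp only [zero_mul, add_zero] at hlim
    exact tendsto_nhds_unique tendsto_const_nhds hlim
  refine ⟨hα, hβ, ?_⟩
  have := h 0
  simp [hα] at this
  exact this.symm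

theorem deriv_eq_zero_of_eq_zero_of_pos {f : ℝ → ℝ} {f' : ℝ} (hf : HasDerivAt f f' 0)
    (h0 : f 0 = 0) (h : ∀ y, 0 < y → f y = 0) : f' = 0 := by
  have h1 : HasDerivWithinAt f 0 (Ici 0) 0 := by
    refine (hasDerivWithinAt_const (0 : ℝ) (Ici 0) (0 : ℝ)).congr (fun y hy => ?_) h0
    rcases eq_or_lt_of_le (show (0 : ℝ) ≤ y from hy) with rfl | hy
    · exact h0
    · exact h y hy
  exact (uniqueDiffWithinAt_Ici (0 : ℝ)).eq_deriv _ hf.hasDerivWithinAt h1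

theorem sinh_lt_mul_cosh {a : ℝ} (ha : 0 < a) : Real.sinh a < a * Real.cosh a := by
  have hd : ∀ x, HasDerivAt (fun x => x * Real.cosh x - Real.sinh x) (x * Real.sinh x) x := by
    intro x
    exact (((hasDerivAt_id x).mul (Real.hasDerivAt_cosh x)).sub (Real.hasDerivAt_sinh x)).congr_deriv
      (by simp)
  have hmono : StrictMonoOn (fun x => x * Real.cosh x - Real.sinh x) (Ici 0) := by
    refine strictMonoOn_of_deriv_pos (convex_Ici 0)
      (fun x _ => (hd x).continuousAt.continuousWithinAt) fun x hx => ?_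
    rw [interior_Ici] at hx
    rw [(hd x).deriv]
    exact mul_pos hx (Real.sinh_pos_iff.2 hx)
  have := hmono (mem_Ici.2 le_rfl) (mem_Ici.2 ha.le) ha
  simp only [zero_mul, Real.sinh_zero, sub_zero] at this
  linarith

theorem halfTimePlus_lt_div {y : ℝ} (hy : 0 < y) : halfTimePlus y < y / (y ^ 2 + 1) := by
  have h := Real.lt_tan (halfTimePlus_pos hy) (Real.arctan_lt_pi_div_two _)
  rwa [halfTimePlus, Real.tan_arctan] at h

theorem halfTimePlus_lt_self {y : ℝ} (hy : 0 < y) : halfTimePlus y < y := by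
  refine (halfTimePlus_lt_div hy).trans_le (div_le_self hy.le ?_)
  nlinarith [sq_nonneg y]

/-- The half time depends on `y / (y² + 1)` only, which is invariant under `y ↦ 1 / y`. Evaluating a
relation at `2` and at `1 / 2` allows its transcendental terms to be eliminated. -/
theorem halfTimePlus_two_eq : halfTimePlus 2 = halfTimePlus (1 / 2) := by
  unfold halfTimePlus
  norm_num

theorem hasDerivAt_halfTimePlus_zero : HasDerivAt halfTimePlus 1 0 := by
  have h := ((hasDerivAt_id (0 : ℝ)).div (((hasDerivAt_id (0 : ℝ)).pow 2).add_const 1)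
    (by simp)).arctan
  refine h.congr_deriv ?_
  simp

/-- The doubled angle of `arctan (1 / 2)` has sine `4 / 5`, and a positive angle exceeds its sine.
The bound serves to show `v 5 = 0`. -/
theorem two_fifths_lt_halfTimePlus_one : 2 / 5 < halfTimePlus 1 := by
  have h1 : halfTimePlus 1 = Real.arctan (1 / 2) := by unfold halfTimePlus; norm_num
  have h2 : Real.sin (2 * halfTimePlus 1) = 4 / 5 := by
    rw [h1, Real.sin_two_mul, Real.sin_arctan, Real.cos_arctan]
    have h3 : √(1 + (1 / 2 : ℝ) ^ 2) ≠ 0 := (Real.sqrt_pos.2 (by norm_num)).ne'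
    have h4 : √(1 + (1 / 2 : ℝ) ^ 2) ^ 2 = 1 + (1 / 2) ^ 2 := Real.sq_sqrt (by norm_num)
    have h5 : ∀ s : ℝ, s ≠ 0 → 2 * (1 / 2 / s) * (1 / s) = 1 / s ^ 2 := fun s hs => by field_simp
    rw [h5 _ h3, h4]
    norm_num
  have h5 := Real.sin_lt (x := 2 * halfTimePlus 1) (by linarith [halfTimePlus_pos one_pos])
  linarith

variable {κ : ℝ} {v : Fin 8 → ℝ}

/-- Each `k` gives an equation between `exp (2 π k)`, its inverse and terms linear in `k`.
Multiplied by `exp (2 π k)` it has the form treated in `eq_zero_of_pow_mul_eq`: the coefficient `β`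
gives the claim on `v 7`, and `α` and `γ` give the two relations between `N` and `V`. -/
theorem kernel_coefficients {y a b : ℝ}
    (h : ∀ k : ℕ, melnikovKernel κ v y a (b + 2 * Real.pi * k) = 0) :
    v 7 * (2 * y ^ 2 + 3) * radSqMinus y = 0 ∧
      (v 7 = 0 → ∃ N V : ℝ, N = kernelPoly v y + (v 4 + v 5) * (2 * y ^ 2 - 1) * radSqPlus y * a ∧
        V = (v 0 + v 2 * y ^ 2) * Real.sinh a + v 1 * y * Real.cosh a ∧
        Real.exp a * N = 2 * V * (1 + κ * y) ∧ N = 2 * V * (1 - κ * y) * Real.exp a) := by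
  set g := v 7 * (2 * y ^ 2 + 3) * radSqMinus y with hg
  set N := kernelPoly v y + (v 4 + v 5) * (2 * y ^ 2 - 1) * radSqPlus y * a with hN
  set V := (v 0 + v 2 * y ^ 2) * Real.sinh a + v 1 * y * Real.cosh a with hV
  have hx : 0 < Real.exp a := Real.exp_pos a
  have hz : 0 < Real.exp b := Real.exp_pos b
  set x := Real.exp a with hxdef
  set z := Real.exp b with hzdef
  have hr : 1 < Real.exp (2 * Real.pi) := Real.one_lt_exp_iff.2 (by linarith [Real.pi_pos])
  have hr2 : 1 < Real.exp (2 * Real.pi) ^ 2 := by nlinarith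
  have key : ∀ k : ℕ, (Real.exp (2 * Real.pi) ^ 2) ^ k *
      ((x * z * (N + g * b) - 2 * V * z * (1 + κ * y)) + 2 * Real.pi * g * x * z * k) =
      ((N + g * b) / (x * z) - 2 * V * (1 - κ * y) / z) + 2 * Real.pi * g / (x * z) * k := by
    intro k
    have hk := h k
    unfold melnikovKernel at hk
    rw [← hN, ← hV, ← hg] at hk
    have hR : Real.exp (2 * Real.pi * k) = Real.exp (2 * Real.pi) ^ k := by
      rw [mul_comm, Real.exp_nat_mul]
    have hRpos : 0 < Real.exp (2 * Real.pi) ^ k := pow_pos (by linarith) k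
    rw [Real.sinh_eq (a + _), Real.sinh_eq (b + _), Real.cosh_eq (b + _), Real.exp_neg,
      Real.exp_neg, Real.exp_add, Real.exp_add, hR, ← hxdef, ← hzdef] at hk
    rw [← pow_mul, mul_comm 2 k, pow_mul]
    generalize Real.exp (2 * Real.pi) ^ k = R at *
    field_simp at hk ⊢
    linear_combination hk
  obtain ⟨h1, h2, h3⟩ := eq_zero_of_pow_mul_eq hr2 key
  have hg0 : g = 0 := by
    have : 2 * Real.pi * x * z ≠ 0 := by positivity
    have h4 : g * (2 * Real.pi * x * z) = 0 := by linear_combination h2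
    exact (mul_eq_zero.1 h4).resolve_right this
  refine ⟨hg0, fun _ => ⟨N, V, rfl, rfl, ?_, ?_⟩⟩
  · rw [hg0] at h1
    have h4 : z * (x * N - 2 * V * (1 + κ * y)) = 0 := by linear_combination h1
    have := (mul_eq_zero.1 h4).resolve_left hz.ne'
    linarith
  · rw [hg0] at h3
    field_simp at h3
    linear_combination h3

theorem eq_zero_of_kernel (hκ : κ = 0 ∨ 1 ≤ κ)
    (h : ∀ y, 0 < y → ∀ k : ℕ,
      melnikovKernel κ v y (halfTimePlus y) (halfTimeMinus y + 2 * Real.pi * k) = 0) : v = 0 := by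
  have h7 : v 7 = 0 := by
    have h1 := (kernel_coefficients (h 1 one_pos)).1
    have h2 : radSqMinus 1 = 1 := by unfold radSqMinus; norm_num
    rw [h2] at h1
    linarith
  have hboth : ∀ y, 0 < y →
      kernelPoly v y + (v 4 + v 5) * (2 * y ^ 2 - 1) * radSqPlus y * halfTimePlus y = 0 ∧
      (v 0 + v 2 * y ^ 2) * Real.sinh (halfTimePlus y) + v 1 * y * Real.cosh (halfTimePlus y)
        = 0 := by
    intro y hy
    obtain ⟨N, V, hN, hV, h1, h2⟩ := (kernel_coefficients (h y hy)).2 h7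
    rw [← hN, ← hV]
    have ha := halfTimePlus_pos hy
    set a := halfTimePlus y
    have hx : 0 < Real.exp a := Real.exp_pos a
    -- Elimination of `N` from the two relations. The second factor is nonzero: for `κ ≥ 1` because
    -- `sinh a < a cosh a` and `a < y ≤ κ y`, for `κ = 0` because `sinh a > 0`.
    have h3 : V * (κ * y * Real.cosh a - Real.sinh a) = 0 := by
      rw [Real.cosh_eq, Real.sinh_eq, Real.exp_neg]
      field_simp
      linear_combination (1 / 2) * (-h1 + Real.exp a * h2)
    have h4 : κ * y * Real.cosh a - Real.sinh a ≠ 0 := by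
      rcases hκ with rfl | hκ
      · have := Real.sinh_pos_iff.2 ha
        simp only [zero_mul, zero_sub, ne_eq, neg_eq_zero]
        exact this.ne'
      · have h5 := sinh_lt_mul_cosh ha
        have h6 := Real.cosh_pos a
        have h7 : a < κ * y := lt_of_lt_of_le (halfTimePlus_lt_self hy) (by nlinarith)
        nlinarith
    have hV0 := (mul_eq_zero.1 h3).resolve_right h4
    rw [hV0] at h2 ⊢
    exact ⟨by rw [h2]; ring, rfl⟩
  have hV := fun y hy => (hboth y hy).2
  have hN := fun y hy => (hboth y hy).1
  have ha0 : halfTimePlus 0 = 0 := by simp [halfTimePlus]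
  have ha2 := halfTimePlus_pos two_pos
  have h02 : v 0 = v 2 := by
    have e1 := hV 2 two_pos
    have e2 := hV (1 / 2) (by norm_num)
    rw [← halfTimePlus_two_eq] at e2
    have h3 : (v 0 - v 2) * Real.sinh (halfTimePlus 2) = 0 := by
      linear_combination (4 / 3) * e2 - (1 / 3) * e1
    have := (mul_eq_zero.1 h3).resolve_right (Real.sinh_pos_iff.2 ha2).ne'
    linarith
  -- The derivative at `y = 0`, where `halfTimePlus` has slope `1`.
  have h01 : v 0 + v 1 = 0 := by
    refine deriv_eq_zero_of_eq_zero_of_pos (f := fun y => (v 0 + v 2 * y ^ 2) *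
      Real.sinh (halfTimePlus y) + v 1 * y * Real.cosh (halfTimePlus y)) ?_ (by simp [ha0]) hV
    have hs := (Real.hasDerivAt_sinh _).comp (0 : ℝ) hasDerivAt_halfTimePlus_zero
    have hc := (Real.hasDerivAt_cosh _).comp (0 : ℝ) hasDerivAt_halfTimePlus_zero
    have hp := (((hasDerivAt_id (0 : ℝ)).pow 2).const_mul (v 2)).const_add (v 0)
    refine ((hp.mul hs).add (((hasDerivAt_id (0 : ℝ)).const_mul (v 1)).mul hc)).congr_deriv ?_
    simp [ha0]
  have h0 : v 0 = 0 := by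
    have e1 := hV 1 one_pos
    have h3 := sinh_lt_mul_cosh (halfTimePlus_pos one_pos)
    have h4 := halfTimePlus_lt_div one_pos
    have h5 := Real.cosh_pos (halfTimePlus 1)
    have h6 : v 0 * (2 * Real.sinh (halfTimePlus 1) - Real.cosh (halfTimePlus 1)) = 0 := by
      rw [← h02, show v 1 = -v 0 by linarith] at e1
      linear_combination e1
    refine (mul_eq_zero.1 h6).resolve_right (ne_of_lt ?_)
    norm_num at h4
    nlinarith
  have h1 : v 1 = 0 := by linarith
  have h2 : v 2 = 0 := by linarith
  have hN' : ∀ y, 0 < y → (2 * y ^ 2 - 1) * ((2 * v 3 + (v 4 - v 5) * (y ^ 2 + 1)) * y +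
      (v 4 + v 5) * radSqPlus y * halfTimePlus y) - 2 * v 6 * (2 * y ^ 2 + 3) * y = 0 := by
    intro y hy
    have := hN y hy
    rw [kernelPoly, h0, h1, h2, h7] at this
    linear_combination this
  -- At `y² = 1 / 2` the factor `2 y² - 1` removes every other parameter.
  have h6 : v 6 = 0 := by
    have hs : 0 < √(1 / 2 : ℝ) := Real.sqrt_pos.2 (by norm_num)
    have hs2 : √(1 / 2 : ℝ) ^ 2 = 1 / 2 := Real.sq_sqrt (by norm_num)
    have := hN' _ hs
    rw [hs2] at this
    have h8 : v 6 * √(1 / 2 : ℝ) = 0 := by linear_combination (-1 / 8) * this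
    exact (mul_eq_zero.1 h8).resolve_right hs.ne'
  have h3 : v 3 = 0 := by
    have e1 := hN' 2 two_pos
    have e2 := hN' (1 / 2) (by norm_num)
    rw [← halfTimePlus_two_eq] at e2
    unfold radSqPlus at e1 e2
    rw [h6] at e1 e2
    linarith
  -- The slope at `y = 0` is `-(v 4 - v 5) - (v 4 + v 5) = -2 v 4`.
  have h4 : v 4 = 0 := by
    have hd : HasDerivAt (fun y : ℝ => (2 * y ^ 2 - 1) * (((v 4 - v 5) * (y ^ 2 + 1)) * y +
        (v 4 + v 5) * (y ^ 2 + (y ^ 2 + 1) ^ 2) * halfTimePlus y)) (-(2 * v 4)) 0 := by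
      have hq := (hasDerivAt_id (0 : ℝ)).pow 2
      have hA := ((hq.add_const 1).const_mul (v 4 - v 5)).mul (hasDerivAt_id (0 : ℝ))
      have hB := ((hq.add ((hq.add_const 1).pow 2)).const_mul (v 4 + v 5)).mul
        hasDerivAt_halfTimePlus_zero
      refine (((hq.const_mul 2).sub_const 1).mul (hA.add hB)).congr_deriv ?_
      simp [ha0]
      ring
    have := deriv_eq_zero_of_eq_zero_of_pos hd (by simp [ha0]) (fun y hy => by
      have := hN' y hy
      rw [h6, h3, radSqPlus] at this
      linear_combination this)
    linarith
  have h5 : v 5 = 0 := by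
    have e1 := hN' 1 one_pos
    have e2 := two_fifths_lt_halfTimePlus_one
    rw [h6, h3, h4, radSqPlus] at e1
    have h8 : v 5 * (5 * halfTimePlus 1 - 2) = 0 := by linear_combination e1
    exact (mul_eq_zero.1 h8).resolve_right (by linarith)
  ext i
  fin_cases i <;> assumption

theorem eq_zero_of_melnikov {c : ℝ} (hc : c ∈ ({-1, 0, 1} : Set ℝ))
    (h : ∀ y, 1 < y → melnikov c v y = 0) : v = 0 := by
  refine eq_zero_of_kernel (κ := 2 - 2 * c) ?_
    (fun y hy k => melnikovKernel_eq_zero_of_forall c v h hy k)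
  rcases hc with rfl | rfl | rfl
  · right; norm_num
  · right; norm_num
  · left; norm_num

end Independence

/-! ### Seven simple zeros -/

/-- Functionals without a common zero other than `0` span the dual space, so `n` of them form a
basis. Sorting the corresponding points gives the increasing sequence. -/
theorem exists_strictMono_interpolation {n : ℕ} {α : Type*} [LinearOrder α]
    (φ : α → (Fin n → ℝ) →ₗ[ℝ] ℝ) (s : Set α) (h : ∀ v ≠ 0, ∃ y ∈ s, φ y v ≠ 0) :
    ∃ y : Fin n → α, StrictMono y ∧ (∀ i, y i ∈ s) ∧ ∀ w : Fin n → ℝ, ∃ v, ∀ i, φ (y i) v = w i := by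
  classical
  have hspan : Submodule.span ℝ (φ '' s) = ⊤ := by
    refine Submodule.span_eq_top_of_ne_zero fun z hz => ?_
    obtain ⟨y, hy, hyz⟩ := h z hz
    exact ⟨φ y, mem_image_of_mem φ hy, hyz⟩
  let b := Module.Basis.ofSpan hspan.ge
  have hb : ∀ i, ∃ y ∈ s, φ y = b i := fun i =>
    Module.Basis.ofSpan_subset hspan.ge (mem_range_self i)
  choose y hys hyb using hb
  have hinj : Function.Injective y := fun i j hij => b.injective (by rw [← hyb, ← hyb, hij])
  have : Fintype _ := Module.Basis.fintypeIndexOfRankLtAleph0 b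
    (Module.rank_lt_aleph0 ℝ (Module.Dual ℝ (Fin n → ℝ)))
  have hcard : (Finset.univ.image y).card = n := by
    rw [Finset.card_image_of_injective _ hinj, Finset.card_univ,
      ← Module.finrank_eq_card_basis b]
    exact Subspace.dual_finrank_eq.trans (by simp)
  let e := (Finset.univ.image y).orderEmbOfFin hcard
  refine ⟨e, e.strictMono, fun i => ?_, fun w => ?_⟩
  · have := Finset.orderEmbOfFin_mem (Finset.univ.image y) hcard i
    obtain ⟨j, -, hj⟩ := Finset.mem_image.1 this
    show e i ∈ s
    rw [show e i = y j from hj.symm]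
    exact hys j
  · let L : (Fin n → ℝ) →ₗ[ℝ] (Fin n → ℝ) := LinearMap.pi fun i => φ (e i)
    have hL : Function.Injective L := by
      rw [injective_iff_map_eq_zero]
      intro v hv
      by_contra hne
      obtain ⟨x, -, hx⟩ := h v hne
      have hev : Module.Dual.eval ℝ (Fin n → ℝ) v = 0 := by
        refine b.ext fun j => ?_
        have hmem : y j ∈ (Finset.univ.image y : Finset α) :=
          Finset.mem_image_of_mem y (Finset.mem_univ j)
        rw [← Finset.mem_coe, ← Finset.range_orderEmbOfFin _ hcard] at hmem
        obtain ⟨i, hi⟩ := hmem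
        have := congrFun hv i
        simp only [L, LinearMap.pi_apply, Pi.zero_apply] at this
        rw [show e i = y j from hi, hyb] at this
        simpa using this
      exact hx (by simpa using LinearMap.congr_fun hev (φ x))
    obtain ⟨v, hv⟩ := LinearMap.injective_iff_surjective.1 hL w
    exact ⟨v, fun i => congrFun hv i⟩

/-- The critical values of a differentiable function do not fill an interval. -/
theorem exists_regular_value {q : ℝ → ℝ} {U : Set ℝ} (hq : ∀ y ∈ U, DifferentiableAt ℝ q y)
    {a b : ℝ} (hab : a < b) : ∃ s ∈ Ioo a b, ∀ y ∈ U, q y = s → deriv q y ≠ 0 := by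
  by_contra! hcon
  -- The image of the set of critical points has measure zero, so it cannot contain an interval of
  -- positive length.
  have h1 : MeasureTheory.volume (q '' {y ∈ U | deriv q y = 0}) = 0 := by
    refine MeasureTheory.addHaar_image_eq_zero_of_det_fderivWithin_eq_zero MeasureTheory.volume
      (f' := fun _ => 0) (fun y hy => ?_) (fun y _ => ?_)
    · have h2 := (hq y hy.1).hasDerivAt
      rw [hy.2] at h2
      have h3 := h2.hasFDerivAt
      simp only [ContinuousLinearMap.toSpanSingleton_zero] at h3
      exact h3.hasFDerivWithinAt
    · simp [ContinuousLinearMap.det]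
  have h2 : Ioo a b ⊆ q '' {y ∈ U | deriv q y = 0} := by
    intro s hs
    obtain ⟨y, hy, hys, hd⟩ := hcon s hs
    exact ⟨y, ⟨hy, hd⟩, hys⟩
  have h3 := MeasureTheory.measure_mono_null h2 h1
  rw [Real.volume_Ioo, ENNReal.ofReal_eq_zero] at h3
  linarith

theorem exists_zero_of_mul_neg {f : ℝ → ℝ} {a b : ℝ} (hab : a < b) (hf : ContinuousOn f (Icc a b))
    (h : f a * f b < 0) : ∃ x ∈ Ioo a b, f x = 0 := by
  rcases mul_neg_iff.1 h with ⟨h1, h2⟩ | ⟨h1, h2⟩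
  · obtain ⟨x, hx, hx'⟩ := intermediate_value_Ioo' hab.le hf ⟨h2, h1⟩
    exact ⟨x, hx, hx'⟩
  · obtain ⟨x, hx, hx'⟩ := intermediate_value_Ioo hab.le hf ⟨h1, h2⟩
    exact ⟨x, hx, hx'⟩

section Linearity

variable (c s y : ℝ) (v w : Fin 8 → ℝ)

theorem fixedXi_add_smul : fixedXi (v + s • w) y = fixedXi v y + s * fixedXi w y := by
  simp only [fixedXi, ellAt, Pi.add_apply, Pi.smul_apply, smul_eq_mul]
  ring

theorem leftXi_add_smul : leftXi (v + s • w) y = leftXi v y + s * leftXi w y := by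
  simp only [leftXi, fixedXi_add_smul, ellAt, Pi.add_apply, Pi.smul_apply, smul_eq_mul]
  ring

theorem melnikov_add_smul : melnikov c (v + s • w) y = melnikov c v y + s * melnikov c w y := by
  simp only [melnikov, energyPlus, energyMinus, fixedXi_add_smul, leftXi_add_smul, ellAt,
    Pi.add_apply, Pi.smul_apply, smul_eq_mul]
  ring

/-- The Melnikov function at `y`, as a linear function of the parameters. -/
noncomputable def melnikovAt : (Fin 8 → ℝ) →ₗ[ℝ] ℝ where
  toFun v := melnikov c v y
  map_add' v w := by simpa using melnikov_add_smul c 1 y v w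
  map_smul' s w := by
    have h0 : melnikov c 0 y = 0 := by
      simpa using melnikov_add_smul c (-1) y 0 0
    simpa [h0] using melnikov_add_smul c s y 0 w

/-- This parameter leaves `fixedXi` and `leftXi` at zero, and its Melnikov function has no zeros. It
can therefore serve as the direction in which multiple zeros are perturbed into simple ones. -/
theorem melnikov_single_three {y : ℝ} (hy : 1 < y) :
    melnikov c (Pi.single 3 1) y = 2 / (2 * y ^ 2 + 3) := by
  have h1 : 2 * y ^ 2 - 1 ≠ 0 := by nlinarith
  have h2 : y ≠ 0 := by linarith
  have h3 : fixedXi (Pi.single 3 1) y = 0 := by simp [fixedXi, ellAt]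
  have h4 : leftXi (Pi.single 3 1) y = 0 := by simp [leftXi, h3, ellAt]
  simp only [melnikov, energyPlus, energyMinus, h3, h4, ellAt]
  simp
  field_simp

end Linearity

/-- There are parameters for which the Melnikov function has seven simple zeros. -/
theorem exists_seven_simple_zeros {c : ℝ} (hc : c ∈ ({-1, 0, 1} : Set ℝ)) :
    ∃ (v : Fin 8 → ℝ) (y : Fin 7 → ℝ), StrictMono y ∧ ∀ i, 1 < y i ∧ melnikov c v (y i) = 0 ∧
      deriv (melnikov c v) (y i) ≠ 0 := by
  obtain ⟨x, hx, hx1, hinterp⟩ := exists_strictMono_interpolation (melnikovAt c) (Ioi 1) (by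
    intro v hv
    by_contra! hcon
    exact hv (eq_zero_of_melnikov hc hcon))
  obtain ⟨v₀, hv₀⟩ := hinterp fun i => (-1) ^ (i : ℕ)
  let m : ℝ → ℝ := fun y => 2 / (2 * y ^ 2 + 3)
  -- After adding `s` times the parameter of index `3` the zeros are the solutions of `q y = s`, and
  -- they are simple if `s` is a regular value of `q`. With `0 < s < 1` and `0 < m < 1` the added
  -- term is below `1` and preserves the alternating signs `(-1) ^ i`.
  let q : ℝ → ℝ := fun y => -(melnikov c v₀ y / m y)
  have hmpos : ∀ y, 0 < m y := fun y => by simp only [m]; positivity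
  have hmlt : ∀ y, m y < 1 := fun y => by
    simp only [m]
    rw [div_lt_one (by positivity)]
    nlinarith [sq_nonneg y]
  have hmd : Differentiable ℝ m := fun y => by
    have : 2 * y ^ 2 + 3 ≠ 0 := by positivity
    simp only [m]
    fun_prop (disch := assumption)
  have hqd : ∀ y ∈ Ioi (1 : ℝ), DifferentiableAt ℝ q y := fun y hy =>
    ((differentiableAt_melnikov c v₀ hy).div (hmd y) (hmpos y).ne').neg
  obtain ⟨s, hs, hreg⟩ := exists_regular_value hqd (zero_lt_one (α := ℝ))
  let v : Fin 8 → ℝ := v₀ + s • Pi.single 3 1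
  have hv : ∀ y, 1 < y → melnikov c v y = m y * (s - q y) := by
    intro y hy
    simp only [v, q]
    rw [melnikov_add_smul, melnikov_single_three c hy]
    have := (hmpos y).ne'
    simp only [m] at this ⊢
    field_simp
    ring
  have hsign : ∀ i : Fin 7, melnikov c v (x i.castSucc) * melnikov c v (x i.succ) < 0 := by
    intro i
    have h1 : ∀ j, melnikov c v (x j) = (-1) ^ (j : ℕ) + s * m (x j) := by
      intro j
      have h2 : melnikov c v₀ (x j) = (-1) ^ (j : ℕ) := hv₀ j
      have h3 := melnikov_add_smul c s (x j) v₀ (Pi.single 3 1)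
      rw [h2, melnikov_single_three c (hx1 j)] at h3
      exact h3
    have h3 : ∀ y, 0 < s * m y ∧ s * m y < 1 := fun y =>
      ⟨mul_pos hs.1 (hmpos y), by nlinarith [hs.1, hs.2, hmpos y, hmlt y]⟩
    rw [h1, h1, Fin.val_castSucc, Fin.val_succ, pow_succ]
    have h4 := h3 (x i.castSucc)
    have h5 := h3 (x i.succ)
    rcases neg_one_pow_eq_or ℝ (i : ℕ) with h | h <;> rw [h] <;> nlinarith
  have hroot : ∀ i : Fin 7, ∃ y ∈ Ioo (x i.castSucc) (x i.succ), melnikov c v y = 0 := by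
    intro i
    refine exists_zero_of_mul_neg (hx Fin.castSucc_lt_succ) (fun y hy => ?_) (hsign i)
    exact (differentiableAt_melnikov c v
      (lt_of_lt_of_le (hx1 _) hy.1)).continuousAt.continuousWithinAt
  choose y hy hy0 using hroot
  have hy1 : ∀ i, 1 < y i := fun i => lt_trans (hx1 _) (hy i).1
  refine ⟨v, y, fun i j hij => ?_, fun i => ⟨hy1 i, hy0 i, ?_⟩⟩
  · refine (hy i).2.trans_le (le_trans (hx.monotone ?_) (hy j).1.le)
    exact Fin.succ_le_castSucc_iff.2 hij
  · have h1 : q (y i) = s := by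
      have := hy0 i
      rw [hv _ (hy1 i)] at this
      linarith [(mul_eq_zero.1 this).resolve_left (hmpos _).ne']
    have h2 := hreg _ (hy1 i) h1
    have h3 : HasDerivAt (melnikov c v) (m (y i) * -deriv q (y i)) (y i) := by
      have h4 := ((hmd (y i)).hasDerivAt).mul
        (((hqd _ (hy1 i)).hasDerivAt).const_sub s)
      rw [h1, sub_self, mul_zero, zero_add] at h4
      refine h4.congr_of_eventuallyEq ?_
      filter_upwards [lt_mem_nhds (hy1 i)] with t ht
      rw [hv t ht]
      rfl
    rw [h3.deriv]
    exact mul_ne_zero (hmpos _).ne' (neg_ne_zero.2 h2)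

/-! ### Distinctness of the cycles and conclusion -/

theorem injective_unperturbedOrbit {y y' : ℝ} (hy : 1 < y) (hy' : 1 < y')
    (h : unperturbedOrbit y = unperturbedOrbit y') : y = y' := by
  have h1 : circlePlus y 0 ∈ unperturbedOrbit y := by
    rw [circlePlus_zero]; exact (isTwoArc_unperturbed 0 0 hy).R_mem_arcs
  have h2 := h1
  rw [h, mem_unperturbedOrbit_iff hy'] at h2
  rw [mem_unperturbedOrbit_iff hy] at h1
  exact (pow_left_inj₀ (by linarith) (by linarith) two_ne_zero).1 (h1.2.symm.trans h2.2)

/-- If families of sets converge to distinct closed sets, then they are eventually distinct. -/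
theorem eventually_injective_of_tendsto_hausdorffEDist {X ι β : Type*} [PseudoEMetricSpace X]
    [Finite ι] {l : Filter β} {Γ : β → ι → Set X} {Γ₀ : ι → Set X}
    (hclosed : ∀ i, IsClosed (Γ₀ i)) (hinj : Function.Injective Γ₀)
    (h : ∀ i, Tendsto (fun ε => Metric.hausdorffEDist (Γ ε i) (Γ₀ i)) l (𝓝 0)) :
    ∀ᶠ ε in l, Function.Injective (Γ ε) := by
  have key : ∀ i j, i ≠ j → ∀ᶠ ε in l, Γ ε i ≠ Γ ε j := by
    intro i j hij
    have hpos : 0 < Metric.hausdorffEDist (Γ₀ i) (Γ₀ j) := by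
      rw [pos_iff_ne_zero, Ne, (hclosed i).hausdorffEDist_zero_iff (hclosed j)]
      exact fun h => hij (hinj h)
    have hsum := (h i).add (h j)
    rw [add_zero] at hsum
    filter_upwards [hsum.eventually_lt_const hpos] with ε hε heq
    refine absurd hε (not_lt.2 ?_)
    calc Metric.hausdorffEDist (Γ₀ i) (Γ₀ j)
        ≤ Metric.hausdorffEDist (Γ₀ i) (Γ ε i) + Metric.hausdorffEDist (Γ ε i) (Γ₀ j) :=
          Metric.hausdorffEDist_triangle
      _ = Metric.hausdorffEDist (Γ ε i) (Γ₀ i) + Metric.hausdorffEDist (Γ ε j) (Γ₀ j) := by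
          rw [Metric.hausdorffEDist_comm, heq]
  have hall : ∀ᶠ ε in l, ∀ i j, i ≠ j → Γ ε i ≠ Γ ε j :=
    eventually_all.2 fun i => eventually_all.2 fun j => eventually_imp_distrib_left.2 (key i j)
  filter_upwards [hall] with ε hε i j hij
  by_contra hne
  exact hε i j hne hij

theorem theorem3 (c d : ℝ) (hc : c ∈ ({-1, 0, 1} : Set ℝ)) (hd : d ∈ ({-1, 0, 1} : Set ℝ)) :
    -- the invariant plane and its period annulus, for the unperturbed system
    ((unperturbedSystem c d).IsInvariant planeS ∧
      annulusOne ∪ annulusTwo ⊆ planeS ∧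
      (unperturbedSystem c d).IsPeriodAnnulus (annulusOne ∪ annulusTwo) ∧
      ∀ Γ, (unperturbedSystem c d).IsCrossingPeriodicOrbit Γ → Γ ⊆ annulusOne ∪ annulusTwo) ∧
    -- an affine perturbation with seven limit cycles
    ∃ (bp bm : Space3) (Ap Am : Matrix (Fin 3) (Fin 3) ℝ) (Γ₀ : Fin 7 → Set Space3)
      (Γ : ℝ → Fin 7 → Set Space3) (ε₀ : ℝ),
      0 < ε₀ ∧
      Function.Injective Γ₀ ∧
      (∀ i, (unperturbedSystem c d).IsCrossingPeriodicOrbit (Γ₀ i) ∧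
        Γ₀ i ⊆ annulusOne ∪ annulusTwo) ∧
      (∀ ε : ℝ, 0 < |ε| → |ε| < ε₀ →
        Function.Injective (Γ ε) ∧
        ∀ i, (perturbedSystem c d bp bm Ap Am ε).IsLimitCycle (Γ ε i)) ∧
      ∀ i, Tendsto (fun ε => Metric.hausdorffEDist (Γ ε i) (Γ₀ i)) (𝓝[≠] 0) (𝓝 0) := by
  refine ⟨⟨isInvariant_planeS c d, annulus_subset_planeS, isPeriodAnnulus_unperturbed c d,
    fun Γ hΓ => crossingPeriodicOrbit_subset_annulus hΓ⟩, ?_⟩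
  obtain ⟨v, y, hy, hzero⟩ := exists_seven_simple_zeros hc
  have hex := fun i => exists_limitCycle_of_melnikov c d v (hzero i).1 (hzero i).2.1
    (differentiableAt_melnikov c v (hzero i).1).hasDerivAt (hzero i).2.2
  choose Γ hΓ hlim using hex
  have hinj₀ : Function.Injective fun i => unperturbedOrbit (y i) := fun i j hij =>
    hy.injective (injective_unperturbedOrbit (hzero i).1 (hzero j).1 hij)
  have hinj := eventually_injective_of_tendsto_hausdorffEDist (Γ := fun ε i => Γ i ε)
    (fun i => (isTwoArc_unperturbed c d (hzero i).1).isCompact_arcs.isClosed) hinj₀ hlim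
  obtain ⟨ε₀, hε₀, hε⟩ := Metric.eventually_nhds_iff.1
    (eventually_nhdsWithin_iff.1 (hinj.and (eventually_all.2 hΓ)))
  -- The vectors and matrices are those in the definition of `familySystem`; the radius `ε₀` serves
  -- all seven cycles and their distinctness together.
  refine ⟨![-(v 0 + v 1), 0, -v 0 + v 3 + v 4], ![0, 0, v 6],
    !![0, v 2 - v 1, -(v 2 + v 1); 0, v 5, 0; 0, -v 1, -v 2 + v 4],
    !![0, 0, 0; 0, v 7, 0; 0, 0, 0], fun i => unperturbedOrbit (y i), fun ε i => Γ i ε, ε₀, hε₀, hinj₀,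
    fun i => ⟨isCrossingPeriodicOrbit_unperturbedOrbit c d (hzero i).1,
      unperturbedOrbit_subset (hzero i).1⟩, fun ε h0 h1 => ?_, hlim⟩
  exact hε (by rwa [Real.dist_eq, sub_zero]) (abs_pos.1 h0)
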